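/- Let $g\in C^1([0,\infty))$ satisfy $g'<0$ on $[0,\infty)$ and $g(0)=0$ (umbilical constant $\alpha=0$), and let $b:=\lim_{t\to\infty}g(t)\in[-\infty,0)$. Let $\mathcal W_g$ be the elliptic Weingarten class of oriented surfaces in $\mathbb R^3$ whose principal curvatures $\kappa_1\ge\kappa_2$ satisfy $\kappa_1\ge 0$ and $\kappa_2=g(\kappa_1)$ at every point. Let $f:(b,\infty)\to(b,\infty)$ be equal to $g$ on $[0,\infty)$ and to $g^{-1}$ on $(b,0]$, and let $\mathcal G(\lambda)=\lambda\, e^{\mathcal F(\lambda)}$ on $(b,\infty)\setminus\{0\}$, where $\mathcal F$ is any primitive of $1/(f(\lambda)-\lambda)$; write $\mathcal G(\infty)$ and $\mathcal G(b)$ for its limits as $\lambda\to\infty$ and as $\lambda\to b^+$. By a rotational surface we mean a connected oriented $C^2$ surface without boundary generated by rotating around the $z$-axis a curve $(x(s),0,z(s))$ with $x\ge 0$, parametrized by arc length on an interval (and $C^2$ also at points on the axis, if there are any). The following rotational surfaces of $\mathcal W_g$ are considered. - A *special catenoid* of necksize $\tau>0$ is a complete embedded surface of $\mathcal W_g$ obtained,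 up to a vertical translation, by rotating a convex curve $(\xi(z),0,z)$, $z\in(-z_1,z_1)$, $0<z_1\le\infty$, where $\xi$ is $C^2$, positive and even, has minimum $\tau=\xi(0)$, and $\xi(z)\to\infty$ as $z\to\pm z_1$. It is denoted $C_\tau^+$ if its unit normal is the interior one (pointing towards the axis) and $C_\tau^-$ if it is the exterior one. - A *pinched special catenoid* is a surface of $\mathcal W_g$ that is a rotational $C^2$ graph $z=u(r)$ over the whole punctured plane $r>0$ with convex profile curve ($u$ is convex or concave), such that $u$ has a finite limit as $r\to0$ but the graph does not extend to a $C^2$ surface across $r=0$ (it has an isolated singularity on the axis). - A *singular special catenoid* is a surface of $\mathcal W_g$ that is a rotational $C^2$ graph $z=u(r)$ over the exterior $r>d$ of a circle, $d>0$, with convex profile curve ($u$ is convex or concave), such that $u$ has a finite limit as $r\to d$ while the second fundamental form blows up there ($\kappa_1^2+\kappa_2^2\to\infty$ as $r\to d$). **Theorem.** Every rotational surface in $\mathcal W_g$ is an open piece of one of the following surfaces: 1. a plane (orthogonal to the $z$-axis); 2. a special catenoid $C_\tau^+$ or $C_\tau^-$ for some $\tau>0$; 3. a pinched special catenoid; 4.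 a singular special catenoid. Moreover, a pinched special catenoid exists in $\mathcal W_g$ if and only if either $|\mathcal G(\infty)|<\infty$, or $b=-\infty$ and $|\mathcal G(b)|<\infty$; and a singular special catenoid exists in $\mathcal W_g$ if and only if $b\ne-\infty$ and $|\mathcal G(b)|<\infty$. -/

import Mathlib

namespace Weingarten

noncomputable section

/-- Euclidean three-space. -/
abbrev E3 : Type := EuclideanSpace ℝ (Fin 3)

/-! Principal curvatures of a parametrized oriented surface. -/

/-- First fundamental form of the parametrization `X` at `q`. -/
def firstForm (X : ℝ × ℝ → E3) (q v w : ℝ × ℝ) : ℝ :=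
  inner ℝ (fderiv ℝ X q v) (fderiv ℝ X q w)

/-- Second fundamental form of the parametrization `X` at `q`, for the unit normal `ν` at `q`. -/
def secondForm (X : ℝ × ℝ → E3) (ν : E3) (q v w : ℝ × ℝ) : ℝ :=
  inner ℝ (fderiv ℝ (fderiv ℝ X) q v w) ν

/-- Determinant `EG - F²` of the first fundamental form. -/
def areaSq (X : ℝ × ℝ → E3) (q : ℝ × ℝ) : ℝ :=
  firstForm X q (1, 0) (1, 0) * firstForm X q (0, 1) (0, 1) - firstForm X q (1, 0) (0, 1) ^ 2

/-- Mean curvature. -/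
def meanCurv (X : ℝ × ℝ → E3) (ν : E3) (q : ℝ × ℝ) : ℝ :=
  (secondForm X ν q (1, 0) (1, 0) * firstForm X q (0, 1) (0, 1)
    - 2 * secondForm X ν q (1, 0) (0, 1) * firstForm X q (1, 0) (0, 1)
    + secondForm X ν q (0, 1) (0, 1) * firstForm X q (1, 0) (1, 0)) / (2 * areaSq X q)

/-- Gauss curvature. -/
def gaussCurv (X : ℝ × ℝ → E3) (ν : E3) (q : ℝ × ℝ) : ℝ :=
  (secondForm X ν q (1, 0) (1, 0) * secondForm X ν q (0, 1) (0, 1)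
    - secondForm X ν q (1, 0) (0, 1) ^ 2) / areaSq X q

/-- The larger principal curvature `κ₁`. -/
def kappa1 (X : ℝ × ℝ → E3) (ν : E3) (q : ℝ × ℝ) : ℝ :=
  meanCurv X ν q + Real.sqrt (meanCurv X ν q ^ 2 - gaussCurv X ν q)

/-- The smaller principal curvature `κ₂`. -/
def kappa2 (X : ℝ × ℝ → E3) (ν : E3) (q : ℝ × ℝ) : ℝ :=
  meanCurv X ν q - Real.sqrt (meanCurv X ν q ^ 2 - gaussCurv X ν q)

/-! Elliptic Weingarten classes. -/

/-- An elliptic Weingarten relation `κ₂ = g(κ₁)`: `g` is `C¹` on `[α, ∞)`, `g' < 0` there, and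
`g(α) = α`. The values of `g` outside `[α, ∞)` play no role. -/
structure EllipticClass where
  α : ℝ
  g : ℝ → ℝ
  contDiffOn : ContDiffOn ℝ 1 g (Set.Ici α)
  deriv_neg : ∀ t ∈ Set.Ici α, derivWithin g (Set.Ici α) t < 0
  fixed : g α = α

/-- `b = g(∞)`, the limit of `g` at `∞` in `[-∞, ∞]` (it exists, since `g` is decreasing). -/
def EllipticClass.b (W : EllipticClass) : EReal :=
  Filter.limUnder Filter.atTop (fun t : ℝ => (W.g t : EReal))

/-- The function `f` on `(b, ∞)`: equal to `g` on `[α, ∞)` and to `g⁻¹` on `(b, α]`. -/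
def EllipticClass.f (W : EllipticClass) (t : ℝ) : ℝ :=
  open Classical in
  if W.α ≤ t then W.g t else Function.invFunOn W.g (Set.Ici W.α) t

/-- `G` is a function `𝓖(λ) = λ exp F(λ)` on `(b, ∞) \ {α}`, with `F` a primitive of
`1 / (f(λ) - λ)` there. -/
def IsGFunction (W : EllipticClass) (G : ℝ → ℝ) : Prop :=
  ∃ F : ℝ → ℝ, ∀ t : ℝ, W.b < (t : EReal) → t ≠ W.α →
    HasDerivAt F (1 / (W.f t - t)) t ∧ G t = t * Real.exp (F t)

/-- `|𝓖(Λ)| < ∞` for `Λ = ∞`: the limit of `𝓖` at `∞` is finite. -/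
def FiniteAtTop (G : ℝ → ℝ) : Prop :=
  ∃ L : ℝ, Filter.Tendsto G Filter.atTop (nhds L)

/-- `|𝓖(Λ)| < ∞` for `Λ = b`: the limit of `𝓖(t)` as the real number `t > b` tends to `b` in
`[-∞, ∞]` is finite. -/
def FiniteAtB (W : EllipticClass) (G : ℝ → ℝ) : Prop :=
  ∃ L : ℝ, Filter.Tendsto G
    (Filter.comap (fun t : ℝ => (t : EReal)) (nhdsWithin W.b (Set.Ioi W.b))) (nhds L)

/-! Rotational surfaces. -/

/-- A connected oriented rotational `C²` surface (without boundary, possibly with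
self-intersections), given by the rotation about the `z`-axis of a profile curve
`s ↦ (x(s), 0, z(s))`, `s ∈ J`, parametrized by arc length, with `x ≥ 0`, and so directed that the
unit normal along the curve is the tangent vector turned by `π/2`. Derivatives within the interval
`J` are one-sided at an endpoint. -/
structure RotSurface where
  J : Set ℝ
  x : ℝ → ℝ
  z : ℝ → ℝ
  interval : J.OrdConnected
  nontrivial : J.Nontrivial
  contDiffOn_x : ContDiffOn ℝ 2 x J
  contDiffOn_z : ContDiffOn ℝ 2 z J
  nonneg : ∀ s ∈ J, 0 ≤ x s
  arcLength : ∀ s ∈ J, derivWithin x J s ^ 2 + derivWithin z J s ^ 2 = 1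
  /-- The surface has no boundary: only points of the axis can be ends of the profile curve. -/
  mem_interior : ∀ s ∈ J, 0 < x s → s ∈ interior J
  /-- Near a point on the axis, the surface is the graph of a (radial) `C²` function on a disk. -/
  regular_on_axis : ∀ s ∈ J, x s = 0 → ∃ w : ℝ → ℝ,
    ContDiffAt ℝ 2 (fun p : EuclideanSpace ℝ (Fin 2) => w ‖p‖) 0 ∧
      ∀ᶠ t in nhdsWithin s J, z t = w (x t)

namespace RotSurface

/-- The parametrization `(s, θ) ↦ (x(s) cos θ, x(s) sin θ, z(s))`. -/
def param (S : RotSurface) (q : ℝ × ℝ) : E3 :=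
  !₂[S.x q.1 * Real.cos q.2, S.x q.1 * Real.sin q.2, S.z q.1]

/-- The unit normal `(- z'(s) cos θ, - z'(s) sin θ, x'(s))`. -/
def normal (S : RotSurface) (q : ℝ × ℝ) : E3 :=
  !₂[- derivWithin S.z S.J q.1 * Real.cos q.2, - derivWithin S.z S.J q.1 * Real.sin q.2,
    derivWithin S.x S.J q.1]

/-- The surface as a set of points. -/
def carrier (S : RotSurface) : Set E3 := S.param '' (S.J ×ˢ Set.univ)

/-- The trace `{(x(s), z(s))}` of the profile curve. -/
def trace (S : RotSurface) : Set (ℝ × ℝ) := (fun s => (S.x s, S.z s)) '' S.J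

/-- The surface belongs to the class `𝓦_g`: `κ₁ ∈ [α, ∞)` and `κ₂ = g(κ₁)`. The relation is
written at the points off the axis; at the (at most two) points on the axis it then holds too, as
the surface is `C²` and `g` is continuous. -/
def InClass (W : EllipticClass) (S : RotSurface) : Prop :=
  ∀ s ∈ S.J, 0 < S.x s → ∀ θ : ℝ,
    W.α ≤ kappa1 S.param (S.normal (s, θ)) (s, θ) ∧
    kappa2 S.param (S.normal (s, θ)) (s, θ) = W.g (kappa1 S.param (S.normal (s, θ)) (s, θ))

/-- `S` is an open piece of `T`: the profile curve of `S` is, up to a shift of the arc length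
parameter, the restriction of that of `T` to a subinterval (so the unit normals agree as well). -/
def IsOpenPiece (S T : RotSurface) : Prop :=
  ∃ c : ℝ, ∀ s ∈ S.J, s + c ∈ T.J ∧ S.x s = T.x (s + c) ∧ S.z s = T.z (s + c)

/-- `T` is a plane (orthogonal to the axis). -/
def IsPlane (T : RotSurface) : Prop :=
  ∃ c : ℝ, T.carrier = {p : E3 | p 2 = c}

/-- `T` is a complete surface of the class, whose profile is a convex curve `(ξ(h), 0, c + h)`,
`h ∈ (-z₁, z₁)`, `z₁ ∈ (0, ∞]`, with `ξ` positive, even, tending to `∞` at the ends, and with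
minimum `τ = ξ(0)`. -/
def IsSpecialCatenoid (W : EllipticClass) (τ : ℝ) (T : RotSurface) : Prop :=
  T.InClass W ∧ T.J = Set.univ ∧
  ∃ (c : ℝ) (z₁ : EReal) (ξ : ℝ → ℝ), 0 < z₁ ∧
    T.trace = (fun h => (ξ h, c + h)) '' {h : ℝ | ((|h| : ℝ) : EReal) < z₁} ∧
    ContDiffOn ℝ 2 ξ {h : ℝ | ((|h| : ℝ) : EReal) < z₁} ∧
    ConvexOn ℝ {h : ℝ | ((|h| : ℝ) : EReal) < z₁} ξ ∧
    (∀ h : ℝ, ((|h| : ℝ) : EReal) < z₁ → 0 < ξ h ∧ ξ (-h) = ξ h ∧ τ ≤ ξ h) ∧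
    ξ 0 = τ ∧
    Filter.Tendsto ξ
      (Filter.comap (fun h : ℝ => (h : EReal)) (nhdsWithin z₁ (Set.Iio z₁))) Filter.atTop

/-- `C_τ⁺`: the special catenoid of necksize `τ` with interior unit normal (that is, the radial
component `- z'` of the normal is negative). -/
def IsCatenoidPlus (W : EllipticClass) (τ : ℝ) (T : RotSurface) : Prop :=
  T.IsSpecialCatenoid W τ ∧ ∀ s ∈ T.J, 0 < derivWithin T.z T.J s

/-- `C_τ⁻`: the special catenoid of necksize `τ` with exterior unit normal. -/
def IsCatenoidMinus (W : EllipticClass) (τ : ℝ) (T : RotSurface) : Prop :=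
  T.IsSpecialCatenoid W τ ∧ ∀ s ∈ T.J, derivWithin T.z T.J s < 0

/-- Pinched special catenoid: a surface of the class that is a graph `z = u(r)` over the whole
plane minus the origin, with convex profile curve, that extends continuously to the origin and has
a singularity there, i.e. it does not extend as a `C²` surface. -/
def IsPinchedCatenoid (W : EllipticClass) (T : RotSurface) : Prop :=
  T.InClass W ∧
  ∃ u : ℝ → ℝ,
    T.trace = (fun r => (r, u r)) '' Set.Ioi 0 ∧
    ContDiffOn ℝ 2 u (Set.Ioi 0) ∧
    (ConvexOn ℝ (Set.Ioi 0) u ∨ ConcaveOn ℝ (Set.Ioi 0) u) ∧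
    ContinuousWithinAt u (Set.Ioi 0) 0 ∧
    ¬ ContDiffAt ℝ 2 (fun p : EuclideanSpace ℝ (Fin 2) => u ‖p‖) 0

/-- Singular special catenoid: a surface of the class that is a graph `z = u(r)` over the exterior
of a circle `r = d`, with convex profile curve, that extends continuously to the boundary circle,
and whose second fundamental form blows up there (`κ₁² + κ₂² → ∞`). -/
def IsSingularCatenoid (W : EllipticClass) (T : RotSurface) : Prop :=
  T.InClass W ∧
  ∃ (d : ℝ) (u : ℝ → ℝ), 0 < d ∧
    T.trace = (fun r => (r, u r)) '' Set.Ioi d ∧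
    ContDiffOn ℝ 2 u (Set.Ioi d) ∧
    (ConvexOn ℝ (Set.Ioi d) u ∨ ConcaveOn ℝ (Set.Ioi d) u) ∧
    ContinuousWithinAt u (Set.Ioi d) d ∧
    Filter.Tendsto
      (fun s => kappa1 T.param (T.normal (s, 0)) (s, 0) ^ 2
        + kappa2 T.param (T.normal (s, 0)) (s, 0) ^ 2)
      (Filter.comap T.x (nhds d) ⊓ Filter.principal T.J) Filter.atTop

end RotSurface

end

end Weingarten

namespace Weingarten

noncomputable section

open Set Filter Topology

/-! ### Calculus on open intervals -/

/-! Along the profile let `λ = z'/x` be the rotational principal curvature and `k` the curvature of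
the curve. The class does not say which of the two is the larger one, but membership is equivalent
to `b < λ` and `k = f(λ)` (`relation_iff`, `inClass_iff`), so the profile solves an ODE. The Codazzi
equation is `λ' = x'(k - λ)/x`, and `|f(λ)| ≤ K|λ|` along compact arcs, so a single zero of `λ`
forces `λ = 0` everywhere (`rotCurv_eq_zero`): the surface is horizontal. Otherwise `λ` has a
constant sign `σ`, and a reflection reduces to `λ ∈ (0, B)` and `k = -p(λ)` with `p` positive and
increasing (`IsRate`), where `B = ∞` for `σ = 1` and `B = -b` for `σ = -1`.

Now the Codazzi equation integrates to `x = C exp F(λ)`. Since the sine of the angle is `xλ`, also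
`sin = C 𝓖(λ)` (`IsProfile.exists_const`). As `p` is comparable to the identity at `0`, `F`
decreases from `∞` and `𝓖` increases from `0`. The cosine `c = x'` increases along the profile, so
`λ`, `x`, `z` and the arc length are functions of `c` (`IsModel`), and `C` determines the curve up
to translations of height and arc length (`IsModel.exists_shift`).

If `C 𝓖` takes the value `1`, then `c` runs over `(-1, 1)` and the model is a special catenoid
(`IsPrim.exists_catenoid`). If `C 𝓖 < 1` throughout, then `c` never vanishes, the model is a graph,
and `λ` runs over all of `(0, B)` (`IsPrim.exists_graph`). For `B = ∞` the radius is at most `1/λ`,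
so the graph reaches the axis, with nonzero slope: it is pinched. For finite `B` the function `F` is
bounded below, so the radius stays above some `d > 0` while `p(λ)` blows up: it is singular.

A graph therefore exists as soon as `𝓖` is bounded, by taking `C` small. Conversely, a pinched
catenoid forces `B = ∞` and `𝓖 ≤ 1/C` (`bound_eq_top_of_isProfile`). A singular one excludes `b =
-∞`, as `p` would be bounded on `λ ≤ 1/d` (`IsSingularCatenoid.b_ne_bot`); and for finite `b` the
boundedness of `𝓖` at `b` is automatic (`IsPrim.exists_gFun_le`). -/

theorem exists_primitive {U : Set ℝ} (hU : IsOpen U) (hc : U.OrdConnected) {f : ℝ → ℝ}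
    (hf : ContinuousOn f U) {a : ℝ} (ha : a ∈ U) :
    ∃ F : ℝ → ℝ, F a = 0 ∧ ∀ t ∈ U, HasDerivAt F (f t) t := by
  refine ⟨fun u => ∫ x in a..u, f x, by simp, fun t ht => ?_⟩
  refine intervalIntegral.integral_hasDerivAt_right ?_ ?_ (hf.continuousAt (hU.mem_nhds ht))
  · exact (hf.mono (hc.uIcc_subset ha ht)).intervalIntegrable
  · exact hf.stronglyMeasurableAtFilter hU t ht

theorem strictMonoOn_of_hasDerivAt_pos {U : Set ℝ} (hU : IsOpen U) (hc : U.OrdConnected)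
    {f f' : ℝ → ℝ} (hd : ∀ t ∈ U, HasDerivAt f (f' t) t) (hp : ∀ t ∈ U, 0 < f' t) :
    StrictMonoOn f U := by
  refine strictMonoOn_of_deriv_pos hc.convex
    (fun t ht => (hd t ht).continuousAt.continuousWithinAt) fun t ht => ?_
  rw [hU.interior_eq] at ht
  rw [(hd t ht).deriv]
  exact hp t ht

theorem monotoneOn_of_hasDerivAt_nonneg {U : Set ℝ} (hU : IsOpen U) (hc : U.OrdConnected)
    {f f' : ℝ → ℝ} (hd : ∀ t ∈ U, HasDerivAt f (f' t) t) (hp : ∀ t ∈ U, 0 ≤ f' t) :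
    MonotoneOn f U := by
  refine monotoneOn_of_deriv_nonneg hc.convex
    (fun t ht => (hd t ht).continuousAt.continuousWithinAt)
    (fun t ht => (hd t (interior_subset ht)).differentiableAt.differentiableWithinAt)
    fun t ht => ?_
  rw [hU.interior_eq] at ht
  rw [(hd t ht).deriv]
  exact hp t ht

theorem antitoneOn_of_hasDerivAt_nonpos {U : Set ℝ} (hU : IsOpen U) (hc : U.OrdConnected)
    {f f' : ℝ → ℝ} (hd : ∀ t ∈ U, HasDerivAt f (f' t) t) (hp : ∀ t ∈ U, f' t ≤ 0) :
    AntitoneOn f U := by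
  have := monotoneOn_of_hasDerivAt_nonneg hU hc (f := fun t => - f t) (f' := fun t => - f' t)
    (fun t ht => (hd t ht).neg) (fun t ht => by linarith [hp t ht])
  intro a ha b hb hab
  have := this ha hb hab
  simp only at this
  linarith

theorem eq_of_hasDerivWithinAt_zero {J : Set ℝ} (hc : J.OrdConnected) {f : ℝ → ℝ}
    (hd : ∀ t ∈ J, HasDerivWithinAt f 0 J t) {a b : ℝ} (ha : a ∈ J) (hb : b ∈ J) : f a = f b := by
  have := Convex.norm_image_sub_le_of_norm_hasDerivWithin_le (f' := fun _ => (0 : ℝ)) (C := 0) hd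
    (by simp) hc.convex hb ha
  simp only [zero_mul, norm_le_zero_iff] at this
  linarith

theorem eq_of_hasDerivAt_zero {J : Set ℝ} (hc : J.OrdConnected) {f : ℝ → ℝ}
    (hd : ∀ t ∈ J, HasDerivAt f 0 t) {a b : ℝ} (ha : a ∈ J) (hb : b ∈ J) : f a = f b :=
  eq_of_hasDerivWithinAt_zero hc (fun t ht => (hd t ht).hasDerivWithinAt) ha hb

/-- The inverse function theorem for an increasing function on an open interval. -/
theorem exists_inverse {U : Set ℝ} (hU : IsOpen U) (hc : U.OrdConnected)
    {h h' : ℝ → ℝ} (hd : ∀ t ∈ U, HasDerivAt h (h' t) t) (hp : ∀ t ∈ U, 0 < h' t) :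
    IsOpen (h '' U) ∧ (h '' U).OrdConnected ∧
      ∃ k : ℝ → ℝ, (∀ t ∈ U, k (h t) = t) ∧ ∀ y ∈ h '' U, HasDerivAt k (h' (k y))⁻¹ y := by
  have hm := strictMonoOn_of_hasDerivAt_pos hU hc hd hp
  have hcont : ContinuousOn h U := fun t ht => (hd t ht).continuousAt.continuousWithinAt
  have hoc : (h '' U).OrdConnected := (hc.isPreconnected.image h hcont).ordConnected
  have hopen : IsOpen (h '' U) := by
    rw [isOpen_iff_mem_nhds]
    rintro _ ⟨t, ht, rfl⟩
    obtain ⟨e, he, hball⟩ := Metric.isOpen_iff.1 hU t ht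
    have h1 : t - e / 2 ∈ U := hball (by simp [abs_of_pos, he])
    have h2 : t + e / 2 ∈ U := hball (by simp [abs_of_pos, he])
    refine mem_of_superset (Ioo_mem_nhds (hm h1 ht (by linarith)) (hm ht h2 (by linarith)))
      (Ioo_subset_Icc_self.trans (hoc.out (mem_image_of_mem h h1) (mem_image_of_mem h h2)))
  refine ⟨hopen, hoc, Function.invFunOn h U, hm.injOn.leftInvOn_invFunOn, ?_⟩
  have hinv := hm.injOn.leftInvOn_invFunOn
  rintro _ ⟨t, ht, rfl⟩
  have hkm : StrictMonoOn (Function.invFunOn h U) (h '' U) := by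
    rintro _ ⟨u, hu, rfl⟩ _ ⟨v, hv, rfl⟩ huv
    rw [hinv hu, hinv hv]
    exact (hm.lt_iff_lt hu hv).1 huv
  have hki : Function.invFunOn h U '' (h '' U) = U := by
    rw [image_image]
    exact (image_congr fun u hu => hinv hu).trans (image_id _)
  have hk : Function.invFunOn h U (h t) = t := hinv ht
  refine HasDerivAt.of_local_left_inverse (f := h) ?_ ?_ (hp _ (by rwa [hk])).ne' ?_
  -- A monotone function is continuous where its image is a neighbourhood of its value; here the
  -- image is `U` itself.
  · refine hkm.continuousAt_of_image_mem_nhds (hopen.mem_nhds (mem_image_of_mem h ht)) ?_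
    rw [hki, hk]
    exact hU.mem_nhds ht
  · exact hd _ (by rwa [hk])
  · filter_upwards [hopen.mem_nhds (mem_image_of_mem h ht)] with y hy
    exact Function.invFunOn_eq hy

theorem contDiffOn_two_of_hasDerivAt {U : Set ℝ} (hU : IsOpen U) {f f₁ f₂ : ℝ → ℝ}
    (h₁ : ∀ t ∈ U, HasDerivAt f (f₁ t) t) (h₂ : ∀ t ∈ U, HasDerivAt f₁ (f₂ t) t)
    (hc : ContinuousOn f₂ U) : ContDiffOn ℝ 2 f U := by
  have e₁ : ∀ t ∈ U, deriv f t = f₁ t := fun t ht => (h₁ t ht).deriv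
  have e₂ : ∀ t ∈ U, deriv f₁ t = f₂ t := fun t ht => (h₂ t ht).deriv
  have A : ContDiffOn ℝ 1 f₁ U := by
    rw [show (1 : WithTop ℕ∞) = 0 + 1 by norm_num, contDiffOn_succ_iff_deriv_of_isOpen hU]
    refine ⟨fun t ht => (h₂ t ht).differentiableAt.differentiableWithinAt, by simp, ?_⟩
    rw [contDiffOn_zero]
    exact hc.congr e₂
  rw [show (2 : WithTop ℕ∞) = 1 + 1 by norm_num, contDiffOn_succ_iff_deriv_of_isOpen hU]
  exact ⟨fun t ht => (h₁ t ht).differentiableAt.differentiableWithinAt, by simp, A.congr e₁⟩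

theorem convexOn_of_hasDerivAt_of_monotoneOn {U : Set ℝ} (hU : IsOpen U) (hc : U.OrdConnected)
    {f f' : ℝ → ℝ} (hd : ∀ t ∈ U, HasDerivAt f (f' t) t) (hm : MonotoneOn f' U) :
    ConvexOn ℝ U f := by
  refine MonotoneOn.convexOn_of_deriv hc.convex
    (fun t ht => (hd t ht).continuousAt.continuousWithinAt)
    (fun t ht => (hd t (interior_subset ht)).differentiableAt.differentiableWithinAt) ?_
  rw [hU.interior_eq]
  exact hm.congr fun t ht => (hd t ht).deriv.symm

/-! ### Intervals and limits at their ends -/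

/-- An open interval that is symmetric about `0` is of the form `{h | |h| < z₁}`. -/
theorem exists_eq_abs_lt {U : Set ℝ} (hU : IsOpen U) (hc : U.OrdConnected) (h0 : (0 : ℝ) ∈ U)
    (hs : ∀ h ∈ U, -h ∈ U) : ∃ z₁ : EReal, 0 < z₁ ∧ U = {h : ℝ | ((|h| : ℝ) : EReal) < z₁} := by
  have habs : ∀ h ∈ U, |h| ∈ U := fun h hh => by
    rcases abs_choice h with e | e <;> rw [e]
    exacts [hh, hs h hh]
  -- The end `z₁` is the supremum of `U` in the extended reals; it is not attained because `U` is
  -- open.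
  have hlt : ∀ h ∈ U, ((|h| : ℝ) : EReal) < sSup ((fun t : ℝ => (t : EReal)) '' U) := by
    intro h hh
    obtain ⟨e, he, hball⟩ := Metric.isOpen_iff.1 hU _ (habs h hh)
    have h1 : |h| + e / 2 ∈ U := hball (by simp [abs_of_pos, he])
    refine lt_of_lt_of_le (EReal.coe_lt_coe_iff.2 (by linarith)) (le_sSup (mem_image_of_mem _ h1))
  refine ⟨_, by simpa using hlt 0 h0, Subset.antisymm hlt fun h hh => ?_⟩
  have hh' : ((|h| : ℝ) : EReal) < sSup ((fun t : ℝ => (t : EReal)) '' U) := hh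
  obtain ⟨_, ⟨u, hu, rfl⟩, hlu⟩ := lt_sSup_iff.1 hh'
  have := abs_lt.1 (EReal.coe_lt_coe_iff.1 hlu)
  exact hc.out (hs u hu) hu ⟨this.1.le, this.2.le⟩

/-- An open interval that is bounded below and not above is a ray. -/
theorem eq_Ioi_csInf {U : Set ℝ} (hU : IsOpen U) (hc : U.OrdConnected) (hb : BddBelow U)
    (hb' : ¬ BddAbove U) : U = Ioi (sInf U) := by
  refine Subset.antisymm (fun t ht => ?_) (hc.isPreconnected.Ioi_csInf_subset hb hb')
  obtain ⟨e, he, hball⟩ := Metric.isOpen_iff.1 hU t ht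
  have h1 : t - e / 2 ∈ U := hball (by simp [abs_of_pos, he])
  have := csInf_le hb h1
  simp only [mem_Ioi]
  linarith

/-- The open interval `(0, B)` of real numbers. -/
def posBelow (B : EReal) : Set ℝ := {t : ℝ | 0 < t ∧ (t : EReal) < B}

/-- The filter of real numbers that tend to `B` from below. -/
def atBelow (B : EReal) : Filter ℝ := comap (fun t : ℝ => (t : EReal)) (𝓝[<] B)

/-- The filter of real numbers that tend to `b` from above. -/
def atAbove (b : EReal) : Filter ℝ := comap (fun t : ℝ => (t : EReal)) (𝓝[>] b)

theorem isOpen_posBelow (B : EReal) : IsOpen (posBelow B) :=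
  isOpen_Ioi.inter (isOpen_Iio.preimage continuous_coe_real_ereal)

theorem ordConnected_posBelow (B : EReal) : (posBelow B).OrdConnected :=
  ⟨fun _ hx _ hy _ hz => ⟨hx.1.trans_le hz.1,
    lt_of_le_of_lt (EReal.coe_le_coe_iff.2 hz.2) hy.2⟩⟩

theorem mem_posBelow_of_le {B : EReal} {t u : ℝ} (hu : u ∈ posBelow B) (ht : 0 < t) (h : t ≤ u) :
    t ∈ posBelow B := ⟨ht, lt_of_le_of_lt (EReal.coe_le_coe_iff.2 h) hu.2⟩

theorem eventually_atBelow {B : EReal} {t : ℝ} (ht : (t : EReal) < B) :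
    ∀ᶠ u in atBelow B, t < u ∧ (u : EReal) < B := by
  filter_upwards [preimage_mem_comap (Ioo_mem_nhdsLT ht)] with u hu
  exact ⟨EReal.coe_lt_coe_iff.1 hu.1, hu.2⟩

theorem exists_of_eventually_atBelow {B : EReal} {t : ℝ} (ht : (t : EReal) < B) {P : ℝ → Prop}
    (h : ∀ᶠ u in atBelow B, P u) : ∃ u, t < u ∧ (u : EReal) < B ∧ P u := by
  obtain ⟨s, hs, hsP⟩ := mem_comap.1 h
  obtain ⟨l, hl, hls⟩ := (mem_nhdsLT_iff_exists_Ioo_subset' ht).1 hs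
  obtain ⟨u, hu1, hu2⟩ := EReal.exists_between_coe_real (max_lt ht hl)
  refine ⟨u, EReal.coe_lt_coe_iff.1 ((le_max_left _ _).trans_lt hu1), hu2, ?_⟩
  exact hsP (hls ⟨(le_max_right _ _).trans_lt hu1, hu2⟩)

/-- This lets finite and infinite ends of the curvature range share one treatment. -/
theorem atTop_eq_atBelow_top : (atTop : Filter ℝ) = atBelow ⊤ := by
  refine le_antisymm ?_ ?_
  · rw [atBelow, ← tendsto_iff_comap]
    exact EReal.tendsto_coe_nhds_top_iff.2 tendsto_id |>.inf
      (tendsto_principal_principal.2 fun a (_ : a ∈ univ) => EReal.coe_lt_top a) |>.mono_left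
        (by simp)
  · refine atTop_basis_Ioi.ge_iff.2 fun t _ => ?_
    exact (eventually_atBelow (EReal.coe_lt_top t)).mono fun u hu => hu.1

theorem tendsto_neg_atAbove (b : EReal) : Tendsto (fun t : ℝ => -t) (atAbove b) (atBelow (-b)) := by
  rw [atBelow, tendsto_comap_iff]
  have : (fun t : ℝ => (t : EReal)) ∘ (fun t : ℝ => -t) = (fun t => -t) ∘ fun t : ℝ => (t : EReal) := by
    ext t; simp
  rw [this]
  refine Tendsto.comp ?_ tendsto_comap
  refine tendsto_nhdsWithin_iff.2 ⟨((continuous_neg (G := EReal)).tendsto b).mono_left inf_le_left, ?_⟩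
  filter_upwards [self_mem_nhdsWithin] with t ht using EReal.neg_lt_neg_iff.2 ht

theorem tendsto_neg_atBelow (b : EReal) : Tendsto (fun t : ℝ => -t) (atBelow (-b)) (atAbove b) := by
  rw [atAbove, tendsto_comap_iff]
  have : (fun t : ℝ => (t : EReal)) ∘ (fun t : ℝ => -t) = (fun t => -t) ∘ fun t : ℝ => (t : EReal) := by
    ext t; simp
  rw [this]
  refine Tendsto.comp ?_ tendsto_comap
  refine tendsto_nhdsWithin_iff.2
    ⟨(((continuous_neg (G := EReal)).tendsto' (-b) b (neg_neg b)).mono_left inf_le_left), ?_⟩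
  filter_upwards [self_mem_nhdsWithin] with t ht
  have := EReal.neg_lt_neg_iff.2 (mem_Iio.1 ht)
  rwa [neg_neg] at this

/-- A monotone function has a finite limit exactly when it is bounded above. Boundedness is the form
in which `|𝓖(Λ)| < ∞` interacts with `sin = C 𝓖(λ) ≤ 1`. -/
theorem exists_tendsto_atBelow_iff {B : EReal} (hB : 0 < B) {G : ℝ → ℝ}
    (hG : MonotoneOn G (posBelow B)) :
    (∃ L, Tendsto G (atBelow B) (𝓝 L)) ↔ ∃ L, ∀ t ∈ posBelow B, G t ≤ L := by
  constructor
  · rintro ⟨L, hL⟩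
    refine ⟨L + 1, fun t ht => ?_⟩
    obtain ⟨u, htu, huB, hu⟩ := exists_of_eventually_atBelow ht.2
      (hL.eventually (gt_mem_nhds (lt_add_one L)))
    exact (hG ht ⟨ht.1.trans htu, huB⟩ htu.le).trans hu.le
  · rintro ⟨L, hL⟩
    obtain ⟨t₀, h1, h2⟩ := EReal.exists_between_coe_real hB
    have hne : (G '' posBelow B).Nonempty := ⟨_, mem_image_of_mem G ⟨EReal.coe_pos.1 h1, h2⟩⟩
    have hbdd : BddAbove (G '' posBelow B) := ⟨L, by rintro _ ⟨t, ht, rfl⟩; exact hL t ht⟩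
    refine ⟨sSup (G '' posBelow B), tendsto_order.2 ⟨fun a ha => ?_, fun a ha => ?_⟩⟩
    · obtain ⟨_, ⟨t, ht, rfl⟩, hat⟩ := exists_lt_of_lt_csSup hne ha
      filter_upwards [eventually_atBelow ht.2] with u hu
      exact hat.trans_le (hG ht ⟨ht.1.trans hu.1, hu.2⟩ hu.1.le)
    · filter_upwards [eventually_atBelow (B := B) (t := 0) (by simpa using hB)] with u hu
      exact (le_csSup hbdd (mem_image_of_mem G hu)).trans_lt ha

/-! ### Curvature relations on a half-line -/

/-- The relation `k = -p(λ)` between the curvature `k` of the profile and the rotational principal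
curvature `λ ∈ (0, B)`, for an elliptic class of umbilical constant `0`. -/
structure IsRate (B : EReal) (p : ℝ → ℝ) : Prop where
  pos_B : 0 < B
  cont : ContinuousOn p (posBelow B)
  pos : ∀ t ∈ posBelow B, 0 < p t
  mono : MonotoneOn p (posBelow B)
  linear : ∃ k K δ : ℝ, 0 < k ∧ 0 < K ∧ δ ∈ posBelow B ∧
    ∀ t, 0 < t → t ≤ δ → k * t ≤ p t ∧ p t ≤ K * t
  blowup : B ≠ ⊤ → ∀ M : ℝ, ∃ t ∈ posBelow B, M ≤ p t

/-- `F` is a primitive of `1 / (-p(t) - t)`. -/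
def IsPrim (B : EReal) (p F : ℝ → ℝ) : Prop :=
  ∀ t ∈ posBelow B, HasDerivAt F (-(p t + t)⁻¹) t

/-- The function `𝓖(t) = t exp F(t)`. -/
def gFun (F : ℝ → ℝ) (t : ℝ) : ℝ := t * Real.exp (F t)

theorem gFun_pos {F : ℝ → ℝ} {t : ℝ} (ht : 0 < t) : 0 < gFun F t := mul_pos ht (Real.exp_pos _)

section

variable {B : EReal} {p F : ℝ → ℝ}

theorem IsRate.nonempty (hp : IsRate B p) : (posBelow B).Nonempty := by
  obtain ⟨k, K, δ, -, -, h, -⟩ := hp.linear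
  exact ⟨δ, h⟩

theorem IsRate.add_pos (hp : IsRate B p) {t : ℝ} (ht : t ∈ posBelow B) : 0 < p t + t :=
  _root_.add_pos (hp.pos t ht) ht.1

theorem IsRate.exists_isPrim (hp : IsRate B p) : ∃ F, IsPrim B p F := by
  obtain ⟨a, ha⟩ := hp.nonempty
  obtain ⟨F, -, hF⟩ := exists_primitive (isOpen_posBelow B) (ordConnected_posBelow B)
    (f := fun t => -(p t + t)⁻¹)
    ((hp.cont.add continuousOn_id).inv₀ fun t ht => (hp.add_pos ht).ne').neg ha
  exact ⟨F, hF⟩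

/-- Up to `δ` this is the linear bound at `0`; beyond `δ` monotonicity gives `p t ≤ p T ≤ (p T / δ)
t`. It supplies the Lipschitz constant for uniqueness at `λ = 0`. -/
theorem IsRate.exists_le_mul (hp : IsRate B p) {T : ℝ} (hT : T ∈ posBelow B) :
    ∃ K, 0 < K ∧ ∀ t, 0 < t → t ≤ T → p t ≤ K * t := by
  obtain ⟨k, K, δ, -, hK, hδ, h⟩ := hp.linear
  refine ⟨max K (p T / δ), lt_max_of_lt_left hK, fun t ht htT => ?_⟩
  rcases le_total t δ with h1 | h1
  · exact (h t ht h1).2.trans (mul_le_mul_of_nonneg_right (le_max_left _ _) ht.le)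
  · calc p t ≤ p T := hp.mono (mem_posBelow_of_le hT ht htT) hT htT
      _ = p T / δ * δ := by field_simp [hδ.1.ne']
      _ ≤ p T / δ * t := mul_le_mul_of_nonneg_left h1 (div_nonneg (hp.pos T hT).le hδ.1.le)
      _ ≤ _ := mul_le_mul_of_nonneg_right (le_max_right _ _) ht.le

theorem IsPrim.antitoneOn (hp : IsRate B p) (hF : IsPrim B p F) : AntitoneOn F (posBelow B) :=
  antitoneOn_of_hasDerivAt_nonpos (isOpen_posBelow B) (ordConnected_posBelow B) hF fun t ht => by
    have := inv_pos.2 (hp.add_pos ht)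
    linarith

theorem IsPrim.strictAntiOn (hp : IsRate B p) (hF : IsPrim B p F) :
    StrictAntiOn F (posBelow B) := by
  have := strictMonoOn_of_hasDerivAt_pos (isOpen_posBelow B) (ordConnected_posBelow B)
    (f := fun t => - F t) (fun t ht => (hF t ht).neg) fun t ht => by
      have := inv_pos.2 (hp.add_pos ht)
      linarith
  intro a ha b hb hab
  have := this ha hb hab
  simp only at this
  linarith

/-- Near `0`, `p t ≤ K t` gives `F' ≤ -1/((K + 1) t)`, so `F` grows at least like `-(K + 1)⁻¹ log
t`. Geometrically, the radius `C exp F(λ)` is unbounded as `λ → 0`. -/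
theorem IsPrim.exists_ge (hp : IsRate B p) (hF : IsPrim B p F) (M : ℝ) :
    ∃ t ∈ posBelow B, M ≤ F t := by
  obtain ⟨k, K, δ, hk, hK, hδ, h⟩ := hp.linear
  have hanti : AntitoneOn (fun t => F t + (K + 1)⁻¹ * Real.log t) (Ioo 0 δ) := by
    refine antitoneOn_of_hasDerivAt_nonpos isOpen_Ioo ordConnected_Ioo
      (f' := fun t => -(p t + t)⁻¹ + (K + 1)⁻¹ * t⁻¹)
      (fun t ht => (hF t (mem_posBelow_of_le hδ ht.1 ht.2.le)).add
        ((Real.hasDerivAt_log ht.1.ne').const_mul _)) fun t ht => ?_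
    rw [← mul_inv]
    have hpt := hp.add_pos (mem_posBelow_of_le hδ ht.1 ht.2.le)
    have : ((K + 1) * t)⁻¹ ≤ (p t + t)⁻¹ :=
      inv_anti₀ hpt (by nlinarith [(h t ht.1 ht.2.le).2])
    linarith
  have hlim : Tendsto (fun t => F (δ / 2) + (K + 1)⁻¹ * Real.log (δ / 2) +
      (K + 1)⁻¹ * (-Real.log t)) (𝓝[>] 0) atTop :=
    tendsto_atTop_add_const_left _ _
      ((tendsto_neg_atBot_atTop.comp Real.tendsto_log_nhdsGT_zero).const_mul_atTop (by positivity))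
  obtain ⟨t, ht, ht0⟩ := ((hlim.eventually_ge_atTop M).and
    (Ioo_mem_nhdsGT (show (0 : ℝ) < δ / 2 from half_pos hδ.1))).exists
  refine ⟨t, mem_posBelow_of_le hδ ht0.1 (by linarith [ht0.2, hδ.1]), ht.trans ?_⟩
  have := hanti ⟨ht0.1, by linarith [ht0.2, hδ.1]⟩ ⟨half_pos hδ.1, by linarith [hδ.1]⟩ ht0.2.le
  simp only at this
  linarith

theorem IsPrim.hasDerivAt_gFun (hp : IsRate B p) (hF : IsPrim B p F) {t : ℝ}
    (ht : t ∈ posBelow B) :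
    HasDerivAt (gFun F) (Real.exp (F t) * p t / (p t + t)) t := by
  have := (hasDerivAt_id t).mul (hF t ht).exp
  refine this.congr_deriv ?_
  have := (hp.add_pos ht).ne'
  simp only [id]
  field_simp
  ring

theorem IsPrim.deriv_gFun_pos (hp : IsRate B p) {t : ℝ} (ht : t ∈ posBelow B) :
    0 < Real.exp (F t) * p t / (p t + t) :=
  div_pos (mul_pos (Real.exp_pos _) (hp.pos t ht)) (hp.add_pos ht)

theorem IsPrim.strictMonoOn_gFun (hp : IsRate B p) (hF : IsPrim B p F) :
    StrictMonoOn (gFun F) (posBelow B) :=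
  strictMonoOn_of_hasDerivAt_pos (isOpen_posBelow B) (ordConnected_posBelow B)
    (fun _ ht => hF.hasDerivAt_gFun hp ht) fun _ ht => IsPrim.deriv_gFun_pos hp ht

/-- Near `0`, `k t ≤ p t` gives `(log 𝓖)' = 1/t - 1/(p + t) ≥ (k/(1 + k))/t`, so `log 𝓖` tends to
`-∞` at least as fast as a positive multiple of `log t`. -/
theorem IsPrim.exists_gFun_lt (hp : IsRate B p) (hF : IsPrim B p F) {ε : ℝ} (hε : 0 < ε) :
    ∃ t ∈ posBelow B, gFun F t < ε := by
  obtain ⟨k, K, δ, hk, hK, hδ, h⟩ := hp.linear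
  have hmono : MonotoneOn (fun t => Real.log t + F t - k / (1 + k) * Real.log t) (Ioo 0 δ) := by
    refine monotoneOn_of_hasDerivAt_nonneg isOpen_Ioo ordConnected_Ioo
      (fun t ht => ((Real.hasDerivAt_log ht.1.ne').add
        (hF t (mem_posBelow_of_le hδ ht.1 ht.2.le))).sub
        ((Real.hasDerivAt_log ht.1.ne').const_mul _)) fun t ht => ?_
    have h1 : (p t + t)⁻¹ ≤ ((1 + k) * t)⁻¹ :=
      inv_anti₀ (mul_pos (by linarith) ht.1) (by nlinarith [(h t ht.1 ht.2.le).1])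
    have h2 : t⁻¹ - k / (1 + k) * t⁻¹ = ((1 + k) * t)⁻¹ := by
      have := ht.1.ne'
      field_simp
      ring
    linarith
  have hlim : Tendsto (fun t => Real.log (δ / 2) + F (δ / 2) - k / (1 + k) * Real.log (δ / 2) +
      k / (1 + k) * Real.log t) (𝓝[>] 0) atBot :=
    tendsto_atBot_add_const_left _ _
      (Real.tendsto_log_nhdsGT_zero.const_mul_atBot (by positivity))
  obtain ⟨t, ht, ht0⟩ := ((hlim.eventually_lt_atBot (Real.log ε)).and
    (Ioo_mem_nhdsGT (show (0 : ℝ) < δ / 2 from half_pos hδ.1))).exists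
  refine ⟨t, mem_posBelow_of_le hδ ht0.1 (by linarith [ht0.2, hδ.1]), ?_⟩
  have := hmono ⟨ht0.1, by linarith [ht0.2, hδ.1]⟩ ⟨half_pos hδ.1, by linarith [hδ.1]⟩ ht0.2.le
  simp only at this
  rw [← Real.log_lt_log_iff (gFun_pos ht0.1) hε, gFun,
    Real.log_mul ht0.1.ne' (Real.exp_pos _).ne', Real.log_exp]
  linarith

theorem IsPrim.ordConnected_image_gFun (hp : IsRate B p) (hF : IsPrim B p F) :
    (gFun F '' posBelow B).OrdConnected :=
  ((ordConnected_posBelow B).isPreconnected.image _ fun _ ht =>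
    (hF.hasDerivAt_gFun hp ht).continuousAt.continuousWithinAt).ordConnected

/-- The image of `𝓖` is an interval with infimum `0`, hence contains every positive number below one
of its values. -/
theorem IsPrim.mem_image_gFun (hp : IsRate B p) (hF : IsPrim B p F) {t v : ℝ}
    (ht : t ∈ posBelow B) (hv : 0 < v) (hvt : v ≤ gFun F t) : v ∈ gFun F '' posBelow B := by
  obtain ⟨u, hu, huv⟩ := hF.exists_gFun_lt hp hv
  exact (hF.ordConnected_image_gFun hp).out (mem_image_of_mem _ hu) (mem_image_of_mem _ ht)
    ⟨huv.le, hvt⟩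

/-- Beyond `a` the slope of `F` is at least `-1/p(a)`, and the range is bounded, so the total
decrease is finite. This keeps profiles with finite `B` away from the axis. -/
theorem IsPrim.exists_le (hp : IsRate B p) (hF : IsPrim B p F) (hB : B ≠ ⊤) :
    ∃ m, ∀ t ∈ posBelow B, m ≤ F t := by
  obtain ⟨a, ha⟩ := hp.nonempty
  have hmono : MonotoneOn (fun t => F t + (p a)⁻¹ * t) (posBelow B ∩ Ioi a) := by
    refine monotoneOn_of_hasDerivAt_nonneg ((isOpen_posBelow B).inter isOpen_Ioi)
      ((ordConnected_posBelow B).inter ordConnected_Ioi)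
      (fun t ht => (hF t ht.1).add ((hasDerivAt_id t).const_mul _)) fun t ht => ?_
    have : (p t + t)⁻¹ ≤ (p a)⁻¹ :=
      inv_anti₀ (hp.pos a ha) (by linarith [hp.mono ha ht.1 (le_of_lt ht.2), ht.1.1])
    linarith
  obtain ⟨c, hac, hcB⟩ := EReal.exists_between_coe_real ha.2
  have hc : c ∈ posBelow B := ⟨ha.1.trans (EReal.coe_lt_coe_iff.1 hac), hcB⟩
  have hpa := hp.pos a ha
  refine ⟨F c - (p a)⁻¹ * B.toReal, fun t ht => ?_⟩
  have htB : t ≤ B.toReal := by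
    rw [← EReal.coe_le_coe_iff, EReal.coe_toReal hB (by rintro rfl; exact absurd hp.pos_B (by simp))]
    exact ht.2.le
  have hB0 : 0 ≤ (p a)⁻¹ * B.toReal := mul_nonneg (inv_pos.2 hpa).le (ht.1.le.trans htB)
  rcases le_total t c with h | h
  · linarith [hF.antitoneOn hp ht hc h]
  · have h1 := hmono ⟨hc, EReal.coe_lt_coe_iff.1 hac⟩
      ⟨ht, (EReal.coe_lt_coe_iff.1 hac).trans_le h⟩ h
    simp only at h1
    have h2 := mul_le_mul_of_nonneg_left htB (inv_pos.2 hpa).le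
    have h3 := mul_pos (inv_pos.2 hpa) hc.1
    linarith

/-- In `t exp F(t)` the first factor is below `B` and the second decreases. -/
theorem IsPrim.exists_gFun_le (hp : IsRate B p) (hF : IsPrim B p F) (hB : B ≠ ⊤) :
    ∃ L, ∀ t ∈ posBelow B, gFun F t ≤ L := by
  obtain ⟨a, ha⟩ := hp.nonempty
  refine ⟨B.toReal * Real.exp (F a), fun t ht => ?_⟩
  have key : ∀ u ∈ posBelow B, a ≤ u → gFun F u ≤ B.toReal * Real.exp (F a) := by
    intro u hu hau
    have huB : u ≤ B.toReal := by
      rw [← EReal.coe_le_coe_iff,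
        EReal.coe_toReal hB (by rintro rfl; exact absurd hp.pos_B (by simp))]
      exact hu.2.le
    exact mul_le_mul huB (Real.exp_le_exp.2 (hF.antitoneOn hp ha hu hau)) (Real.exp_pos _).le
      (hu.1.le.trans huB)
  rcases le_total a t with h | h
  · exact key t ht h
  · exact ((hF.strictMonoOn_gFun hp).monotoneOn ht ha h).trans (key a ha le_rfl)

end

/-! ### Profile curves -/

/-- The sine of the angle in `[0, π]` whose cosine is `c`. -/
def sine (c : ℝ) : ℝ := √(1 - c ^ 2)

theorem sine_pos {c : ℝ} (h : c ∈ Ioo (-1 : ℝ) 1) : 0 < sine c :=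
  Real.sqrt_pos.2 (by nlinarith [h.1, h.2])

theorem sine_sq {c : ℝ} (h : c ∈ Ioo (-1 : ℝ) 1) : sine c ^ 2 = 1 - c ^ 2 :=
  Real.sq_sqrt (by nlinarith [h.1, h.2])

theorem sine_neg (c : ℝ) : sine (-c) = sine c := by simp [sine]

theorem sine_le_one (c : ℝ) : sine c ≤ 1 :=
  Real.sqrt_le_one.2 (by nlinarith [sq_nonneg c])

theorem continuous_sine : Continuous sine :=
  Real.continuous_sqrt.comp (by fun_prop)

theorem hasDerivAt_sine {c : ℝ} (h : c ∈ Ioo (-1 : ℝ) 1) :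
    HasDerivAt sine (-c / sine c) c := by
  have h1 : (1 : ℝ) - c ^ 2 ≠ 0 := by nlinarith [h.1, h.2]
  have := ((hasDerivAt_pow 2 c).const_sub 1).sqrt h1
  refine this.congr_deriv ?_
  rw [sine]
  field_simp
  norm_num

theorem sine_sqrt {w : ℝ} (hw : 0 ≤ w) (hw1 : w ≤ 1) : sine (√(1 - w ^ 2)) = w := by
  rw [sine, Real.sq_sqrt (by nlinarith), sub_sub_cancel, Real.sqrt_sq hw]

/-- An arc of a profile curve, off the axis, of cosine `c = x'` and of rotational principal
curvature `λ = z' / x > 0`, that satisfies the relation `k = -p(λ)`. -/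
structure IsProfile (B : EReal) (p : ℝ → ℝ) (J : Set ℝ) (x z c : ℝ → ℝ) : Prop where
  isOpen : IsOpen J
  ordConnected : J.OrdConnected
  nonempty : J.Nonempty
  x_pos : ∀ s ∈ J, 0 < x s
  c_mem : ∀ s ∈ J, c s ∈ Ioo (-1 : ℝ) 1
  hasDerivAt_x : ∀ s ∈ J, HasDerivAt x (c s) s
  hasDerivAt_z : ∀ s ∈ J, HasDerivAt z (sine (c s)) s
  hasDerivAt_c : ∀ s ∈ J, HasDerivAt c (p (sine (c s) / x s) * sine (c s)) s
  mem : ∀ s ∈ J, sine (c s) / x s ∈ posBelow B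

section

variable {B : EReal} {p F : ℝ → ℝ} {J : Set ℝ} {x z c : ℝ → ℝ}

/-- The reversed profile, reflected in a horizontal line. -/
theorem IsProfile.reverse (h : IsProfile B p J x z c) :
    IsProfile B p (Neg.neg ⁻¹' J) (fun s => x (-s)) (fun s => -z (-s)) (fun s => -c (-s)) where
  isOpen := h.isOpen.preimage continuous_neg
  ordConnected := ⟨fun a ha b hb t ht =>
    h.ordConnected.out hb ha ⟨neg_le_neg ht.2, neg_le_neg ht.1⟩⟩
  nonempty := by
    obtain ⟨s, hs⟩ := h.nonempty
    exact ⟨-s, by simpa using hs⟩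
  x_pos s hs := h.x_pos _ hs
  c_mem s hs := ⟨by linarith [(h.c_mem _ hs).2], by linarith [(h.c_mem _ hs).1]⟩
  hasDerivAt_x s hs := by
    exact ((h.hasDerivAt_x _ hs).scomp s (hasDerivAt_neg s)).congr_deriv (by simp)
  hasDerivAt_z s hs := by
    exact ((h.hasDerivAt_z _ hs).scomp s (hasDerivAt_neg s)).neg.congr_deriv (by simp [sine_neg])
  hasDerivAt_c s hs := by
    exact ((h.hasDerivAt_c _ hs).scomp s (hasDerivAt_neg s)).neg.congr_deriv (by simp [sine_neg])
  mem s hs := by simpa [sine_neg] using h.mem _ hs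

/-- The first integral of the equation of profile curves. -/
theorem IsProfile.exists_const (hp : IsRate B p) (hF : IsPrim B p F)
    (h : IsProfile B p J x z c) :
    ∃ C, 0 < C ∧ ∀ s ∈ J, x s = C * Real.exp (F (sine (c s) / x s)) ∧
      sine (c s) = C * gFun F (sine (c s) / x s) := by
  -- With `λ = sin/x` one has `λ' = -c (p + λ)/x`, and `F' = -1/(p + λ)`, so `F(λ)' = c/x = (log
  -- x)'`.
  have hd : ∀ s ∈ J, HasDerivAt (fun s => Real.log (x s) - F (sine (c s) / x s)) 0 s := by
    intro s hs
    have hx := h.x_pos s hs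
    have hw := sine_pos (h.c_mem s hs)
    have hl := ((hasDerivAt_sine (h.c_mem s hs)).comp s (h.hasDerivAt_c s hs)).div
      (h.hasDerivAt_x s hs) hx.ne'
    have := ((h.hasDerivAt_x s hs).log hx.ne').sub ((hF _ (h.mem s hs)).comp s hl)
    refine this.congr_deriv ?_
    have h1 := hp.add_pos (h.mem s hs)
    simp only [Function.comp]
    generalize p (sine (c s) / x s) = P at *
    generalize sine (c s) = w at *
    have h2 : P * x s + w ≠ 0 := by
      have : P * x s + w = (P + w / x s) * x s := by field_simp
      rw [this]; positivity
    have : (P + w / x s)⁻¹ = x s / (P * x s + w) := by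
      rw [inv_eq_one_div, div_eq_div_iff h1.ne' h2]; field_simp
    rw [this]
    generalize x s = y at *
    have h3 : P * y + w ≠ 0 := h2
    rw [sub_eq_zero, div_eq_iff hx.ne']
    have h4 : -c s / w * (P * w) * y - w * c s = -(c s * (P * y + w)) := by
      field_simp
      ring
    rw [h4]
    generalize P * y + w = N at *
    field_simp
  obtain ⟨a, ha⟩ := h.nonempty
  refine ⟨Real.exp (Real.log (x a) - F (sine (c a) / x a)), Real.exp_pos _, fun s hs => ?_⟩
  have e : x s = Real.exp (Real.log (x a) - F (sine (c a) / x a)) *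
      Real.exp (F (sine (c s) / x s)) := by
    rw [← eq_of_hasDerivAt_zero h.ordConnected hd hs ha, ← Real.exp_add, sub_add_cancel,
      Real.exp_log (h.x_pos s hs)]
  refine ⟨e, ?_⟩
  rw [gFun, mul_left_comm, ← e, div_mul_cancel₀ _ (h.x_pos s hs).ne']

/-! ### Parametrization by the cosine of the angle -/

/-- The rotational principal curvature `l`, the coordinates `X` and `Z`, and the arc length `S`
of a profile curve, as functions of the cosine `c ∈ D` of its angle. -/
structure IsModel (B : EReal) (p F : ℝ → ℝ) (C : ℝ) (D : Set ℝ) (l X Z S : ℝ → ℝ) : Prop where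
  isOpen : IsOpen D
  ordConnected : D.OrdConnected
  nonempty : D.Nonempty
  subset : D ⊆ Ioo (-1) 1
  l_mem : ∀ c ∈ D, l c ∈ posBelow B
  l_eq : ∀ c ∈ D, C * gFun F (l c) = sine c
  l_cont : ContinuousOn l D
  X_eq : ∀ c ∈ D, X c = C * Real.exp (F (l c))
  hasDerivAt_X : ∀ c ∈ D, HasDerivAt X (c / (p (l c) * sine c)) c
  hasDerivAt_Z : ∀ c ∈ D, HasDerivAt Z (p (l c))⁻¹ c
  hasDerivAt_S : ∀ c ∈ D, HasDerivAt S (p (l c) * sine c)⁻¹ c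

/-- Inverting `sin = C 𝓖(λ)` gives `λ` as a function of the cosine. As `c' = p sin`, the height and
the arc length are then the primitives of `1/p` and `1/(p sin)`, while the radius is given by the
first integral itself. -/
theorem IsPrim.exists_isModel (hp : IsRate B p) (hF : IsPrim B p F) {C : ℝ} (hC : 0 < C)
    {D : Set ℝ} (hD : IsOpen D) (hDc : D.OrdConnected) (hsub : D ⊆ Ioo (-1) 1)
    (hmem : ∀ c ∈ D, sine c / C ∈ gFun F '' posBelow B) {a : ℝ} (ha : a ∈ D) :
    ∃ l X Z S : ℝ → ℝ, IsModel B p F C D l X Z S ∧ Z a = 0 ∧ S a = 0 := by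
  obtain ⟨-, -, k, hk, hk'⟩ := exists_inverse (isOpen_posBelow B) (ordConnected_posBelow B)
    (fun t ht => hF.hasDerivAt_gFun hp ht) (fun t ht => IsPrim.deriv_gFun_pos hp ht)
  set l : ℝ → ℝ := fun c => k (sine c / C) with hl
  have hlm : ∀ c ∈ D, l c ∈ posBelow B ∧ gFun F (l c) = sine c / C := by
    intro c hc
    obtain ⟨t, ht, htc⟩ := hmem c hc
    rw [hl]
    simp only
    rw [← htc, hk t ht]
    exact ⟨ht, rfl⟩
  have hld : ∀ c ∈ D, HasDerivAt l
      ((Real.exp (F (l c)) * p (l c) / (p (l c) + l c))⁻¹ * (-c / sine c / C)) c :=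
    fun c hc => (hk' _ (hmem c hc)).comp c ((hasDerivAt_sine (hsub hc)).div_const C)
  have hlc : ContinuousOn l D := fun c hc => (hld c hc).continuousAt.continuousWithinAt
  have hpc : ContinuousOn (fun c => p (l c)) D := hp.cont.comp hlc fun c hc => (hlm c hc).1
  have hsc : ContinuousOn sine D := fun c hc =>
    (hasDerivAt_sine (hsub hc)).continuousAt.continuousWithinAt
  have hp0 : ∀ c ∈ D, p (l c) ≠ 0 := fun c hc => (hp.pos _ (hlm c hc).1).ne'
  have hs0 : ∀ c ∈ D, sine c ≠ 0 := fun c hc => (sine_pos (hsub hc)).ne'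
  obtain ⟨Z, hZa, hZ⟩ := exists_primitive hD hDc (hpc.inv₀ hp0) ha
  obtain ⟨S, hSa, hS⟩ := exists_primitive hD hDc
    ((hpc.mul hsc).inv₀ fun c hc => mul_ne_zero (hp0 c hc) (hs0 c hc)) ha
  refine ⟨l, fun c => C * Real.exp (F (l c)), Z, S, ⟨hD, hDc, ⟨a, ha⟩, hsub,
    fun c hc => (hlm c hc).1, fun c hc => ?_, hlc, fun _ _ => rfl, fun c hc => ?_, hZ, hS⟩,
    hZa, hSa⟩
  · rw [(hlm c hc).2, mul_div_cancel₀ _ hC.ne']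
  · have := (((hF _ (hlm c hc).1).comp c (hld c hc)).exp).const_mul C
    refine this.congr_deriv ?_
    have h1 := (hp.add_pos (hlm c hc).1).ne'
    have h2 := hp0 c hc
    have h3 := hs0 c hc
    simp only [Function.comp]
    field_simp

section

variable {C : ℝ} {D : Set ℝ} {l X Z S : ℝ → ℝ}

theorem IsModel.C_pos (h : IsModel B p F C D l X Z S) : 0 < C := by
  obtain ⟨c, hc⟩ := h.nonempty
  have h1 := sine_pos (h.subset hc)
  rw [← h.l_eq c hc] at h1
  exact pos_of_mul_pos_left h1 (gFun_pos (h.l_mem c hc).1).le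

theorem IsModel.X_pos (h : IsModel B p F C D l X Z S) {c : ℝ} (hc : c ∈ D) : 0 < X c := by
  rw [h.X_eq c hc]
  exact mul_pos h.C_pos (Real.exp_pos _)

theorem IsModel.sine_div_X (h : IsModel B p F C D l X Z S) {c : ℝ} (hc : c ∈ D) :
    sine c / X c = l c := by
  rw [div_eq_iff (h.X_pos hc).ne', h.X_eq c hc, ← h.l_eq c hc, gFun]
  ring

theorem IsModel.deriv_S_pos (hp : IsRate B p) (h : IsModel B p F C D l X Z S) :
    ∀ c ∈ D, 0 < (p (l c) * sine c)⁻¹ := fun c hc =>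
  inv_pos.2 (mul_pos (hp.pos _ (h.l_mem c hc)) (sine_pos (h.subset hc)))

/-- The arc length `S` increases with the cosine; its inverse `k` turns the model into a curve
parametrized by arc length. -/
theorem IsModel.exists_isProfile (hp : IsRate B p) (h : IsModel B p F C D l X Z S) (z₀ : ℝ) :
    ∃ k : ℝ → ℝ, (∀ c ∈ D, k (S c) = c) ∧
      IsProfile B p (S '' D) (fun s => X (k s)) (fun s => z₀ + Z (k s)) k := by
  obtain ⟨hSo, hSc, k, hk, hk'⟩ := exists_inverse h.isOpen h.ordConnected h.hasDerivAt_S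
    (h.deriv_S_pos hp)
  refine ⟨k, hk, ⟨hSo, hSc, h.nonempty.image S, ?_, ?_, ?_, ?_, ?_, ?_⟩⟩
  all_goals
    rintro _ ⟨c, hc, rfl⟩
    have hkd := hk' _ (mem_image_of_mem S hc)
    have h1 := (hp.pos _ (h.l_mem c hc)).ne'
    have h2 := (sine_pos (h.subset hc)).ne'
    simp only [hk c hc, inv_inv] at hkd ⊢
  · exact h.X_pos hc
  · exact h.subset hc
  · have := HasDerivAt.comp (S c) (by rw [hk c hc]; exact h.hasDerivAt_X c hc) hkd
    refine this.congr_deriv ?_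
    field_simp
  · have := (HasDerivAt.comp (S c) (by rw [hk c hc]; exact h.hasDerivAt_Z c hc) hkd).const_add z₀
    refine this.congr_deriv ?_
    field_simp
  · rwa [h.sine_div_X hc]
  · rw [h.sine_div_X hc]
    exact h.l_mem c hc

/-- A profile curve with the same first integral is an arc of the model. -/
theorem IsModel.exists_shift (hp : IsRate B p) (hF : IsPrim B p F)
    (h : IsModel B p F C D l X Z S) (hP : IsProfile B p J x z c)
    (hC : ∀ s ∈ J, x s = C * Real.exp (F (sine (c s) / x s)) ∧
      sine (c s) = C * gFun F (sine (c s) / x s)) (hD : ∀ s ∈ J, c s ∈ D) :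
    ∃ a z₀ : ℝ, ∀ s ∈ J, S (c s) = s + a ∧ x s = X (c s) ∧ z s = z₀ + Z (c s) := by
  -- Both curvatures have the same image under the injective `𝓖`, because the constant `C` is the
  -- same.
  have hl : ∀ s ∈ J, l (c s) = sine (c s) / x s := fun s hs => by
    refine (hF.strictMonoOn_gFun hp).injOn (h.l_mem _ (hD s hs)) (hP.mem s hs) ?_
    exact mul_left_cancel₀ h.C_pos.ne' ((h.l_eq _ (hD s hs)).trans (hC s hs).2)
  obtain ⟨s₀, hs₀⟩ := hP.nonempty
  refine ⟨S (c s₀) - s₀, z s₀ - Z (c s₀), fun s hs => ⟨?_, ?_, ?_⟩⟩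
  · have := eq_of_hasDerivAt_zero hP.ordConnected (f := fun s => S (c s) - s) (fun s hs => by
      refine (((h.hasDerivAt_S _ (hD s hs)).comp s (hP.hasDerivAt_c s hs)).sub
        (hasDerivAt_id s)).congr_deriv ?_
      have h1 := (hp.pos _ (h.l_mem _ (hD s hs))).ne'
      have h2 := (sine_pos (hP.c_mem s hs)).ne'
      rw [← hl s hs]
      field_simp
      ring) hs hs₀
    linarith
  · rw [h.X_eq _ (hD s hs), hl s hs]
    exact (hC s hs).1
  · have := eq_of_hasDerivAt_zero hP.ordConnected (f := fun s => Z (c s) - z s) (fun s hs => by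
      refine (((h.hasDerivAt_Z _ (hD s hs)).comp s (hP.hasDerivAt_c s hs)).sub
        (hP.hasDerivAt_z s hs)).congr_deriv ?_
      have h1 := (hp.pos _ (h.l_mem _ (hD s hs))).ne'
      rw [← hl s hs]
      field_simp
      ring) hs hs₀
    linarith

/-- The curvature `l` tends to `0` as the cosine tends to `1`. -/
theorem IsModel.exists_l_lt (hp : IsRate B p) (hF : IsPrim B p F)
    (h : IsModel B p F C D l X Z S) {t : ℝ} (ht : t ∈ posBelow B) :
    ∃ c₀ < 1, ∀ c ∈ D, c₀ < c → l c < t := by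
  have hε : 0 < C * gFun F t := mul_pos h.C_pos (gFun_pos ht.1)
  -- With `ε = C 𝓖(t)`, `c > 1 - ε²/2` gives `1 - c² < 2(1 - c) < ε²`, that is `sin < C 𝓖(t)`.
  refine ⟨1 - (C * gFun F t) ^ 2 / 2, by nlinarith [sq_pos_of_pos hε], fun c hc hlt => ?_⟩
  rw [← (hF.strictMonoOn_gFun hp).lt_iff_lt (h.l_mem c hc) ht,
    ← mul_lt_mul_iff_right₀ h.C_pos, h.l_eq c hc]
  refine lt_of_pow_lt_pow_left₀ 2 hε.le ?_
  rw [sine_sq (h.subset hc)]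
  nlinarith [(h.subset hc).1, (h.subset hc).2]

theorem IsModel.exists_lt_X (hp : IsRate B p) (hF : IsPrim B p F)
    (h : IsModel B p F C D l X Z S) (M : ℝ) : ∃ c₀ < 1, ∀ c ∈ D, c₀ < c → M < X c := by
  -- The level of `F` is chosen so that `C exp F ≥ |M| + 1`.
  obtain ⟨t, ht, htM⟩ := hF.exists_ge hp (Real.log ((|M| + 1) / C))
  obtain ⟨c₀, hc₀, H⟩ := h.exists_l_lt hp hF ht
  refine ⟨c₀, hc₀, fun c hc hlt => ?_⟩
  have h1 := htM.trans (hF.antitoneOn hp (h.l_mem c hc) ht (H c hc hlt).le)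
  rw [Real.log_le_iff_le_exp (div_pos (by positivity) h.C_pos), div_le_iff₀ h.C_pos,
    mul_comm, ← h.X_eq c hc] at h1
  linarith [le_abs_self M]

end

end

/-! ### Special catenoids -/

/-- `A` is the trace of a convex profile curve of a special catenoid of necksize `τ`. -/
def IsCatenoidTrace (τ : ℝ) (A : Set (ℝ × ℝ)) : Prop :=
  ∃ (c : ℝ) (z₁ : EReal) (ξ : ℝ → ℝ), 0 < z₁ ∧
    A = (fun h => (ξ h, c + h)) '' {h : ℝ | ((|h| : ℝ) : EReal) < z₁} ∧
    ContDiffOn ℝ 2 ξ {h : ℝ | ((|h| : ℝ) : EReal) < z₁} ∧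
    ConvexOn ℝ {h : ℝ | ((|h| : ℝ) : EReal) < z₁} ξ ∧
    (∀ h : ℝ, ((|h| : ℝ) : EReal) < z₁ → 0 < ξ h ∧ ξ (-h) = ξ h ∧ τ ≤ ξ h) ∧
    ξ 0 = τ ∧ Tendsto ξ (atBelow z₁) atTop

/-- `A` is the trace of the graph over `(d, ∞)` of a convex or concave function that extends
continuously, but not with zero derivative, to `d`. -/
def IsGraphTrace (d : ℝ) (A : Set (ℝ × ℝ)) : Prop :=
  ∃ u : ℝ → ℝ, A = (fun r => (r, u r)) '' Ioi d ∧ ContDiffOn ℝ 2 u (Ioi d) ∧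
    (ConvexOn ℝ (Ioi d) u ∨ ConcaveOn ℝ (Ioi d) u) ∧ ContinuousWithinAt u (Ioi d) d ∧
    ∃ m > 0, ∀ r, d < r → r < d + 1 → m * (r - d) ≤ |u r - u d|

theorem IsCatenoidTrace.reflect {τ : ℝ} {A : Set (ℝ × ℝ)} (h : IsCatenoidTrace τ A) :
    IsCatenoidTrace τ ((fun q => (q.1, -q.2)) '' A) := by
  obtain ⟨c, z₁, ξ, h1, rfl, h3, h4, h5, h6, h7⟩ := h
  refine ⟨-c, z₁, ξ, h1, ?_, h3, h4, h5, h6, h7⟩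
  rw [image_image]
  ext q
  constructor
  all_goals
    rintro ⟨h, hh, rfl⟩
    refine ⟨-h, by simpa using hh, ?_⟩
    have := (h5 h hh).2.1
    ext
    · simp [this]
    · simp
      try ring

theorem IsGraphTrace.reflect {d : ℝ} {A : Set (ℝ × ℝ)} (h : IsGraphTrace d A) :
    IsGraphTrace d ((fun q => (q.1, -q.2)) '' A) := by
  obtain ⟨u, rfl, h2, h3, h4, m, hm, h5⟩ := h
  refine ⟨fun r => -u r, by rw [image_image], h2.neg, ?_, h4.neg, m, hm, fun r h1 h2 => ?_⟩
  · exact h3.symm.imp (fun h => neg_convexOn_iff.2 h) (fun h => neg_concaveOn_iff.2 h)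
  · rw [neg_sub_neg, abs_sub_comm]
    exact h5 r h1 h2

section

variable {B : EReal} {p F : ℝ → ℝ} {C : ℝ} {D : Set ℝ} {l X Z S : ℝ → ℝ}

theorem IsModel.l_neg (hp : IsRate B p) (hF : IsPrim B p F) (h : IsModel B p F C D l X Z S)
    {c : ℝ} (hc : c ∈ D) (hc' : -c ∈ D) : l (-c) = l c := by
  refine (hF.strictMonoOn_gFun hp).injOn (h.l_mem _ hc') (h.l_mem _ hc)
    (mul_left_cancel₀ h.C_pos.ne' ?_)
  rw [h.l_eq _ hc, h.l_eq _ hc', sine_neg]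

theorem hasDerivAt_cot {c : ℝ} (h : c ∈ Ioo (-1 : ℝ) 1) :
    HasDerivAt (fun c => c / sine c) (1 / sine c ^ 3) c := by
  have h1 := (sine_pos h).ne'
  refine ((hasDerivAt_id c).div (hasDerivAt_sine h) h1).congr_deriv ?_
  have h2 := sine_sq h
  simp only [id]
  field_simp
  linarith

/-- The cotangent is the slope `dX/dZ` of a profile; its monotonicity is the convexity of the
catenoid. -/
theorem monotoneOn_cot : MonotoneOn (fun c => c / sine c) (Ioo (-1) 1) :=
  monotoneOn_of_hasDerivAt_nonneg isOpen_Ioo ordConnected_Ioo (fun _ hc => hasDerivAt_cot hc)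
    fun c hc => by have := sine_pos hc; positivity

theorem odd_of_even_deriv {f f' : ℝ → ℝ} (hd : ∀ c ∈ Ioo (-1 : ℝ) 1, HasDerivAt f (f' c) c)
    (he : ∀ c ∈ Ioo (-1 : ℝ) 1, f' (-c) = f' c) (h0 : f 0 = 0) {c : ℝ}
    (hc : c ∈ Ioo (-1 : ℝ) 1) : f (-c) = -f c := by
  have hm : ∀ c ∈ Ioo (-1 : ℝ) 1, -c ∈ Ioo (-1 : ℝ) 1 := fun c hc =>
    ⟨by linarith [hc.2], by linarith [hc.1]⟩
  have := eq_of_hasDerivAt_zero ordConnected_Ioo (f := fun c => f c + f (-c)) (fun c hc => by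
    refine ((hd c hc).add ((hd _ (hm c hc)).scomp c (hasDerivAt_neg c))).congr_deriv ?_
    simp [he c hc]) hc (b := 0) (by simp)
  simp only [neg_zero, h0] at this
  linarith

/-- Completeness: since `c < 1`, the arc length grows at least as fast as the radius, which is
unbounded as `c → 1`. Oddness of `S` covers the other end. -/
theorem IsModel.image_S_eq_univ (hp : IsRate B p) (hF : IsPrim B p F)
    (h : IsModel B p F C (Ioo (-1) 1) l X Z S) (hS : S 0 = 0) : S '' Ioo (-1) 1 = univ := by
  have hoc : (S '' Ioo (-1) 1).OrdConnected := (exists_inverse h.isOpen h.ordConnected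
    h.hasDerivAt_S (h.deriv_S_pos hp)).2.1
  have hm : ∀ c ∈ Ioo (-1 : ℝ) 1, -c ∈ Ioo (-1 : ℝ) 1 := fun c hc =>
    ⟨by linarith [hc.2], by linarith [hc.1]⟩
  have hodd : ∀ c ∈ Ioo (-1 : ℝ) 1, S (-c) = -S c := fun c hc =>
    odd_of_even_deriv h.hasDerivAt_S (fun c hc => by
      rw [h.l_neg hp hF hc (hm c hc), sine_neg]) hS hc
  have hmono : MonotoneOn (fun c => S c - X c) (Ioo (-1) 1) := by
    refine monotoneOn_of_hasDerivAt_nonneg isOpen_Ioo ordConnected_Ioo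
      (fun c hc => (h.hasDerivAt_S c hc).sub (h.hasDerivAt_X c hc)) fun c hc => ?_
    have := h.deriv_S_pos hp c hc
    rw [div_eq_mul_inv]
    nlinarith [hc.2]
  refine eq_univ_of_forall fun y => ?_
  obtain ⟨c₀, hc₀, H⟩ := h.exists_lt_X hp hF (|y| + X 0)
  have hc : (max c₀ 0 + 1) / 2 ∈ Ioo (-1 : ℝ) 1 :=
    ⟨by linarith [le_max_right c₀ 0], by linarith [max_lt hc₀ (zero_lt_one' ℝ)]⟩
  have h1 := H _ hc (by linarith [le_max_left c₀ 0, max_lt hc₀ (zero_lt_one' ℝ)])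
  have h2 := hmono (show (0 : ℝ) ∈ Ioo (-1 : ℝ) 1 by simp) hc (by linarith [le_max_right c₀ 0])
  simp only [hS] at h2
  have h3 : |y| ≤ S ((max c₀ 0 + 1) / 2) := by linarith
  refine hoc.out (mem_image_of_mem S (hm _ hc)) (mem_image_of_mem S hc) ?_
  rw [hodd _ hc]
  exact abs_le.1 h3

/-- The height `Z` increases with `c`, so it can serve as parameter; the slope `cot` increases with
it. Symmetry holds because `λ` depends on `c` only through the even function `sine`. -/
theorem IsModel.isCatenoidTrace (hp : IsRate B p) (hF : IsPrim B p F)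
    (h : IsModel B p F C (Ioo (-1) 1) l X Z S) (hZ : Z 0 = 0) (z₀ : ℝ) :
    IsCatenoidTrace (X 0) ((fun c => (X c, z₀ + Z c)) '' Ioo (-1) 1) := by
  have hm : ∀ c ∈ Ioo (-1 : ℝ) 1, -c ∈ Ioo (-1 : ℝ) 1 := fun c hc =>
    ⟨by linarith [hc.2], by linarith [hc.1]⟩
  have hZp : ∀ c ∈ Ioo (-1 : ℝ) 1, 0 < (p (l c))⁻¹ := fun c hc =>
    inv_pos.2 (hp.pos _ (h.l_mem c hc))
  have hZm := strictMonoOn_of_hasDerivAt_pos h.isOpen h.ordConnected h.hasDerivAt_Z hZp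
  obtain ⟨ho, hoc, k, hk, hk'⟩ := exists_inverse h.isOpen h.ordConnected h.hasDerivAt_Z hZp
  have h0 : (0 : ℝ) ∈ Ioo (-1 : ℝ) 1 := by simp
  have hodd : ∀ c ∈ Ioo (-1 : ℝ) 1, Z (-c) = -Z c := fun c hc =>
    odd_of_even_deriv h.hasDerivAt_Z (fun c hc => by
      rw [h.l_neg hp hF hc (hm c hc)]) hZ hc
  have hXe : ∀ c ∈ Ioo (-1 : ℝ) 1, X (-c) = X c := fun c hc => by
    rw [h.X_eq _ hc, h.X_eq _ (hm c hc), h.l_neg hp hF hc (hm c hc)]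
  obtain ⟨z₁, hz₁, hU⟩ := exists_eq_abs_lt ho hoc ⟨0, h0, hZ⟩ (by
    rintro _ ⟨c, hc, rfl⟩
    exact ⟨-c, hm c hc, hodd c hc⟩)
  have hd₁ : ∀ y ∈ Z '' Ioo (-1) 1, HasDerivAt (fun y => X (k y)) (k y / sine (k y)) y := by
    rintro _ ⟨c, hc, rfl⟩
    have hkd := hk' _ (mem_image_of_mem Z hc)
    rw [hk c hc] at hkd ⊢
    refine (HasDerivAt.comp (Z c) (by rw [hk c hc]; exact h.hasDerivAt_X c hc) hkd).congr_deriv ?_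
    have h1 := (hp.pos _ (h.l_mem c hc)).ne'
    have h2 := (sine_pos hc).ne'
    field_simp
  have hd₂ : ∀ y ∈ Z '' Ioo (-1) 1, HasDerivAt (fun y => k y / sine (k y))
      (p (l (k y)) / sine (k y) ^ 3) y := by
    rintro _ ⟨c, hc, rfl⟩
    have hkd := hk' _ (mem_image_of_mem Z hc)
    rw [hk c hc] at hkd ⊢
    refine (HasDerivAt.comp (h₂ := fun c => c / sine c) (Z c)
      (by rw [hk c hc]; exact hasDerivAt_cot hc) hkd).congr_deriv ?_
    rw [inv_inv]
    ring
  have hkc : ContinuousOn k (Z '' Ioo (-1) 1) := fun y hy =>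
    (hk' y hy).continuousAt.continuousWithinAt
  have hkm : MapsTo k (Z '' Ioo (-1) 1) (Ioo (-1) 1) := by
    rintro _ ⟨c, hc, rfl⟩
    rwa [hk c hc]
  have hconv : ConvexOn ℝ (Z '' Ioo (-1) 1) (fun y => X (k y)) := by
    refine convexOn_of_hasDerivAt_of_monotoneOn ho hoc hd₁ ?_
    rintro _ ⟨a, ha, rfl⟩ _ ⟨b, hb, rfl⟩ hab
    simp only [hk a ha, hk b hb]
    exact monotoneOn_cot ha hb ((hZm.le_iff_le ha hb).1 hab)
  have heven : ∀ y ∈ Z '' Ioo (-1) 1, -y ∈ Z '' Ioo (-1) 1 ∧ X (k (-y)) = X (k y) := by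
    rintro _ ⟨c, hc, rfl⟩
    rw [← hodd c hc, hk c hc, hk _ (hm c hc)]
    exact ⟨mem_image_of_mem _ (hm c hc), hXe c hc⟩
  refine ⟨z₀, z₁, fun y => X (k y), hz₁, ?_, ?_, ?_, ?_, ?_, ?_⟩
  · rw [← hU, image_image]
    exact image_congr fun c hc => by simp only [hk c hc]
  · rw [← hU]
    refine contDiffOn_two_of_hasDerivAt ho hd₁ hd₂ ?_
    refine ContinuousOn.div ?_ ?_ ?_
    · exact hp.cont.comp (h.l_cont.comp hkc hkm) fun y hy => h.l_mem _ (hkm hy)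
    · exact (continuous_sine.comp_continuousOn hkc).pow 3
    · exact fun y hy => (pow_pos (sine_pos (hkm hy)) 3).ne'
  · rwa [← hU]
  · intro y hy
    have hy : y ∈ Z '' Ioo (-1) 1 := by rwa [hU]
    refine ⟨h.X_pos (hkm hy), (heven y hy).2, ?_⟩
    -- An even convex function has its minimum at `0`: apply convexity at the midpoint of `y` and
    -- `-y`.
    have hc := hconv.2
    have := hc hy (heven y hy).1 (a := 1 / 2) (b := 1 / 2) (by norm_num) (by norm_num)
      (by norm_num)
    simp only [smul_eq_mul, (heven y hy).2] at this
    have e : 1 / 2 * y + 1 / 2 * -y = Z 0 := by rw [hZ]; ring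
    rw [e, hk 0 h0] at this
    linarith
  · have := hk 0 h0
    rw [hZ] at this
    simp only [this]
  · refine tendsto_atTop.2 fun M => ?_
    obtain ⟨c₀, hc₀, H⟩ := h.exists_lt_X hp hF M
    set a := (max c₀ 0 + 1) / 2 with ha_def
    have ha : a ∈ Ioo (-1 : ℝ) 1 :=
      ⟨by linarith [le_max_right c₀ 0], by linarith [max_lt hc₀ (zero_lt_one' ℝ)]⟩
    have ha0 : 0 ≤ a := by linarith [le_max_right c₀ 0]
    have hac : c₀ < a := by linarith [le_max_left c₀ 0, max_lt hc₀ (zero_lt_one' ℝ)]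
    have hZa : 0 ≤ Z a := by
      rw [← hZ]
      exact hZm.monotoneOn h0 ha ha0
    have hmem : Z a ∈ {h : ℝ | ((|h| : ℝ) : EReal) < z₁} := hU ▸ mem_image_of_mem Z ha
    have hlt : (Z a : EReal) < z₁ := by
      have : ((|Z a| : ℝ) : EReal) < z₁ := hmem
      rwa [abs_of_nonneg hZa] at this
    filter_upwards [eventually_atBelow hlt] with y hy
    have hyU : y ∈ Z '' Ioo (-1) 1 := by
      rw [hU]
      change ((|y| : ℝ) : EReal) < z₁
      rw [abs_of_nonneg (hZa.trans hy.1.le)]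
      exact hy.2
    obtain ⟨c, hc, rfl⟩ := hyU
    rw [hk c hc]
    exact (H c hc (hac.trans ((hZm.lt_iff_lt ha hc).1 hy.1))).le

/-- When `C 𝓖` reaches `1`, every value in `(0, 1]` of the sine is available, so the model lives on
the whole of `(-1, 1)`. -/
theorem IsPrim.exists_catenoid (hp : IsRate B p) (hF : IsPrim B p F) (hC : 0 < C) {t : ℝ}
    (ht : t ∈ posBelow B) (hCt : C * gFun F t = 1) :
    ∃ l X Z S : ℝ → ℝ, IsModel B p F C (Ioo (-1) 1) l X Z S ∧ S '' Ioo (-1) 1 = univ ∧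
      ∃ τ > 0, ∀ z₀, IsCatenoidTrace τ ((fun c => (X c, z₀ + Z c)) '' Ioo (-1) 1) := by
  obtain ⟨l, X, Z, S, h, hZ, hS⟩ := hF.exists_isModel hp hC isOpen_Ioo ordConnected_Ioo
    Subset.rfl (fun c hc => hF.mem_image_gFun hp ht (div_pos (sine_pos hc) hC) (by
      rw [div_le_iff₀ hC, mul_comm, hCt]
      exact sine_le_one c)) (show (0 : ℝ) ∈ Ioo (-1 : ℝ) 1 by simp)
  exact ⟨l, X, Z, S, h, h.image_S_eq_univ hp hF hS, X 0, h.X_pos (by simp),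
    h.isCatenoidTrace hp hF hZ⟩

/-! ### Pinched and singular catenoids -/

/-- The cosines of the angles of a graph of first integral `C`. -/
def graphDomain (B : EReal) (F : ℝ → ℝ) (C : ℝ) : Set ℝ :=
  {c | c ∈ Ioo (0 : ℝ) 1 ∧ sine c / C ∈ gFun F '' posBelow B}

theorem graphDomain_subset : graphDomain B F C ⊆ Ioo 0 1 := fun _ h => h.1

theorem sine_le_sine {a c : ℝ} (ha : 0 ≤ a) (hac : a ≤ c) : sine c ≤ sine a :=
  Real.sqrt_le_sqrt (by nlinarith)

/-- For nonnegative cosines the sine decreases, and the image of `𝓖` contains all smaller positive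
numbers. -/
theorem IsPrim.mem_graphDomain_of_le (hp : IsRate B p) (hF : IsPrim B p F) (hC : 0 < C) {a c : ℝ}
    (ha : a ∈ graphDomain B F C) (hac : a ≤ c) (hc : c < 1) : c ∈ graphDomain B F C := by
  have hc0 : c ∈ Ioo (0 : ℝ) 1 := ⟨ha.1.1.trans_le hac, hc⟩
  refine ⟨hc0, ?_⟩
  obtain ⟨t, ht, hta⟩ := ha.2
  refine hF.mem_image_gFun hp ht (div_pos (sine_pos ⟨by linarith [hc0.1], hc⟩) hC) ?_
  rw [hta]
  exact div_le_div_of_nonneg_right (sine_le_sine ha.1.1.le hac) hC.le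

theorem IsPrim.isOpen_graphDomain (hp : IsRate B p) (hF : IsPrim B p F) :
    IsOpen (graphDomain B F C) := by
  have := (exists_inverse (isOpen_posBelow B) (ordConnected_posBelow B)
    (fun t ht => hF.hasDerivAt_gFun hp ht) (fun t ht => IsPrim.deriv_gFun_pos hp ht)).1
  exact isOpen_Ioo.inter (this.preimage (continuous_sine.div_const C))

theorem exists_mem_graphDomain (hC : 0 < C)
    (hlt : ∀ t ∈ posBelow B, C * gFun F t < 1) {t : ℝ} (ht : t ∈ posBelow B) :
    ∃ c ∈ graphDomain B F C, sine c = C * gFun F t := by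
  have h0 : 0 < C * gFun F t := mul_pos hC (gFun_pos ht.1)
  have e := sine_sqrt h0.le (hlt t ht).le
  refine ⟨√(1 - (C * gFun F t) ^ 2), ⟨⟨?_, ?_⟩, ?_⟩, e⟩
  · exact Real.sqrt_pos.2 (by nlinarith [hlt t ht])
  · rw [Real.sqrt_lt' one_pos]
    nlinarith [sq_pos_of_pos h0]
  · rw [e, mul_div_cancel_left₀ _ hC.ne']
    exact mem_image_of_mem _ ht

/-- For `c > 0` the radius increases with `c` and can serve as parameter; the slope `sine c / c` is
then decreasing, so the graph is concave. -/
theorem IsModel.isGraphTrace (hp : IsRate B p) (h : IsModel B p F C D l X Z S)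
    (hD : D ⊆ Ioo 0 1) (hl : AntitoneOn l D) {d : ℝ} (hXD : X '' D = Ioi d) (z₀ : ℝ) :
    IsGraphTrace d ((fun c => (X c, z₀ + Z c)) '' D) := by
  have hpl : ∀ c ∈ D, 0 < p (l c) := fun c hc => hp.pos _ (h.l_mem c hc)
  have hs : ∀ c ∈ D, 0 < sine c := fun c hc => sine_pos (h.subset hc)
  have hXp : ∀ c ∈ D, 0 < c / (p (l c) * sine c) := fun c hc =>
    div_pos (hD hc).1 (mul_pos (hpl c hc) (hs c hc))
  have hXm := strictMonoOn_of_hasDerivAt_pos h.isOpen h.ordConnected h.hasDerivAt_X hXp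
  obtain ⟨-, -, k, hk, hk'⟩ := exists_inverse h.isOpen h.ordConnected h.hasDerivAt_X hXp
  rw [hXD] at hk'
  have hsurj : ∀ r ∈ Ioi d, ∃ c ∈ D, X c = r := fun r hr => by rwa [← hXD] at hr
  set v : ℝ → ℝ := fun r => z₀ + Z (k r) with hv
  have hd₁ : ∀ r ∈ Ioi d, HasDerivAt v (sine (k r) / k r) r := by
    intro r hr
    obtain ⟨c, hc, rfl⟩ := hsurj r hr
    have hkd := hk' _ hr
    rw [hk c hc] at hkd ⊢
    refine ((HasDerivAt.comp (X c)
      (by rw [hk c hc]; exact h.hasDerivAt_Z c hc) hkd).const_add z₀).congr_deriv ?_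
    have h1 := (hpl c hc).ne'
    have h2 := (hs c hc).ne'
    have h3 := (hD hc).1.ne'
    field_simp
  have hd₂ : ∀ r ∈ Ioi d, HasDerivAt (fun r => sine (k r) / k r) (-p (l (k r)) / k r ^ 3) r := by
    intro r hr
    obtain ⟨c, hc, rfl⟩ := hsurj r hr
    have hkd := hk' _ hr
    rw [hk c hc] at hkd ⊢
    have h1 := (hpl c hc).ne'
    have h2 := (hs c hc).ne'
    have h3 := (hD hc).1.ne'
    refine (HasDerivAt.comp (h₂ := fun c => sine c / c) (X c) (by
      rw [hk c hc]
      exact (hasDerivAt_sine (h.subset hc)).div (hasDerivAt_id c) h3) hkd).congr_deriv ?_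
    have h4 := sine_sq (h.subset hc)
    field_simp
    rw [h4]
    ring
  have hkm : MapsTo k (Ioi d) D := fun r hr => by
    obtain ⟨c, hc, rfl⟩ := hsurj r hr
    rwa [hk c hc]
  have hkc : ContinuousOn k (Ioi d) := fun y hy => (hk' y hy).continuousAt.continuousWithinAt
  have hkmono : MonotoneOn k (Ioi d) := by
    intro a ha b hb hab
    obtain ⟨a', ha', rfl⟩ := hsurj a ha
    obtain ⟨b', hb', rfl⟩ := hsurj b hb
    rw [hk _ ha', hk _ hb']
    exact (hXm.le_iff_le ha' hb').1 hab
  have hslope : AntitoneOn (fun r => sine (k r) / k r) (Ioi d) := by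
    intro a ha b hb hab
    exact div_le_div₀ (hs _ (hkm ha)).le (sine_le_sine (hD (hkm ha)).1.le (hkmono ha hb hab))
      (hD (hkm ha)).1 (hkmono ha hb hab)
  have hvmono : MonotoneOn v (Ioi d) :=
    monotoneOn_of_hasDerivAt_nonneg isOpen_Ioi ordConnected_Ioi hd₁ fun r hr =>
      (div_pos (hs _ (hkm hr)) (hD (hkm hr)).1).le
  -- As `c` decreases, `λ` and `p(λ)` increase, so `Z' = 1/p` stays bounded on a bounded range of
  -- `c`: the height has a finite limit at the inner end.
  have hbdd : BddBelow (v '' Ioi d) := by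
    obtain ⟨a, ha⟩ := h.nonempty
    have hmono : AntitoneOn (fun c => Z c - (p (l a))⁻¹ * c) (D ∩ Iio a) := by
      refine antitoneOn_of_hasDerivAt_nonpos (h.isOpen.inter isOpen_Iio)
        (h.ordConnected.inter ordConnected_Iio)
        (fun c hc => (h.hasDerivAt_Z c hc.1).sub ((hasDerivAt_id c).const_mul _)) fun c hc => ?_
      have h1 : (p (l c))⁻¹ ≤ (p (l a))⁻¹ := inv_anti₀ (hpl a ha)
        (hp.mono (h.l_mem a ha) (h.l_mem c hc.1) (hl hc.1 ha (le_of_lt hc.2)))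
      linarith
    obtain ⟨a', ha', haa⟩ : ∃ a' ∈ D, a' < a := by
      obtain ⟨e, he, hball⟩ := Metric.isOpen_iff.1 h.isOpen a ha
      exact ⟨a - e / 2, hball (by simp [abs_of_pos, he]), by linarith⟩
    have hZm := strictMonoOn_of_hasDerivAt_pos h.isOpen h.ordConnected h.hasDerivAt_Z
      fun c hc => inv_pos.2 (hpl c hc)
    refine ⟨z₀ + (Z a' - (p (l a))⁻¹), ?_⟩
    rintro _ ⟨r, hr, rfl⟩
    have hkr := hkm hr
    have hpa := inv_pos.2 (hpl a ha)
    change z₀ + (Z a' - (p (l a))⁻¹) ≤ z₀ + Z (k r)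
    rcases le_total (k r) a' with hle | hle
    · have := hmono ⟨hkr, hle.trans_lt haa⟩ ⟨ha', haa⟩ hle
      simp only at this
      have h2 := (hD ha').2
      have h3 := (hD hkr).1
      have h4 := mul_pos hpa h3
      have h5 := mul_lt_mul_of_pos_left h2 hpa
      linarith
    · linarith [hZm.monotoneOn ha' hkr hle]
  have hlim := hvmono.tendsto_nhdsGT hbdd
  -- Nothing controls the value of `v` at `d`; it is replaced by the limit.
  set u : ℝ → ℝ := Function.update v d (sInf (v '' Ioi d)) with hu
  have huv : ∀ r ∈ Ioi d, u r = v r := fun r hr => Function.update_of_ne (ne_of_gt hr) _ _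
  have hud : u d = sInf (v '' Ioi d) := Function.update_self _ _ _
  refine ⟨u, ?_, ?_, Or.inr ?_, ?_, ?_⟩
  · rw [← hXD, image_image]
    refine image_congr fun c hc => ?_
    rw [huv _ (hXD ▸ mem_image_of_mem X hc), hv]
    simp only [hk c hc]
  · refine (contDiffOn_two_of_hasDerivAt isOpen_Ioi hd₁ hd₂ ?_).congr huv
    refine ContinuousOn.div ?_ (hkc.pow 3) fun r hr => (pow_pos (hD (hkm hr)).1 3).ne'
    exact (hp.cont.comp (h.l_cont.comp hkc hkm) fun y hy => h.l_mem _ (hkm hy)).neg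
  · have : ConvexOn ℝ (Ioi d) (fun r => -v r) :=
      convexOn_of_hasDerivAt_of_monotoneOn isOpen_Ioi ordConnected_Ioi
        (fun r hr => (hd₁ r hr).neg) hslope.neg
    exact (neg_convexOn_iff.1 this).congr fun r hr => (huv r hr).symm
  · rw [ContinuousWithinAt, hud]
    exact hlim.congr' (by filter_upwards [self_mem_nhdsWithin] with r hr using (huv r hr).symm)
  · have h1 : d + 1 ∈ Ioi d := by simp
    -- The slope decreases with the radius, so on `(d, d + 1)` it is at least its value `m` at `d +
    -- 1`.
    set m := sine (k (d + 1)) / k (d + 1) with hm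
    refine ⟨m, div_pos (hs _ (hkm h1)) (hD (hkm h1)).1, fun r hr hr1 => ?_⟩
    have hmono : MonotoneOn (fun r => v r - m * r) (Ioo d (d + 1)) :=
      monotoneOn_of_hasDerivAt_nonneg isOpen_Ioo ordConnected_Ioo
        (fun r hr => (hd₁ r hr.1).sub ((hasDerivAt_id r).const_mul m)) fun r hr => by
          have := hslope hr.1 h1 hr.2.le
          simp only at this
          linarith
    have hlim' : Tendsto (fun r => v r - m * r) (𝓝[>] d) (𝓝 (sInf (v '' Ioi d) - m * d)) :=
      hlim.sub ((continuous_const.mul continuous_id).tendsto d |>.mono_left inf_le_left)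
    have := le_of_tendsto hlim' (b := v r - m * r) (by
      filter_upwards [Ioo_mem_nhdsGT hr] with y hy
      exact hmono ⟨hy.1, hy.2.trans hr1⟩ ⟨hr, hr1⟩ hy.2.le)
    rw [huv r hr, hud]
    refine le_trans ?_ (le_abs_self _)
    linarith

/-- If `C 𝓖 < 1`, then there is a graph of first integral `C`. -/
theorem IsPrim.exists_graph (hp : IsRate B p) (hF : IsPrim B p F) (hC : 0 < C)
    (hlt : ∀ t ∈ posBelow B, C * gFun F t < 1) :
    ∃ l X Z S : ℝ → ℝ, IsModel B p F C (graphDomain B F C) l X Z S ∧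
      ∃ d, (B = ⊤ → d = 0) ∧ (B ≠ ⊤ → 0 < d) ∧ X '' graphDomain B F C = Ioi d ∧
        (∀ z₀, IsGraphTrace d ((fun c => (X c, z₀ + Z c)) '' graphDomain B F C)) ∧
        (B ≠ ⊤ → ∀ M : ℝ, ∃ r₀ > d, ∀ c ∈ graphDomain B F C, X c < r₀ → M ≤ p (l c)) := by
  obtain ⟨t₀, ht₀⟩ := hp.nonempty
  obtain ⟨a, ha, -⟩ := exists_mem_graphDomain hC hlt ht₀
  obtain ⟨l, X, Z, S, h, -⟩ := hF.exists_isModel hp hC (hF.isOpen_graphDomain hp)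
    ⟨fun a ha b hb c hc => hF.mem_graphDomain_of_le hp hC ha hc.1 (hc.2.trans_lt hb.1.2)⟩
    (fun c hc => ⟨by linarith [hc.1.1], hc.1.2⟩) (fun c hc => hc.2) ha
  have hl : AntitoneOn l (graphDomain B F C) := by
    intro a ha b hb hab
    rw [← (hF.strictMonoOn_gFun hp).le_iff_le (h.l_mem b hb) (h.l_mem a ha),
      ← mul_le_mul_iff_right₀ hC, h.l_eq a ha, h.l_eq b hb]
    exact sine_le_sine ha.1.1.le hab
  have hsurj : ∀ t ∈ posBelow B, ∃ c ∈ graphDomain B F C, l c = t := by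
    intro t ht
    obtain ⟨c, hc, hct⟩ := exists_mem_graphDomain hC hlt ht
    rw [← h.l_eq c hc] at hct
    exact ⟨c, hc, (hF.strictMonoOn_gFun hp).injOn (h.l_mem c hc) ht
      (mul_left_cancel₀ hC.ne' hct)⟩
  have hXp : ∀ c ∈ graphDomain B F C, 0 < c / (p (l c) * sine c) := fun c hc =>
    div_pos hc.1.1 (mul_pos (hp.pos _ (h.l_mem c hc)) (sine_pos (h.subset hc)))
  obtain ⟨hXo, hXc, -⟩ := exists_inverse h.isOpen h.ordConnected h.hasDerivAt_X hXp
  have hbdd : BddBelow (X '' graphDomain B F C) :=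
    ⟨0, by rintro _ ⟨c, hc, rfl⟩; exact (h.X_pos hc).le⟩
  have hbdd' : ¬ BddAbove (X '' graphDomain B F C) := by
    rintro ⟨M, hM⟩
    obtain ⟨c₀, hc₀, H⟩ := h.exists_lt_X hp hF M
    have h1 : max c₀ a < 1 := max_lt hc₀ ha.1.2
    have hc := hF.mem_graphDomain_of_le hp hC ha (c := (max c₀ a + 1) / 2)
      (by linarith [le_max_right c₀ a]) (by linarith)
    exact absurd (hM (mem_image_of_mem X hc)) (not_le.2 (H _ hc (by linarith [le_max_left c₀ a])))
  have hXD := eq_Ioi_csInf hXo hXc hbdd hbdd'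
  have hne : (X '' graphDomain B F C).Nonempty := ⟨_, mem_image_of_mem X ha⟩
  refine ⟨l, X, Z, S, h, _, ?_, ?_, hXD,
    h.isGraphTrace hp graphDomain_subset hl hXD, ?_⟩
  · rintro rfl
    refine le_antisymm (le_of_forall_pos_lt_add fun ε hε => ?_)
      (le_csInf hne (by rintro _ ⟨c, hc, rfl⟩; exact (h.X_pos hc).le))
    -- All curvatures occur, and a point with `λ = 2/ε` has radius `sin/λ ≤ ε/2`.
    obtain ⟨c, hc, hlc⟩ := hsurj (2 / ε) ⟨by positivity, EReal.coe_lt_top _⟩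
    refine (csInf_le hbdd (mem_image_of_mem X hc)).trans_lt ?_
    have h1 := h.sine_div_X hc
    rw [hlc, div_eq_div_iff (h.X_pos hc).ne' hε.ne'] at h1
    nlinarith [sine_le_one c]
  · intro hB
    obtain ⟨m, hm⟩ := hF.exists_le hp hB
    refine lt_of_lt_of_le (mul_pos hC (Real.exp_pos m)) (le_csInf hne ?_)
    rintro _ ⟨c, hc, rfl⟩
    rw [h.X_eq c hc]
    exact mul_le_mul_of_nonneg_left (Real.exp_le_exp.2 (hm _ (h.l_mem c hc))) hC.le
  · intro hB M
    obtain ⟨t, ht, htM⟩ := hp.blowup hB M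
    -- The radius `C exp F(λ)` decreases in `λ`, so points closer to the axis than the one with `λ =
    -- t` have larger `λ`, hence larger `p`.
    obtain ⟨b, hb, hbt⟩ := hsurj t ht
    refine ⟨X b, ?_, fun c hc hcb => htM.trans (hp.mono ht (h.l_mem c hc) ?_)⟩
    · have := mem_image_of_mem X hb
      rwa [hXD] at this
    · rw [h.X_eq c hc, h.X_eq b hb, hbt] at hcb
      have := Real.exp_lt_exp.1 ((mul_lt_mul_iff_right₀ hC).1 hcb)
      exact ((hF.strictAntiOn hp).lt_iff_gt (h.l_mem c hc) ht).1 this |>.le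

end

/-! ### Principal curvatures of rotational surfaces -/

theorem hasDerivAt_vec3 {f g h : ℝ → ℝ} {f' g' h' t : ℝ} (hf : HasDerivAt f f' t)
    (hg : HasDerivAt g g' t) (hh : HasDerivAt h h' t) :
    HasDerivAt (fun t => (!₂[f t, g t, h t] : E3)) !₂[f', g', h'] t := by
  rw [hasDerivAt_iff_hasFDerivAt, ← hasFDerivWithinAt_univ, hasFDerivWithinAt_euclidean]
  intro i
  fin_cases i
  · exact hf.hasFDerivAt.hasFDerivWithinAt.congr_fderiv (by ext; simp)
  · exact hg.hasFDerivAt.hasFDerivWithinAt.congr_fderiv (by ext; simp)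
  · exact hh.hasFDerivAt.hasFDerivWithinAt.congr_fderiv (by ext; simp)

theorem inner_vec3 (a b c a' b' c' : ℝ) :
    inner ℝ (!₂[a, b, c] : E3) !₂[a', b', c'] = a * a' + b * b' + c * c' := by
  simp [PiLp.inner_apply, Fin.sum_univ_three]
  ring

theorem fderiv_apply_fst {E : Type*} [NormedAddCommGroup E] [NormedSpace ℝ E] {X : ℝ × ℝ → E}
    {s θ : ℝ} {v : E} (hX : DifferentiableAt ℝ X (s, θ))
    (h : HasDerivAt (fun t => X (t, θ)) v s) : fderiv ℝ X (s, θ) (1, 0) = v :=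
  (hX.hasFDerivAt.comp_hasDerivAt s
    ((hasDerivAt_id s).prodMk (hasDerivAt_const s θ))).unique h

theorem fderiv_apply_snd {E : Type*} [NormedAddCommGroup E] [NormedSpace ℝ E] {X : ℝ × ℝ → E}
    {s θ : ℝ} {v : E} (hX : DifferentiableAt ℝ X (s, θ))
    (h : HasDerivAt (fun t => X (s, t)) v θ) : fderiv ℝ X (s, θ) (0, 1) = v :=
  (hX.hasFDerivAt.comp_hasDerivAt θ
    ((hasDerivAt_const θ s).prodMk (hasDerivAt_id θ))).unique h

theorem mean_add_sqrt (a b : ℝ) :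
    (a + b) / 2 + √(((a + b) / 2) ^ 2 - a * b) = max a b ∧
      (a + b) / 2 - √(((a + b) / 2) ^ 2 - a * b) = min a b := by
  have : ((a + b) / 2) ^ 2 - a * b = ((a - b) / 2) ^ 2 := by ring
  rw [this, Real.sqrt_sq_eq_abs]
  rcases le_total a b with h | h
  · rw [abs_of_nonpos (by linarith), max_eq_right h, min_eq_left h]
    constructor <;> ring
  · rw [abs_of_nonneg (by linarith), max_eq_left h, min_eq_right h]
    constructor <;> ring

namespace RotSurface

variable (S : RotSurface)

/-- The derivative of `x`. -/
def dx (s : ℝ) : ℝ := derivWithin S.x S.J s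

/-- The derivative of `z`. -/
def dz (s : ℝ) : ℝ := derivWithin S.z S.J s

/-- The second derivative of `x`. -/
def ddx (s : ℝ) : ℝ := derivWithin S.dx S.J s

/-- The second derivative of `z`. -/
def ddz (s : ℝ) : ℝ := derivWithin S.dz S.J s

/-- The curvature of the profile curve. -/
def profCurv (s : ℝ) : ℝ := S.ddz s * S.dx s - S.ddx s * S.dz s

/-- The rotational principal curvature. -/
def rotCurv (s : ℝ) : ℝ := S.dz s / S.x s

theorem interior_nonempty : (interior S.J).Nonempty := by
  obtain ⟨a, ha, b, hb, hab⟩ := S.nontrivial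
  have key : ∀ a ∈ S.J, ∀ b ∈ S.J, a < b → (interior S.J).Nonempty := fun a ha b hb h =>
    ⟨(a + b) / 2, interior_mono (S.interval.out ha hb) (by
      rw [interior_Icc]; exact ⟨by linarith, by linarith⟩)⟩
  rcases lt_or_gt_of_ne hab with h | h
  exacts [key a ha b hb h, key b hb a ha h]

theorem uniqueDiffOn : UniqueDiffOn ℝ S.J :=
  uniqueDiffOn_convex S.interval.convex S.interior_nonempty

theorem derivWithin_of_contDiffOn_two {J : Set ℝ} (hu : UniqueDiffOn ℝ J) {x : ℝ → ℝ}
    (h : ContDiffOn ℝ 2 x J) :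
    DifferentiableOn ℝ x J ∧ DifferentiableOn ℝ (derivWithin x J) J ∧
      ContinuousOn (derivWithin (derivWithin x J) J) J := by
  rw [show (2 : WithTop ℕ∞) = 1 + 1 by norm_num, contDiffOn_succ_iff_derivWithin hu] at h
  have h2 := h.2.2
  rw [show (1 : WithTop ℕ∞) = 0 + 1 by norm_num, contDiffOn_succ_iff_derivWithin hu,
    contDiffOn_zero] at h2
  exact ⟨h.1, h2.1, h2.2.2⟩

theorem hasDerivWithinAt_x {s : ℝ} (hs : s ∈ S.J) : HasDerivWithinAt S.x (S.dx s) S.J s :=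
  ((derivWithin_of_contDiffOn_two S.uniqueDiffOn S.contDiffOn_x).1 s hs).hasDerivWithinAt

theorem hasDerivWithinAt_z {s : ℝ} (hs : s ∈ S.J) : HasDerivWithinAt S.z (S.dz s) S.J s :=
  ((derivWithin_of_contDiffOn_two S.uniqueDiffOn S.contDiffOn_z).1 s hs).hasDerivWithinAt

theorem hasDerivWithinAt_dx {s : ℝ} (hs : s ∈ S.J) : HasDerivWithinAt S.dx (S.ddx s) S.J s :=
  ((derivWithin_of_contDiffOn_two S.uniqueDiffOn S.contDiffOn_x).2.1 s hs).hasDerivWithinAt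

theorem hasDerivWithinAt_dz {s : ℝ} (hs : s ∈ S.J) : HasDerivWithinAt S.dz (S.ddz s) S.J s :=
  ((derivWithin_of_contDiffOn_two S.uniqueDiffOn S.contDiffOn_z).2.1 s hs).hasDerivWithinAt

variable {S}

theorem dx_sq_add_dz_sq {s : ℝ} (hs : s ∈ S.J) : S.dx s ^ 2 + S.dz s ^ 2 = 1 := S.arcLength s hs

theorem subset_interior {s : ℝ} (hs : s ∈ interior S.J) : s ∈ S.J := interior_subset hs

theorem hasDerivAt_x {s : ℝ} (hs : s ∈ interior S.J) : HasDerivAt S.x (S.dx s) s :=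
  (S.hasDerivWithinAt_x (subset_interior hs)).hasDerivAt (mem_interior_iff_mem_nhds.1 hs)

theorem hasDerivAt_z {s : ℝ} (hs : s ∈ interior S.J) : HasDerivAt S.z (S.dz s) s :=
  (S.hasDerivWithinAt_z (subset_interior hs)).hasDerivAt (mem_interior_iff_mem_nhds.1 hs)

theorem hasDerivAt_dx {s : ℝ} (hs : s ∈ interior S.J) : HasDerivAt S.dx (S.ddx s) s :=
  (S.hasDerivWithinAt_dx (subset_interior hs)).hasDerivAt (mem_interior_iff_mem_nhds.1 hs)

theorem hasDerivAt_dz {s : ℝ} (hs : s ∈ interior S.J) : HasDerivAt S.dz (S.ddz s) s :=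
  (S.hasDerivWithinAt_dz (subset_interior hs)).hasDerivAt (mem_interior_iff_mem_nhds.1 hs)

theorem dx_mul_ddx {s : ℝ} (hs : s ∈ interior S.J) :
    S.dx s * S.ddx s + S.dz s * S.ddz s = 0 := by
  have h1 : HasDerivAt (fun t => S.dx t ^ 2 + S.dz t ^ 2)
      (2 * S.dx s ^ 1 * S.ddx s + 2 * S.dz s ^ 1 * S.ddz s) s :=
    ((hasDerivAt_dx hs).pow 2).add ((hasDerivAt_dz hs).pow 2)
  have h2 : HasDerivAt (fun t => S.dx t ^ 2 + S.dz t ^ 2) 0 s :=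
    (hasDerivAt_const s (1 : ℝ)).congr_of_eventuallyEq (by
      filter_upwards [mem_interior_iff_mem_nhds.1 hs] with t ht using dx_sq_add_dz_sq ht)
  have := h1.unique h2
  linarith

theorem contDiffAt_param {s : ℝ} (hs : s ∈ interior S.J) (θ : ℝ) :
    ContDiffAt ℝ 2 S.param (s, θ) := by
  have hx : ContDiffAt ℝ 2 (fun q : ℝ × ℝ => S.x q.1) (s, θ) :=
    (S.contDiffOn_x.contDiffAt (mem_interior_iff_mem_nhds.1 hs)).comp (s, θ) contDiffAt_fst
  have hz : ContDiffAt ℝ 2 (fun q : ℝ × ℝ => S.z q.1) (s, θ) :=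
    (S.contDiffOn_z.contDiffAt (mem_interior_iff_mem_nhds.1 hs)).comp (s, θ) contDiffAt_fst
  rw [contDiffAt_euclidean]
  intro i
  fin_cases i
  · exact hx.mul (Real.contDiff_cos.contDiffAt.comp (s, θ) contDiffAt_snd)
  · exact hx.mul (Real.contDiff_sin.contDiffAt.comp (s, θ) contDiffAt_snd)
  · exact hz

theorem fderiv_param_fst {s : ℝ} (hs : s ∈ interior S.J) (θ : ℝ) :
    fderiv ℝ S.param (s, θ) (1, 0) =
      !₂[S.dx s * Real.cos θ, S.dx s * Real.sin θ, S.dz s] :=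
  fderiv_apply_fst ((contDiffAt_param hs θ).differentiableAt (by norm_num))
    (hasDerivAt_vec3 ((hasDerivAt_x hs).mul_const (Real.cos θ))
      ((hasDerivAt_x hs).mul_const (Real.sin θ)) (hasDerivAt_z hs))

theorem fderiv_param_snd {s : ℝ} (hs : s ∈ interior S.J) (θ : ℝ) :
    fderiv ℝ S.param (s, θ) (0, 1) =
      !₂[S.x s * -Real.sin θ, S.x s * Real.cos θ, 0] :=
  fderiv_apply_snd ((contDiffAt_param hs θ).differentiableAt (by norm_num))
    (hasDerivAt_vec3 ((Real.hasDerivAt_cos θ).const_mul (S.x s))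
      ((Real.hasDerivAt_sin θ).const_mul (S.x s)) (hasDerivAt_const θ (S.z s)))

theorem fderiv_fderiv_param {s : ℝ} (hs : s ∈ interior S.J) (θ : ℝ) :
    fderiv ℝ (fderiv ℝ S.param) (s, θ) (1, 0) (1, 0) =
        !₂[S.ddx s * Real.cos θ, S.ddx s * Real.sin θ, S.ddz s] ∧
      fderiv ℝ (fderiv ℝ S.param) (s, θ) (1, 0) (0, 1) =
        !₂[S.dx s * -Real.sin θ, S.dx s * Real.cos θ, 0] ∧
      fderiv ℝ (fderiv ℝ S.param) (s, θ) (0, 1) (0, 1) =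
        !₂[S.x s * -Real.cos θ, S.x s * -Real.sin θ, 0] := by
  have hd : DifferentiableAt ℝ (fderiv ℝ S.param) (s, θ) :=
    ((contDiffAt_param hs θ).fderiv_right (m := 1) (by norm_num)).differentiableAt (by norm_num)
  -- Second derivatives are computed by differentiating the first derivative along a fixed vector,
  -- whose formula is known nearby.
  have hap : ∀ v w : ℝ × ℝ, fderiv ℝ (fderiv ℝ S.param) (s, θ) v w =
      fderiv ℝ (fun q => fderiv ℝ S.param q w) (s, θ) v := fun v w => by
    rw [fderiv_clm_apply hd (differentiableAt_const w)]
    simp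
  have hdw : ∀ w : ℝ × ℝ, DifferentiableAt ℝ (fun q => fderiv ℝ S.param q w) (s, θ) :=
    fun w => hd.clm_apply (differentiableAt_const w)
  have hnear : ∀ᶠ t in 𝓝 s, t ∈ interior S.J := isOpen_interior.mem_nhds hs
  refine ⟨?_, ?_, ?_⟩
  · rw [hap]
    refine fderiv_apply_fst (hdw _) (HasDerivAt.congr_of_eventuallyEq (hasDerivAt_vec3
      ((hasDerivAt_dx hs).mul_const _) ((hasDerivAt_dx hs).mul_const _) (hasDerivAt_dz hs)) ?_)
    filter_upwards [hnear] with t ht using fderiv_param_fst ht θ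
  · rw [hap]
    refine fderiv_apply_fst (hdw _) (HasDerivAt.congr_of_eventuallyEq (hasDerivAt_vec3
      ((hasDerivAt_x hs).mul_const _) ((hasDerivAt_x hs).mul_const _) (hasDerivAt_const s 0)) ?_)
    filter_upwards [hnear] with t ht using fderiv_param_snd ht θ
  · rw [hap]
    refine fderiv_apply_snd (hdw _) (HasDerivAt.congr_of_eventuallyEq (hasDerivAt_vec3
      ((Real.hasDerivAt_sin θ).neg.const_mul _) ((Real.hasDerivAt_cos θ).const_mul _)
      (hasDerivAt_const θ 0)) ?_)
    exact Eventually.of_forall fun t => fderiv_param_snd hs t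

/-- Meridians and parallels are lines of curvature: both fundamental forms are diagonal, so `2H` and
`K` are the sum and product of the two curvatures. -/
theorem kappa_eq {s : ℝ} (hs : s ∈ interior S.J) (hx : 0 < S.x s) (θ : ℝ) :
    kappa1 S.param (S.normal (s, θ)) (s, θ) = max (S.profCurv s) (S.rotCurv s) ∧
      kappa2 S.param (S.normal (s, θ)) (s, θ) = min (S.profCurv s) (S.rotCurv s) := by
  obtain ⟨h1, h2, h3⟩ := fderiv_fderiv_param hs θ
  have hN : S.normal (s, θ) = !₂[-S.dz s * Real.cos θ, -S.dz s * Real.sin θ, S.dx s] := rfl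
  have hcs := Real.cos_sq_add_sin_sq θ
  have hu := dx_sq_add_dz_sq (subset_interior hs)
  have E : firstForm S.param (s, θ) (1, 0) (1, 0) = 1 := by
    rw [firstForm, fderiv_param_fst hs, inner_vec3]
    linear_combination S.dx s ^ 2 * hcs + hu
  have F : firstForm S.param (s, θ) (1, 0) (0, 1) = 0 := by
    rw [firstForm, fderiv_param_fst hs, fderiv_param_snd hs, inner_vec3]
    ring
  have G : firstForm S.param (s, θ) (0, 1) (0, 1) = S.x s ^ 2 := by
    rw [firstForm, fderiv_param_snd hs, inner_vec3]
    linear_combination S.x s ^ 2 * hcs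
  have L : secondForm S.param (S.normal (s, θ)) (s, θ) (1, 0) (1, 0) = S.profCurv s := by
    rw [secondForm, h1, hN, inner_vec3, profCurv]
    linear_combination -S.ddx s * S.dz s * hcs
  have M : secondForm S.param (S.normal (s, θ)) (s, θ) (1, 0) (0, 1) = 0 := by
    rw [secondForm, h2, hN, inner_vec3]
    ring
  have N : secondForm S.param (S.normal (s, θ)) (s, θ) (0, 1) (0, 1) = S.x s * S.dz s := by
    rw [secondForm, h3, hN, inner_vec3]
    linear_combination S.x s * S.dz s * hcs
  have hH : meanCurv S.param (S.normal (s, θ)) (s, θ) = (S.profCurv s + S.rotCurv s) / 2 := by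
    rw [meanCurv, areaSq, E, F, G, L, M, N, rotCurv]
    field_simp
    ring
  have hK : gaussCurv S.param (S.normal (s, θ)) (s, θ) = S.profCurv s * S.rotCurv s := by
    rw [gaussCurv, areaSq, E, F, G, L, M, N, rotCurv]
    field_simp
    ring
  rw [kappa1, kappa2, hH, hK]
  exact mean_add_sqrt _ _

/-- The Codazzi equation of a rotational surface. -/
theorem hasDerivAt_rotCurv {s : ℝ} (hs : s ∈ interior S.J) (hx : 0 < S.x s) :
    HasDerivAt S.rotCurv (S.dx s * (S.profCurv s - S.rotCurv s) / S.x s) s := by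
  refine ((hasDerivAt_dz hs).div (hasDerivAt_x hs) hx.ne').congr_deriv ?_
  have h1 := dx_sq_add_dz_sq (subset_interior hs)
  have h2 := dx_mul_ddx hs
  rw [profCurv, rotCurv]
  field_simp
  linear_combination (-S.x s * S.ddz s) * h1 + S.x s * S.dz s * h2

theorem continuousOn_rotCurv (hpos : ∀ s ∈ interior S.J, 0 < S.x s) :
    ContinuousOn S.rotCurv (interior S.J) := fun s hs =>
  (hasDerivAt_rotCurv hs (hpos s hs)).continuousAt.continuousWithinAt

theorem ordConnected_interior : (interior S.J).OrdConnected :=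
  S.interval.convex.interior.ordConnected

/-- The arc of the profile over an interval where `λ` has the sign `σ` and the curvatures are
related by `k = -σ p(σ λ)`. -/
theorem isProfile {B : EReal} {p : ℝ → ℝ} {σ : ℝ} (hσ : σ = 1 ∨ σ = -1) {J : Set ℝ}
    (hJ : IsOpen J) (hJc : J.OrdConnected) (hJn : J.Nonempty) (hsub : J ⊆ interior S.J)
    (hx : ∀ s ∈ J, 0 < S.x s)
    (hrel : ∀ s ∈ J, σ * S.rotCurv s ∈ posBelow B ∧
      S.profCurv s = -σ * p (σ * S.rotCurv s)) :
    IsProfile B p J S.x (fun s => σ * S.z s) S.dx ∧ ∀ s ∈ J, sine (S.dx s) = σ * S.dz s := by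
  have hσ2 : σ ^ 2 = 1 := by rcases hσ with rfl | rfl <;> norm_num
  have hz : ∀ s ∈ J, 0 < σ * S.dz s := fun s hs => by
    have := mul_pos (hrel s hs).1.1 (hx s hs)
    rwa [mul_assoc, rotCurv, div_mul_cancel₀ _ (hx s hs).ne'] at this
  have hu : ∀ s ∈ J, S.dx s ^ 2 + S.dz s ^ 2 = 1 := fun s hs =>
    dx_sq_add_dz_sq (interior_subset (hsub hs))
  have hsine : ∀ s ∈ J, sine (S.dx s) = σ * S.dz s := fun s hs => by
    have : 1 - S.dx s ^ 2 = (σ * S.dz s) ^ 2 := by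
      rw [mul_pow, hσ2]
      linarith [hu s hs]
    rw [sine, this, Real.sqrt_sq (hz s hs).le]
  have hlam : ∀ s ∈ J, sine (S.dx s) / S.x s = σ * S.rotCurv s := fun s hs => by
    rw [hsine s hs, rotCurv, mul_div_assoc]
  refine ⟨⟨hJ, hJc, hJn, hx, fun s hs => ?_, fun s hs => hasDerivAt_x (hsub hs), fun s hs => ?_,
    fun s hs => ?_, fun s hs => ?_⟩, hsine⟩
  · have h1 : 0 < S.dz s ^ 2 := by
      have := sq_pos_of_pos (hz s hs)
      rwa [mul_pow, hσ2, one_mul] at this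
    rw [mem_Ioo, ← abs_lt, ← sq_lt_one_iff_abs_lt_one]
    linarith [hu s hs]
  · rw [hsine s hs]
    exact (hasDerivAt_z (hsub hs)).const_mul σ
  · rw [hlam s hs, hsine s hs]
    refine (hasDerivAt_dx (hsub hs)).congr_deriv ?_
    have h1 := hu s hs
    have h2 := dx_mul_ddx (hsub hs)
    have h3 := (hrel s hs).2
    rw [profCurv] at h3
    linear_combination (-S.ddx s) * h1 + S.dx s * h2 - S.dz s * h3
  · rw [hlam s hs]
    exact (hrel s hs).1

end RotSurface

/-! ### Rotational surfaces of given profile -/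

section

variable {B : EReal} {p : ℝ → ℝ} {J : Set ℝ} {x z c : ℝ → ℝ}

theorem IsProfile.hasDerivAt_sine (h : IsProfile B p J x z c) {s : ℝ} (hs : s ∈ J) :
    HasDerivAt (fun s => sine (c s)) (-c s * p (sine (c s) / x s)) s := by
  refine ((Weingarten.hasDerivAt_sine (h.c_mem s hs)).comp s
    (h.hasDerivAt_c s hs)).congr_deriv ?_
  have := (sine_pos (h.c_mem s hs)).ne'
  field_simp

/-- The rotational surface whose profile is given, up to a reflection in a horizontal plane if
`σ = -1`. -/
theorem IsProfile.exists_rotSurface (hp : IsRate B p) (h : IsProfile B p J x z c) {σ : ℝ}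
    (hσ : σ = 1 ∨ σ = -1) :
    ∃ T : RotSurface, T.J = J ∧ T.x = x ∧ (T.z = fun s => σ * z s) ∧
      ∀ s ∈ J, T.dz s = σ * sine (c s) ∧ T.rotCurv s = σ * (sine (c s) / x s) ∧
        T.profCurv s = -σ * p (sine (c s) / x s) := by
  have hσ2 : σ ^ 2 = 1 := by rcases hσ with rfl | rfl <;> norm_num
  have hz : ∀ s ∈ J, HasDerivAt (fun s => σ * z s) (σ * sine (c s)) s := fun s hs =>
    (h.hasDerivAt_z s hs).const_mul σ
  have hzz : ∀ s ∈ J, HasDerivAt (fun s => σ * sine (c s))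
      (σ * (-c s * p (sine (c s) / x s))) s := fun s hs => (h.hasDerivAt_sine hs).const_mul σ
  have hcc : ContinuousOn c J := fun s hs => (h.hasDerivAt_c s hs).continuousAt.continuousWithinAt
  have hxc : ContinuousOn x J := fun s hs => (h.hasDerivAt_x s hs).continuousAt.continuousWithinAt
  have hsc : ContinuousOn (fun s => sine (c s)) J := continuous_sine.comp_continuousOn hcc
  have hpc : ContinuousOn (fun s => p (sine (c s) / x s)) J :=
    hp.cont.comp (hsc.div hxc fun s hs => (h.x_pos s hs).ne') h.mem
  have ex : ∀ s ∈ J, derivWithin x J s = c s := fun s hs =>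
    (h.hasDerivAt_x s hs).hasDerivWithinAt.derivWithin (h.isOpen.uniqueDiffWithinAt hs)
  have ez : ∀ s ∈ J, derivWithin (fun s => σ * z s) J s = σ * sine (c s) := fun s hs =>
    (hz s hs).hasDerivWithinAt.derivWithin (h.isOpen.uniqueDiffWithinAt hs)
  have exx : ∀ s ∈ J, derivWithin (derivWithin x J) J s =
      p (sine (c s) / x s) * sine (c s) := fun s hs => by
    rw [derivWithin_congr ex (ex s hs)]
    exact (h.hasDerivAt_c s hs).hasDerivWithinAt.derivWithin (h.isOpen.uniqueDiffWithinAt hs)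
  have ezz : ∀ s ∈ J, derivWithin (derivWithin (fun s => σ * z s) J) J s =
      σ * (-c s * p (sine (c s) / x s)) := fun s hs => by
    rw [derivWithin_congr ez (ez s hs)]
    exact (hzz s hs).hasDerivWithinAt.derivWithin (h.isOpen.uniqueDiffWithinAt hs)
  obtain ⟨a, ha⟩ := h.nonempty
  refine ⟨⟨J, x, fun s => σ * z s, h.ordConnected, ?_,
    contDiffOn_two_of_hasDerivAt h.isOpen h.hasDerivAt_x h.hasDerivAt_c (hpc.mul hsc),
    contDiffOn_two_of_hasDerivAt h.isOpen hz hzz (continuousOn_const.mul (hcc.neg.mul hpc)),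
    fun s hs => (h.x_pos s hs).le, fun s hs => ?_, fun s hs _ => ?_, fun s hs h0 => ?_⟩,
    rfl, rfl, rfl, fun s hs => ⟨ez s hs, ?_, ?_⟩⟩
  · obtain ⟨e, he, hball⟩ := Metric.isOpen_iff.1 h.isOpen a ha
    exact ⟨a, ha, a + e / 2, hball (by simp [abs_of_pos, he]), by linarith⟩
  · rw [ex s hs, ez s hs, mul_pow, hσ2, sine_sq (h.c_mem s hs)]
    ring
  · rwa [h.isOpen.interior_eq]
  · exact absurd h0 (h.x_pos s hs).ne'
  · change derivWithin (fun s => σ * z s) J s / x s = _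
    rw [ez s hs, mul_div_assoc]
  · change derivWithin (derivWithin (fun s => σ * z s) J) J s * derivWithin x J s -
      derivWithin (derivWithin x J) J s * derivWithin (fun s => σ * z s) J s = _
    rw [ezz s hs, exx s hs, ex s hs, ez s hs]
    have := sine_sq (h.c_mem s hs)
    linear_combination (-σ * p (sine (c s) / x s)) * this

end

/-! ### Elliptic classes of umbilical constant `0` -/

namespace EllipticClass

variable {W : EllipticClass}

theorem continuousOn_g (hα : W.α = 0) : ContinuousOn W.g (Ici 0) :=
  hα ▸ W.contDiffOn.continuousOn

theorem hasDerivWithinAt_g (hα : W.α = 0) {t : ℝ} (ht : 0 ≤ t) :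
    HasDerivWithinAt W.g (derivWithin W.g (Ici 0) t) (Ici 0) t := by
  have := W.contDiffOn.differentiableOn (by norm_num)
  rw [hα] at this
  exact (this t ht).hasDerivWithinAt

theorem derivWithin_g_neg (hα : W.α = 0) {t : ℝ} (ht : 0 ≤ t) :
    derivWithin W.g (Ici 0) t < 0 := by
  have := W.deriv_neg t (by rw [hα]; exact ht)
  rwa [hα] at this

theorem hasDerivAt_g (hα : W.α = 0) {t : ℝ} (ht : 0 < t) :
    HasDerivAt W.g (derivWithin W.g (Ici 0) t) t :=
  (hasDerivWithinAt_g hα ht.le).hasDerivAt (Ici_mem_nhds ht)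

theorem strictAntiOn_g (hα : W.α = 0) : StrictAntiOn W.g (Ici 0) := by
  refine strictAntiOn_of_deriv_neg (convex_Ici 0) (continuousOn_g hα) fun t ht => ?_
  rw [interior_Ici] at ht
  rw [(hasDerivAt_g hα ht).deriv]
  exact derivWithin_g_neg hα (le_of_lt ht)

theorem g_zero (hα : W.α = 0) : W.g 0 = 0 := by
  have := W.fixed
  rwa [hα] at this

/-- Monotonicity is known only on `[0, ∞)`, so `g` is replaced by `g (max t 0)`. The resulting limit
also identifies the `limUnder` in the definition of `b`. -/
theorem tendsto_b (hα : W.α = 0) : Tendsto (fun t : ℝ => (W.g t : EReal)) atTop (𝓝 W.b) := by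
  have hanti : Antitone fun t : ℝ => ((W.g (max t 0) : ℝ) : EReal) := fun s t hst =>
    EReal.coe_le_coe_iff.2 ((strictAntiOn_g hα).antitoneOn (le_max_right s 0) (le_max_right t 0)
      (max_le_max_right 0 hst))
  have h : Tendsto (fun t : ℝ => (W.g t : EReal)) atTop
      (𝓝 (⨅ t : ℝ, ((W.g (max t 0) : ℝ) : EReal))) := by
    refine (tendsto_atTop_iInf hanti).congr' ?_
    filter_upwards [eventually_ge_atTop 0] with t ht
    rw [max_eq_left ht]
  rw [b, h.limUnder_eq]
  exact h

theorem b_lt_g (hα : W.α = 0) {t : ℝ} (ht : 0 ≤ t) : W.b < W.g t := by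
  have h1 : W.b ≤ W.g (t + 1) := by
    refine le_of_tendsto (tendsto_b hα) ?_
    filter_upwards [eventually_ge_atTop (t + 1)] with u hu
    exact EReal.coe_le_coe_iff.2 ((strictAntiOn_g hα).antitoneOn
      (show (0 : ℝ) ≤ t + 1 by linarith) (show (0 : ℝ) ≤ u by linarith) hu)
  exact h1.trans_lt (EReal.coe_lt_coe_iff.2 (strictAntiOn_g hα ht
    (show (0 : ℝ) ≤ t + 1 by linarith) (lt_add_one t)))

theorem b_neg (hα : W.α = 0) : W.b < 0 := by
  have := b_lt_g hα le_rfl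
  rwa [g_zero hα, EReal.coe_zero] at this

theorem exists_g_eq (hα : W.α = 0) {y : ℝ} (hy : W.b < y) (hy0 : y ≤ 0) :
    ∃ t, 0 ≤ t ∧ W.g t = y := by
  obtain ⟨t, ht, ht0⟩ := (((tendsto_b hα).eventually (gt_mem_nhds hy)).and
    (eventually_ge_atTop 0)).exists
  obtain ⟨u, hu, huy⟩ := intermediate_value_Icc' ht0
    ((continuousOn_g hα).mono Icc_subset_Ici_self)
    ⟨(EReal.coe_lt_coe_iff.1 ht).le, hy0.trans (g_zero hα).ge⟩
  exact ⟨u, hu.1, huy⟩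

theorem g_neg (hα : W.α = 0) {t : ℝ} (ht : 0 < t) : W.g t < 0 := by
  rw [← g_zero hα]
  exact strictAntiOn_g hα self_mem_Ici ht.le ht

theorem g_nonpos (hα : W.α = 0) {t : ℝ} (ht : 0 ≤ t) : W.g t ≤ 0 := by
  rw [← g_zero hα]
  exact (strictAntiOn_g hα).antitoneOn self_mem_Ici ht ht

theorem f_of_nonneg (hα : W.α = 0) {t : ℝ} (ht : 0 ≤ t) : W.f t = W.g t := by
  rw [f, if_pos (hα.le.trans ht)]

theorem f_g (hα : W.α = 0) {t : ℝ} (ht : 0 ≤ t) : W.f (W.g t) = t := by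
  rcases ht.eq_or_lt with rfl | ht
  · rw [g_zero hα, f_of_nonneg hα le_rfl, g_zero hα]
  · rw [f, if_neg (by rw [hα]; exact not_le.2 (g_neg hα ht)), hα]
    exact (strictAntiOn_g hα).injOn.leftInvOn_invFunOn ht.le

/-- If `l` is the larger curvature, then `l ≥ 0` and `k = g(l)`; if `k` is, then `l = g(k)` and `k =
g⁻¹(l)`. In both cases `k = f(l)`, which removes the ordering. -/
theorem relation_iff (hα : W.α = 0) {k l : ℝ} :
    (0 ≤ max k l ∧ min k l = W.g (max k l)) ↔ (W.b < l ∧ k = W.f l) := by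
  constructor
  · rintro ⟨h0, h⟩
    rcases le_total k l with hkl | hkl
    · rw [max_eq_right hkl] at h0 h
      rw [min_eq_left hkl] at h
      exact ⟨(b_neg hα).trans_le (by exact_mod_cast h0), by rw [f_of_nonneg hα h0, h]⟩
    · rw [max_eq_left hkl] at h0 h
      rw [min_eq_right hkl] at h
      rw [h]
      exact ⟨b_lt_g hα h0, (f_g hα h0).symm⟩
  · rintro ⟨hb, rfl⟩
    rcases le_total 0 l with hl | hl
    · have := g_nonpos hα hl
      rw [f_of_nonneg hα hl, max_eq_right (this.trans hl), min_eq_left (this.trans hl)]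
      exact ⟨hl, rfl⟩
    · obtain ⟨t, ht, rfl⟩ := exists_g_eq hα hb hl
      rw [f_g hα ht, max_eq_left (hl.trans ht), min_eq_right (hl.trans ht)]
      exact ⟨ht, rfl⟩

theorem exists_linear_g (hα : W.α = 0) : ∃ k K δ : ℝ, 0 < k ∧ 0 < K ∧ 0 < δ ∧
    ∀ t, 0 < t → t ≤ δ → k * t ≤ -W.g t ∧ -W.g t ≤ K * t := by
  have hd := derivWithin_g_neg hα le_rfl
  have h := hasDerivWithinAt_g hα le_rfl
  rw [← hasDerivWithinAt_Ioi_iff_Ici, hasDerivWithinAt_iff_tendsto_slope' (by simp)] at h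
  set d := derivWithin W.g (Ici 0) 0
  -- The slopes of `g` at `0` tend to `d = g'(0) < 0`, so eventually lie between `2d` and `d/2`.
  have h2 := h.eventually (Ioo_mem_nhds (show 2 * d < d by linarith)
    (show d < d / 2 by linarith))
  obtain ⟨δ, hδ, hsub⟩ := (mem_nhdsGT_iff_exists_Ioc_subset).1 h2
  refine ⟨-(d / 2), -(2 * d), δ, by linarith, by linarith, hδ, fun t ht htδ => ?_⟩
  have := hsub ⟨ht, htδ⟩
  simp only [slope_def_field, g_zero hα, sub_zero, mem_ofPred_eq] at this
  rw [lt_div_iff₀ ht, div_lt_iff₀ ht] at this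
  constructor <;> linarith [this.1, this.2]

theorem mem_posBelow_neg_b (hα : W.α = 0) {y : ℝ} (hy : y ∈ posBelow (-W.b)) :
    ∃ t, 0 < t ∧ y = -W.g t := by
  have : W.b < ((-y : ℝ) : EReal) := by
    rw [EReal.coe_neg]
    exact EReal.lt_neg_comm.1 hy.2
  obtain ⟨t, ht, hty⟩ := exists_g_eq hα this (neg_nonpos.2 hy.1.le)
  refine ⟨t, lt_of_le_of_ne ht ?_, by linarith⟩
  rintro rfl
  rw [g_zero hα] at hty
  linarith [hy.1]

theorem neg_g_mem_posBelow (hα : W.α = 0) {t : ℝ} (ht : 0 < t) : -W.g t ∈ posBelow (-W.b) := by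
  refine ⟨neg_pos.2 (g_neg hα ht), ?_⟩
  rw [EReal.coe_neg]
  exact EReal.neg_lt_neg_iff.2 (b_lt_g hα ht.le)

theorem isRate_plus (hα : W.α = 0) : IsRate ⊤ (fun t => -W.f t) where
  pos_B := by simp
  cont := ((continuousOn_g hα).mono fun t ht => ht.1.le).neg.congr
    fun t ht => by rw [f_of_nonneg hα ht.1.le]; rfl
  pos t ht := by
    rw [f_of_nonneg hα ht.1.le]
    exact neg_pos.2 (g_neg hα ht.1)
  mono a ha b hb hab := by
    simp only [f_of_nonneg hα ha.1.le, f_of_nonneg hα hb.1.le]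
    exact neg_le_neg ((strictAntiOn_g hα).antitoneOn ha.1.le hb.1.le hab)
  linear := by
    obtain ⟨k, K, δ, hk, hK, hδ, h⟩ := exists_linear_g hα
    refine ⟨k, K, δ, hk, hK, ⟨hδ, EReal.coe_lt_top _⟩, fun t ht htδ => ?_⟩
    rw [f_of_nonneg hα ht.le]
    exact h t ht htδ
  blowup h := absurd rfl h

/-- For negative curvatures `p` inverts `-g`: writing `y = -g(t)`, one has `p(y) = t`. Monotonicity,
the linear bounds with reciprocal constants and the blow-up are read off in the variable `t`. -/
theorem isRate_minus (hα : W.α = 0) : IsRate (-W.b) (fun t => W.f (-t)) where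
  pos_B := by
    have := EReal.neg_lt_neg_iff.2 (b_neg hα)
    rwa [neg_zero] at this
  cont := by
    obtain ⟨-, -, k, hk, hk'⟩ := exists_inverse isOpen_Ioi ordConnected_Ioi
      (h := fun t => -W.g t) (fun t ht => (hasDerivAt_g hα ht).neg)
      (fun t (ht : 0 < t) => neg_pos.2 (derivWithin_g_neg hα ht.le))
    refine ContinuousOn.congr (f := k) (fun y hy => ?_) fun y hy => ?_
    · obtain ⟨t, ht, rfl⟩ := mem_posBelow_neg_b hα hy
      exact (hk' _ ⟨t, ht, rfl⟩).continuousAt.continuousWithinAt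
    · obtain ⟨t, ht, rfl⟩ := mem_posBelow_neg_b hα hy
      rw [hk t ht, neg_neg, f_g hα ht.le]
  pos y hy := by
    obtain ⟨t, ht, rfl⟩ := mem_posBelow_neg_b hα hy
    rwa [neg_neg, f_g hα ht.le]
  mono a ha b hb hab := by
    obtain ⟨t, ht, rfl⟩ := mem_posBelow_neg_b hα ha
    obtain ⟨u, hu, rfl⟩ := mem_posBelow_neg_b hα hb
    simp only [neg_neg, f_g hα ht.le, f_g hα hu.le]
    exact ((strictAntiOn_g hα).le_iff_ge hu.le ht.le).1 (by linarith)
  linear := by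
    obtain ⟨k, K, δ, hk, hK, hδ, h⟩ := exists_linear_g hα
    refine ⟨K⁻¹, k⁻¹, -W.g δ, inv_pos.2 hK, inv_pos.2 hk, neg_g_mem_posBelow hα hδ,
      fun y hy hyδ => ?_⟩
    obtain ⟨t, ht, rfl⟩ := mem_posBelow_neg_b hα
      (mem_posBelow_of_le (neg_g_mem_posBelow hα hδ) hy hyδ)
    have htδ : t ≤ δ := ((strictAntiOn_g hα).le_iff_ge hδ.le ht.le).1 (by linarith)
    obtain ⟨h1, h2⟩ := h t ht htδ
    rw [neg_neg, f_g hα ht.le, inv_mul_le_iff₀ hK, le_inv_mul_iff₀ hk]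
    exact ⟨h2, h1⟩
  blowup _ M := by
    have h1 : (0 : ℝ) < max M 1 := lt_max_of_lt_right one_pos
    refine ⟨_, neg_g_mem_posBelow hα h1, ?_⟩
    rw [neg_neg, f_g hα h1.le]
    exact le_max_left _ _

theorem neg_b_eq_top_iff : -W.b = ⊤ ↔ W.b = ⊥ := by
  rw [EReal.neg_eq_top_iff]

end EllipticClass

open EllipticClass

/-- The two components of `(b, ∞) \ {0}` carry independent primitives; `t ↦ -t` brings the negative
one to `(0, -b)`, where `𝓖(-t)` is minus the positive function `gFun`. -/
theorem IsGFunction.exists_isPrim {W : EllipticClass} (hα : W.α = 0) {G : ℝ → ℝ}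
    (hG : IsGFunction W G) : ∃ F₁ F₂ : ℝ → ℝ,
      IsPrim ⊤ (fun t => -W.f t) F₁ ∧ IsPrim (-W.b) (fun t => W.f (-t)) F₂ ∧
      (FiniteAtTop G ↔ ∃ L, ∀ t ∈ posBelow ⊤, gFun F₁ t ≤ L) ∧
      (FiniteAtB W G ↔ ∃ L, ∀ t ∈ posBelow (-W.b), gFun F₂ t ≤ L) := by
  obtain ⟨F, hF⟩ := hG
  have hpos : ∀ t : ℝ, 0 < t → W.b < t := fun t ht =>
    (b_neg hα).trans (by exact_mod_cast ht)
  have hneg : ∀ t ∈ posBelow (-W.b), W.b < ((-t : ℝ) : EReal) := fun t ht => by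
    rw [EReal.coe_neg]
    exact EReal.lt_neg_comm.1 ht.2
  have h₁ : IsPrim ⊤ (fun t => -W.f t) F := fun t ht => by
    refine (hF t (hpos t ht.1) (by rw [hα]; exact ht.1.ne')).1.congr_deriv ?_
    rw [one_div, ← inv_neg]
    congr 1
    ring
  have h₂ : IsPrim (-W.b) (fun t => W.f (-t)) (fun t => F (-t)) := fun t ht => by
    refine ((hF (-t) (hneg t ht) (by rw [hα]; linarith [ht.1])).1.scomp t
      (hasDerivAt_neg t)).congr_deriv ?_
    simp
  refine ⟨F, fun t => F (-t), h₁, h₂, ?_, ?_⟩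
  · rw [← exists_tendsto_atBelow_iff (isRate_plus hα).pos_B
      (h₁.strictMonoOn_gFun (isRate_plus hα)).monotoneOn, FiniteAtTop, atTop_eq_atBelow_top]
    refine exists_congr fun L => tendsto_congr' ?_
    filter_upwards [eventually_atBelow (B := ⊤) (t := 0) (by simp)] with t ht
    rw [(hF t (hpos t ht.1) (by rw [hα]; exact ht.1.ne')).2, gFun]
  · rw [← exists_tendsto_atBelow_iff (isRate_minus hα).pos_B
      (h₂.strictMonoOn_gFun (isRate_minus hα)).monotoneOn, FiniteAtB]
    change (∃ L, Tendsto G (atAbove W.b) (𝓝 L)) ↔ _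
    have hev : ∀ᶠ t in atBelow (-W.b), gFun (fun t => F (-t)) t = -G (-t) := by
      filter_upwards [eventually_atBelow (B := -W.b) (t := 0) (isRate_minus hα).pos_B] with t ht
      rw [(hF (-t) (hneg t ht) (by rw [hα]; linarith [ht.1])).2, gFun]
      ring
    constructor
    · rintro ⟨L, hL⟩
      exact ⟨-L, (hL.comp (tendsto_neg_atBelow W.b)).neg.congr' (hev.mono fun t ht => ht.symm)⟩
    · rintro ⟨L, hL⟩
      refine ⟨-L, ?_⟩
      have := ((hL.congr' hev).comp (tendsto_neg_atAbove W.b)).neg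
      refine this.congr fun t => ?_
      simp

/-! ### Both signs of the rotational curvature -/

/-- The end of the range of `|λ|` for `λ` of sign `σ`. -/
def EllipticClass.bound (W : EllipticClass) (σ : ℝ) : EReal := if σ = 1 then ⊤ else -W.b

/-- The function `p` with `f(λ) = -σ p(σ λ)` for `λ` of sign `σ`. -/
def EllipticClass.rate (W : EllipticClass) (σ : ℝ) (t : ℝ) : ℝ := -σ * W.f (σ * t)

section

variable {W : EllipticClass} {σ : ℝ}

theorem EllipticClass.bound_one : W.bound 1 = ⊤ := if_pos rfl

theorem EllipticClass.bound_neg_one : W.bound (-1) = -W.b := if_neg (by norm_num)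

theorem EllipticClass.rate_one : W.rate 1 = fun t => -W.f t := by
  ext t; simp [rate]

theorem EllipticClass.rate_neg_one : W.rate (-1) = fun t => W.f (-t) := by
  ext t; simp [rate]

theorem EllipticClass.isRate (hα : W.α = 0) (hσ : σ = 1 ∨ σ = -1) :
    IsRate (W.bound σ) (W.rate σ) := by
  rcases hσ with rfl | rfl
  · rw [bound_one, rate_one]
    exact isRate_plus hα
  · rw [bound_neg_one, rate_neg_one]
    exact isRate_minus hα

theorem EllipticClass.mul_mem_posBelow (hσ : σ = 1 ∨ σ = -1) {l : ℝ} (hl : W.b < l)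
    (h : 0 < σ * l) : σ * l ∈ posBelow (W.bound σ) := by
  refine ⟨h, ?_⟩
  rcases hσ with rfl | rfl
  · rw [bound_one]
    exact EReal.coe_lt_top _
  · rw [bound_neg_one, neg_one_mul, EReal.coe_neg]
    exact EReal.neg_lt_neg_iff.2 hl

theorem EllipticClass.b_lt_mul (hα : W.α = 0) (hσ : σ = 1 ∨ σ = -1) {t : ℝ}
    (ht : t ∈ posBelow (W.bound σ)) : W.b < ((σ * t : ℝ) : EReal) := by
  rcases hσ with rfl | rfl
  · rw [one_mul]
    exact (b_neg hα).trans (by exact_mod_cast ht.1)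
  · rw [bound_neg_one] at ht
    rw [neg_one_mul, EReal.coe_neg]
    exact EReal.lt_neg_comm.1 ht.2

theorem EllipticClass.f_mul (hσ : σ = 1 ∨ σ = -1) (t : ℝ) : W.f (σ * t) = -σ * W.rate σ t := by
  rcases hσ with rfl | rfl <;> simp [rate]

theorem EllipticClass.f_eq (hσ : σ = 1 ∨ σ = -1) (l : ℝ) : W.f l = -σ * W.rate σ (σ * l) := by
  rcases hσ with rfl | rfl <;> simp [rate]

theorem EllipticClass.f_zero (hα : W.α = 0) : W.f 0 = 0 := by
  rw [f_of_nonneg hα le_rfl, g_zero hα]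

namespace RotSurface

variable {S : RotSurface}

theorem inClass_iff (hα : W.α = 0) : S.InClass W ↔ ∀ s ∈ S.J, 0 < S.x s →
    W.b < S.rotCurv s ∧ S.profCurv s = W.f (S.rotCurv s) := by
  refine forall₃_congr fun s hs hx => ?_
  have h := fun θ => kappa_eq (S.mem_interior s hs hx) hx θ
  rw [← relation_iff hα]
  constructor
  · intro H
    have := H 0
    rwa [(h 0).1, (h 0).2, hα] at this
  · intro H θ
    rwa [(h θ).1, (h θ).2, hα]

/-! ### Points on the axis -/

/-- Restricted to a line through the origin, the function is even and differentiable. -/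
theorem hasDerivAt_radial {w : ℝ → ℝ}
    (hw : ContDiffAt ℝ 2 (fun p : EuclideanSpace ℝ (Fin 2) => w ‖p‖) 0) :
    HasDerivAt (fun r : ℝ => w |r|) 0 0 := by
  let e : EuclideanSpace ℝ (Fin 2) := EuclideanSpace.single 0 1
  have hd : DifferentiableAt ℝ (fun r : ℝ => w |r|) 0 := by
    have h1 : DifferentiableAt ℝ (fun p : EuclideanSpace ℝ (Fin 2) => w ‖p‖) ((0 : ℝ) • e) := by
      rw [zero_smul]
      exact hw.differentiableAt (by norm_num)
    have h2 := h1.comp (0 : ℝ) (f := fun r : ℝ => r • e) (by fun_prop)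
    refine h2.congr_of_eventuallyEq (Eventually.of_forall fun r => ?_)
    simp [e, norm_smul]
  have h1 := hd.hasDerivAt
  have h2 : HasDerivAt (fun r : ℝ => w |r|) (-deriv (fun r : ℝ => w |r|) 0) 0 := by
    have := HasDerivAt.scomp (h := Neg.neg) (g₁ := fun r : ℝ => w |r|) (0 : ℝ)
      (by rw [neg_zero]; exact h1) (hasDerivAt_neg 0)
    simp only [neg_smul, one_smul] at this
    refine this.congr_of_eventuallyEq (Eventually.of_forall fun r => ?_)
    simp
  have h3 : deriv (fun r : ℝ => w |r|) 0 = 0 := by linarith [h1.unique h2]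
  rwa [h3] at h1

theorem dz_eq_zero_of_axis {s : ℝ} (hs : s ∈ S.J) (h0 : S.x s = 0) : S.dz s = 0 := by
  obtain ⟨w, hw, hz⟩ := S.regular_on_axis s hs h0
  have h1 := hasDerivAt_radial hw
  have h4 : HasDerivWithinAt S.z (0 * S.dx s) S.J s := by
    have := HasDerivAt.comp_hasDerivWithinAt s (h₂ := fun r : ℝ => w |r|)
      (by rw [h0]; exact h1) (S.hasDerivWithinAt_x hs)
    refine this.congr_of_eventuallyEq_of_mem ?_ hs
    filter_upwards [hz, self_mem_nhdsWithin] with t ht htJ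
    simp only [Function.comp, abs_of_nonneg (S.nonneg t htJ), ht]
  rw [zero_mul] at h4
  exact (S.uniqueDiffOn s hs).eq_deriv _ (S.hasDerivWithinAt_z hs) h4

/-- An interior point on the axis would minimize `x`, so `x' = 0`; but the tangent is horizontal on
the axis, contradicting unit speed. -/
theorem pos_of_mem_interior {s : ℝ} (hs : s ∈ interior S.J) : 0 < S.x s := by
  have hsJ := interior_subset hs
  refine lt_of_le_of_ne (S.nonneg s hsJ) fun h0 => ?_
  have hmin : IsLocalMin S.x s := by
    filter_upwards [mem_interior_iff_mem_nhds.1 hs] with t ht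
    rw [← h0]
    exact S.nonneg t ht
  have h1 := hmin.hasDerivAt_eq_zero (hasDerivAt_x hs)
  have h2 := dx_sq_add_dz_sq hsJ
  rw [h1, dz_eq_zero_of_axis hsJ h0.symm] at h2
  norm_num at h2

/-! ### Sign of the rotational curvature -/

/-- On a compact arc `σλ` has a maximum, which lies inside `(0, B)` if positive, and up to it `p`
has a linear bound. The two signs of `λ` are treated separately. -/
theorem exists_abs_profCurv_le (hα : W.α = 0) (hS : S.InClass W) {a b : ℝ} (hab : a ≤ b)
    (hsub : Icc a b ⊆ interior S.J) :
    ∃ K, 0 ≤ K ∧ ∀ s ∈ Icc a b, |S.profCurv s| ≤ K * |S.rotCurv s| := by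
  rw [inClass_iff hα] at hS
  have hcont : ContinuousOn S.rotCurv (Icc a b) :=
    (continuousOn_rotCurv fun s hs => pos_of_mem_interior hs).mono hsub
  have key : ∀ σ : ℝ, (σ = 1 ∨ σ = -1) → ∃ K, 0 ≤ K ∧ ∀ s ∈ Icc a b, 0 < σ * S.rotCurv s →
      |S.profCurv s| ≤ K * |S.rotCurv s| := by
    intro σ hσ
    have hσ1 : |σ| = 1 := by rcases hσ with rfl | rfl <;> simp
    obtain ⟨m, hm, hmax⟩ := isCompact_Icc.exists_isMaxOn (nonempty_Icc.2 hab)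
      (continuousOn_const.mul hcont : ContinuousOn (fun s => σ * S.rotCurv s) (Icc a b))
    by_cases h0 : 0 < σ * S.rotCurv m
    · have hr := isRate hα hσ
      obtain ⟨K, hK, H⟩ := hr.exists_le_mul (mul_mem_posBelow hσ (hS m (interior_subset (hsub hm))
        (pos_of_mem_interior (hsub hm))).1 h0)
      refine ⟨K, hK.le, fun s hs h => ?_⟩
      obtain ⟨h1, h2⟩ := hS s (interior_subset (hsub hs)) (pos_of_mem_interior (hsub hs))
      have h3 := hr.pos _ (mul_mem_posBelow hσ h1 h)
      have h4 := H _ h (hmax hs)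
      have h5 : |S.rotCurv s| = σ * S.rotCurv s := by
        rw [← abs_of_pos h, abs_mul, hσ1, one_mul]
      rw [h2, f_eq hσ, abs_mul, abs_neg, hσ1, one_mul, abs_of_pos h3, h5]
      exact h4
    · exact ⟨0, le_rfl, fun s hs h => absurd (h.trans_le (hmax hs)) h0⟩
  obtain ⟨K₁, hK₁, H₁⟩ := key 1 (Or.inl rfl)
  obtain ⟨K₂, hK₂, H₂⟩ := key (-1) (Or.inr rfl)
  refine ⟨K₁ + K₂, add_nonneg hK₁ hK₂, fun s hs => ?_⟩
  have hn := abs_nonneg (S.rotCurv s)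
  rcases lt_trichotomy (S.rotCurv s) 0 with h | h | h
  · have := H₂ s hs (by linarith)
    nlinarith
  · rw [(hS s (interior_subset (hsub hs)) (pos_of_mem_interior (hsub hs))).2, h, f_zero hα]
    simp
  · have := H₁ s hs (by linarith)
    nlinarith

/-- By the Codazzi equation and `|k| ≤ K|λ|`, `λ` solves a linear equation with bounded coefficient
on a compact arc, so uniqueness compares it with the zero solution. -/
theorem rotCurv_eq_zero (hα : W.α = 0) (hS : S.InClass W) {s₁ s₂ : ℝ} (h₁ : s₁ ∈ interior S.J)
    (h₂ : s₂ ∈ interior S.J) (h0 : S.rotCurv s₁ = 0) : S.rotCurv s₂ = 0 := by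
  have hex : ∀ s ∈ interior S.J, ∃ e > 0, s - e ∈ interior S.J ∧ s + e ∈ interior S.J := by
    intro s hs
    obtain ⟨e, he, hball⟩ := Metric.isOpen_iff.1 isOpen_interior s hs
    exact ⟨e / 2, half_pos he, hball (by simp [abs_of_pos, he]), hball (by simp [abs_of_pos, he])⟩
  obtain ⟨a, b, ha, hb, h1, h2⟩ : ∃ a b, a ∈ interior S.J ∧ b ∈ interior S.J ∧
      s₁ ∈ Ioo a b ∧ s₂ ∈ Ioo a b := by
    obtain ⟨e₁, he₁, h11, h12⟩ := hex s₁ h₁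
    obtain ⟨e₂, he₂, h21, h22⟩ := hex s₂ h₂
    rcases le_total s₁ s₂ with h | h
    · exact ⟨s₁ - e₁, s₂ + e₂, h11, h22, ⟨by linarith, by linarith⟩, by linarith, by linarith⟩
    · exact ⟨s₂ - e₂, s₁ + e₁, h21, h12, ⟨by linarith, by linarith⟩, by linarith, by linarith⟩
  have hab : a ≤ b := (h1.1.trans h1.2).le
  have hsub : Icc a b ⊆ interior S.J := ordConnected_interior.out ha hb
  obtain ⟨K, hK, H⟩ := exists_abs_profCurv_le hα hS hab hsub
  have hxc : ContinuousOn S.x (Icc a b) := fun s hs =>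
    (hasDerivAt_x (hsub hs)).continuousAt.continuousWithinAt
  obtain ⟨m, hm, hmin⟩ := isCompact_Icc.exists_isMinOn (nonempty_Icc.2 hab) hxc
  have hxm := pos_of_mem_interior (hsub hm)
  let d : ℝ → ℝ := fun s => S.dx s * (S.profCurv s - S.rotCurv s) / S.x s
  have hd : ∀ s ∈ Icc a b, |d s| ≤ (K + 1) / S.x m * |S.rotCurv s| := by
    intro s hs
    have hx := pos_of_mem_interior (hsub hs)
    have h3 : |S.dx s| ≤ 1 := by
      rw [← sq_le_one_iff_abs_le_one]
      nlinarith [dx_sq_add_dz_sq (interior_subset (hsub hs)), sq_nonneg (S.dz s)]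
    have h4 : |S.profCurv s - S.rotCurv s| ≤ (K + 1) * |S.rotCurv s| :=
      (abs_sub _ _).trans (by linarith [H s hs])
    simp only [d]
    rw [abs_div, abs_mul, abs_of_pos hx, div_mul_eq_mul_div]
    refine div_le_div₀ (by positivity) ?_ hxm (hmin hs)
    calc |S.dx s| * |S.profCurv s - S.rotCurv s| ≤ 1 * ((K + 1) * |S.rotCurv s|) :=
          mul_le_mul h3 h4 (abs_nonneg _) zero_le_one
      _ = _ := one_mul _
  have hL : 0 ≤ (K + 1) / S.x m := by positivity
  -- The coefficient is `λ'/λ`. Where `λ = 0` the division gives `0`, which is consistent because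
  -- `λ'` vanishes there too.
  have := ODE_solution_unique_of_mem_Ioo (v := fun t y => d t / S.rotCurv t * y)
    (s := fun _ => univ) (K := ⟨(K + 1) / S.x m, hL⟩) (f := S.rotCurv) (g := fun _ => 0)
    (a := a) (b := b) (t₀ := s₁) (fun t ht => ?_) h1 (fun t ht => ⟨?_, mem_univ _⟩)
    (fun t ht => ⟨by simpa using hasDerivAt_const t (0 : ℝ), mem_univ _⟩) h0
  · exact this h2
  · refine LipschitzWith.lipschitzOnWith (LipschitzWith.of_dist_le_mul fun y y' => ?_)
    rw [Real.dist_eq, Real.dist_eq, ← mul_sub, abs_mul]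
    refine mul_le_mul_of_nonneg_right ?_ (abs_nonneg _)
    rw [abs_div]
    exact div_le_of_le_mul₀ (abs_nonneg _) hL (hd t (Ioo_subset_Icc_self ht))
  · have htI := Ioo_subset_Icc_self ht
    refine (hasDerivAt_rotCurv (hsub htI) (pos_of_mem_interior (hsub htI))).congr_deriv ?_
    by_cases hz : S.rotCurv t = 0
    · have := hd t htI
      rw [hz, abs_zero, mul_zero] at this
      have h5 : d t = 0 := abs_nonpos_iff.1 this
      simp only [hz, mul_zero]
      simpa only [d, hz] using h5
    · exact (div_mul_cancel₀ (d t) hz).symm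

theorem exists_sign_of_ne_zero {J : Set ℝ} (hJ : J.OrdConnected) {f : ℝ → ℝ}
    (hf : ContinuousOn f J) (h0 : ∀ s ∈ J, f s ≠ 0) :
    ∃ σ : ℝ, (σ = 1 ∨ σ = -1) ∧ ∀ s ∈ J, 0 < σ * f s := by
  by_cases h : ∃ s ∈ J, 0 < f s
  · obtain ⟨a, ha, hpos⟩ := h
    refine ⟨1, Or.inl rfl, fun s hs => ?_⟩
    by_contra hneg
    obtain ⟨t, ht, ht0⟩ := hJ.isPreconnected.intermediate_value hs ha hf
      ⟨by linarith, hpos.le⟩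
    exact h0 t ht ht0
  · push Not at h
    exact ⟨-1, Or.inr rfl, fun s hs => by
      have := lt_of_le_of_ne (h s hs) (h0 s hs)
      linarith⟩

/-- At a point on the axis `z' = 0` and `x' ≠ 0`, so `λ = z'/x` has the finite limit `z''/x'`. Hence
`F(λ)` is bounded below and `x = C exp F(λ)` cannot tend to `0`. -/
theorem not_axis (hα : W.α = 0) (hσ : σ = 1 ∨ σ = -1)
    (hP : IsProfile (W.bound σ) (W.rate σ) (interior S.J) S.x (fun s => σ * S.z s) S.dx)
    (hsine : ∀ s ∈ interior S.J, sine (S.dx s) = σ * S.dz s) {s₀ : ℝ} (hs₀ : s₀ ∈ S.J) :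
    S.x s₀ ≠ 0 := by
  intro h0
  have hr := isRate hα hσ
  obtain ⟨F, hF⟩ := hr.exists_isPrim
  obtain ⟨C, hC, H⟩ := hP.exists_const hr hF
  have hdz0 := dz_eq_zero_of_axis hs₀ h0
  have hdx0 : S.dx s₀ ≠ 0 := by
    intro h
    have := dx_sq_add_dz_sq hs₀
    rw [h, hdz0] at this
    norm_num at this
  have hle : 𝓝[interior S.J] s₀ ≤ 𝓝[S.J \ {s₀}] s₀ := nhdsWithin_mono _ fun s hs =>
    ⟨interior_subset hs, by rintro rfl; exact (pos_of_mem_interior hs).ne' h0⟩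
  -- L'Hôpital's rule: since `z'` and `x` vanish at `s₀`, `z'/x` is a quotient of difference
  -- quotients.
  have hlim : Tendsto (fun s => σ * (slope S.dz s₀ s / slope S.x s₀ s)) (𝓝[interior S.J] s₀)
      (𝓝 (σ * (S.ddz s₀ / S.dx s₀))) :=
    (((hasDerivWithinAt_iff_tendsto_slope.1 (S.hasDerivWithinAt_dz hs₀)).div
      (hasDerivWithinAt_iff_tendsto_slope.1 (S.hasDerivWithinAt_x hs₀)) hdx0).const_mul
        σ).mono_left hle
  have hlam : ∀ᶠ s in 𝓝[interior S.J] s₀,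
      sine (S.dx s) / S.x s < |σ * (S.ddz s₀ / S.dx s₀)| + 1 := by
    filter_upwards [hlim.eventually (gt_mem_nhds (show σ * (S.ddz s₀ / S.dx s₀) <
      |σ * (S.ddz s₀ / S.dx s₀)| + 1 by linarith [le_abs_self (σ * (S.ddz s₀ / S.dx s₀))])),
      self_mem_nhdsWithin] with s hs hsJ
    have hne : s - s₀ ≠ 0 := by
      intro h
      rw [sub_eq_zero] at h
      subst h
      exact (pos_of_mem_interior hsJ).ne' h0
    rw [slope_def_field, slope_def_field, hdz0, h0, sub_zero, sub_zero,
      div_div_div_cancel_right₀ hne] at hs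
    rwa [hsine s hsJ, mul_div_assoc]
  have hbelow : ∃ m, ∀ᶠ s in 𝓝[interior S.J] s₀, m ≤ F (sine (S.dx s) / S.x s) := by
    by_cases hB : W.bound σ = ⊤
    · refine ⟨F (|σ * (S.ddz s₀ / S.dx s₀)| + 1), ?_⟩
      filter_upwards [hlam, self_mem_nhdsWithin] with s hs hsJ
      refine hF.antitoneOn hr (hP.mem s hsJ) ⟨by positivity, ?_⟩ hs.le
      rw [hB]
      exact EReal.coe_lt_top _
    · obtain ⟨m, hm⟩ := hF.exists_le hr hB
      refine ⟨m, ?_⟩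
      filter_upwards [self_mem_nhdsWithin] with s hs using hm _ (hP.mem s hs)
  obtain ⟨m, hm⟩ := hbelow
  have hconv : Convex ℝ S.J := S.interval.convex
  have hne : (𝓝[interior S.J] s₀).NeBot := by
    rw [← mem_closure_iff_nhdsWithin_neBot,
      hconv.closure_interior_eq_closure_of_nonempty_interior S.interior_nonempty]
    exact subset_closure hs₀
  have hx0 : Tendsto S.x (𝓝[interior S.J] s₀) (𝓝 0) := by
    rw [← h0]
    exact (S.hasDerivWithinAt_x hs₀).continuousWithinAt.mono_left
      (nhdsWithin_mono _ interior_subset)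
  have := ge_of_tendsto hx0 (b := C * Real.exp m) (by
    filter_upwards [hm, self_mem_nhdsWithin] with s hs hsJ
    rw [(H s hsJ).1]
    exact mul_le_mul_of_nonneg_left (Real.exp_le_exp.2 hs) hC.le)
  exact absurd this (not_le.2 (mul_pos hC (Real.exp_pos m)))

/-- A surface of the class is horizontal, or its profile does not meet the axis and its rotational
curvature has a sign. -/
theorem dz_eq_zero_or_isProfile (hα : W.α = 0) (hS : S.InClass W) :
    (∀ s ∈ S.J, S.dz s = 0) ∨ ∃ σ : ℝ, (σ = 1 ∨ σ = -1) ∧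
      IsProfile (W.bound σ) (W.rate σ) S.J S.x (fun s => σ * S.z s) S.dx ∧
      ∀ s ∈ S.J, sine (S.dx s) = σ * S.dz s := by
  have hS' := (inClass_iff hα).1 hS
  by_cases h : ∃ s ∈ interior S.J, S.rotCurv s = 0
  · obtain ⟨s₁, h₁, h0⟩ := h
    refine Or.inl fun s hs => ?_
    rcases (S.nonneg s hs).eq_or_lt with hx | hx
    · exact dz_eq_zero_of_axis hs hx.symm
    · have := rotCurv_eq_zero hα hS h₁ (S.mem_interior s hs hx) h0
      rwa [rotCurv, div_eq_zero_iff, or_iff_left hx.ne'] at this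
  · push Not at h
    right
    obtain ⟨σ, hσ, hsign⟩ := exists_sign_of_ne_zero ordConnected_interior
      (continuousOn_rotCurv fun s hs => pos_of_mem_interior hs) h
    obtain ⟨hP, hsine⟩ := S.isProfile hσ (B := W.bound σ) (p := W.rate σ) isOpen_interior
      ordConnected_interior S.interior_nonempty Subset.rfl (fun s hs => pos_of_mem_interior hs)
      fun s hs => by
        obtain ⟨h1, h2⟩ := hS' s (interior_subset hs) (pos_of_mem_interior hs)
        exact ⟨mul_mem_posBelow hσ h1 (hsign s hs), by rw [h2, ← f_eq hσ]⟩
    have hJ : interior S.J = S.J := Subset.antisymm interior_subset fun s hs =>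
      S.mem_interior s hs (lt_of_le_of_ne (S.nonneg s hs) (not_axis hα hσ hP hsine hs).symm)
    rw [hJ] at hP hsine
    exact ⟨σ, hσ, hP, hsine⟩

end RotSurface

end

section

variable {W : EllipticClass} {σ : ℝ}

namespace RotSurface

variable {S T : RotSurface}

/-! ### Planes -/

/-- Unit speed forces `x' = ε` with a constant sign `ε`. The sign is kept because it is the
orientation; the plane is the rotation of `s ↦ (εs, z₀)` over the half-line `εs ≥ 0`. -/
theorem exists_plane (h : ∀ s ∈ S.J, S.dz s = 0) :
    ∃ T : RotSurface, T.IsPlane ∧ S.IsOpenPiece T := by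
  obtain ⟨s₀, hs₀⟩ := S.nontrivial.nonempty
  have hdx : ∀ s ∈ S.J, S.dx s ^ 2 = 1 := fun s hs => by
    have := dx_sq_add_dz_sq hs
    rwa [h s hs, zero_pow two_ne_zero, add_zero] at this
  obtain ⟨ε, hε, hsign⟩ := exists_sign_of_ne_zero S.interval (f := S.dx)
    (fun s hs => (S.hasDerivWithinAt_dx hs).continuousWithinAt) fun s hs h0 => by
      have := hdx s hs
      rw [h0] at this
      norm_num at this
  have hε2 : ε * ε = 1 := by rcases hε with rfl | rfl <;> norm_num
  have hdxε : ∀ s ∈ S.J, S.dx s = ε := fun s hs => by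
    have h1 := hsign s hs
    rcases mul_self_eq_one_iff.1 ((sq _).symm.trans (hdx s hs)) with h2 | h2 <;>
      rcases hε with rfl | rfl <;> rw [h2] at h1 ⊢ <;> norm_num at h1
  have hx : ∀ s ∈ S.J, S.x s = ε * (s + ε * (S.x s₀ - ε * s₀)) := fun s hs => by
    have := eq_of_hasDerivWithinAt_zero S.interval (f := fun s => S.x s - ε * s) (fun t ht => by
      refine ((S.hasDerivWithinAt_x ht).sub
        ((hasDerivWithinAt_id t _).const_mul ε)).congr_deriv ?_
      rw [hdxε t ht]
      ring) hs hs₀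
    linear_combination this - (S.x s₀ - ε * s₀) * hε2
  have hz : ∀ s ∈ S.J, S.z s = S.z s₀ := fun s hs =>
    eq_of_hasDerivWithinAt_zero S.interval (fun t ht => by
      have := S.hasDerivWithinAt_z ht
      rwa [h t ht] at this) hs hs₀
  have hmem : ∀ t : ℝ, 0 ≤ t → 0 ≤ ε * (ε * t) := fun t ht => by
    rw [← mul_assoc, hε2, one_mul]
    exact ht
  have hJc : {s : ℝ | 0 ≤ ε * s}.OrdConnected := by
    rcases hε with rfl | rfl
    · simp only [one_mul]
      exact ordConnected_Ici
    · simp only [neg_one_mul, neg_nonneg]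
      exact ordConnected_Iic
  have hJn : {s : ℝ | 0 ≤ ε * s}.Nontrivial := by
    refine ⟨ε * 0, hmem 0 le_rfl, ε * 1, hmem 1 zero_le_one, ?_⟩
    rcases hε with rfl | rfl <;> norm_num
  have hopen : IsOpen {s : ℝ | 0 < ε * s} := isOpen_lt continuous_const (by fun_prop)
  have hint : {s : ℝ | 0 < ε * s} ⊆ interior {s : ℝ | 0 ≤ ε * s} :=
    interior_maximal (fun s (hs : 0 < ε * s) => hs.le) hopen
  have hu : UniqueDiffOn ℝ {s : ℝ | 0 ≤ ε * s} := uniqueDiffOn_convex hJc.convex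
    ⟨ε * 1, hint (by change 0 < ε * (ε * 1); rw [← mul_assoc, hε2]; norm_num)⟩
  refine ⟨⟨{s | 0 ≤ ε * s}, fun s => ε * s, fun _ => S.z s₀, hJc, hJn,
    by fun_prop, contDiffOn_const, fun s hs => hs, fun s hs => ?_, fun s _ hs => hint hs,
    fun s hs h0 => ⟨fun _ => S.z s₀, contDiffAt_const, Eventually.of_forall fun t => rfl⟩⟩,
    ⟨S.z s₀, ?_⟩, ⟨ε * (S.x s₀ - ε * s₀), fun s hs => ⟨?_, hx s hs, hz s hs⟩⟩⟩
  · have e1 : derivWithin (fun s => ε * s) {s | 0 ≤ ε * s} s = ε := by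
      have := ((hasDerivWithinAt_id s {s | 0 ≤ ε * s}).const_mul ε).derivWithin (hu s hs)
      rw [mul_one] at this
      exact this
    rw [e1, derivWithin_fun_const]
    simp only [Pi.zero_apply]
    linear_combination hε2
  · ext q
    constructor
    · rintro ⟨⟨s, θ⟩, -, rfl⟩
      simp [param]
    · intro hq
      have hq' : q 2 = S.z s₀ := hq
      let ζ : ℂ := ⟨q 0, q 1⟩
      refine ⟨(ε * ‖ζ‖, ζ.arg), ⟨hmem _ (norm_nonneg _), mem_univ _⟩, ?_⟩
      ext i
      fin_cases i
      · simp only [param, ← mul_assoc, hε2, one_mul]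
        exact Complex.norm_mul_cos_arg ζ
      · simp only [param, ← mul_assoc, hε2, one_mul]
        exact Complex.norm_mul_sin_arg ζ
      · simp [param, hq']
  · change 0 ≤ ε * (s + ε * (S.x s₀ - ε * s₀))
    rw [← hx s hs]
    exact S.nonneg s hs

/-! ### Surfaces from profiles -/

theorem inClass_of_rate (hα : W.α = 0) (hσ : σ = 1 ∨ σ = -1)
    (h : ∀ s ∈ T.J, ∃ t ∈ posBelow (W.bound σ), T.rotCurv s = σ * t ∧
      T.profCurv s = -σ * W.rate σ t) : T.InClass W := by
  rw [inClass_iff hα]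
  intro s hs _
  obtain ⟨t, ht, h1, h2⟩ := h s hs
  rw [h1, h2, ← f_mul hσ]
  exact ⟨b_lt_mul hα hσ ht, rfl⟩

/-- A `C²` extension would give `u(r) - u(0) = o(r)`, against the linear lower bound. -/
theorem isPinchedCatenoid_of_isGraphTrace (hT : T.InClass W) (hG : IsGraphTrace 0 T.trace) :
    T.IsPinchedCatenoid W := by
  obtain ⟨u, h1, h2, h3, h4, m, hm, h5⟩ := hG
  refine ⟨hT, u, h1, h2, h3, h4, fun hcd => ?_⟩
  have hev := (hasDerivAt_iff_isLittleO.1 (hasDerivAt_radial hcd)).def (half_pos hm)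
  obtain ⟨r, hr, hr1⟩ := ((hev.filter_mono inf_le_left).and
    (Ioo_mem_nhdsGT (zero_lt_one' ℝ))).exists (f := 𝓝[>] 0)
  have h6 := h5 r hr1.1 (by linarith [hr1.2])
  simp only [abs_zero, sub_zero, smul_zero, Real.norm_eq_abs, abs_of_pos hr1.1] at hr h6
  nlinarith [mul_pos hm hr1.1]

theorem isSingularCatenoid_of_isGraphTrace (hT : T.InClass W) {d : ℝ} (hd : 0 < d)
    (hG : IsGraphTrace d T.trace)
    (hb : ∀ M : ℝ, ∃ r₀ > d, ∀ s ∈ T.J, T.x s < r₀ → M ≤ |T.profCurv s|) :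
    T.IsSingularCatenoid W := by
  obtain ⟨u, h1, h2, h3, h4, -⟩ := hG
  refine ⟨hT, d, u, hd, h1, h2, h3, h4, tendsto_atTop.2 fun M => ?_⟩
  -- With `|k| ≥ max M 1` one has `k² ≥ M`.
  obtain ⟨r₀, hr₀, H⟩ := hb (max M 1)
  rw [eventually_inf_principal]
  filter_upwards [preimage_mem_comap (Iio_mem_nhds hr₀)] with s hs hsJ
  have hx : 0 < T.x s := by
    have : (T.x s, T.z s) ∈ T.trace := mem_image_of_mem _ hsJ
    rw [h1] at this
    obtain ⟨r, hr, hrs⟩ := this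
    have hx : r = T.x s := (Prod.ext_iff.1 hrs).1
    exact hx ▸ hd.trans hr
  obtain ⟨e1, e2⟩ := kappa_eq (T.mem_interior s hsJ hx) hx 0
  rw [e1, e2]
  have h5 := H s hsJ hs
  have h6 : max (T.profCurv s) (T.rotCurv s) ^ 2 + min (T.profCurv s) (T.rotCurv s) ^ 2 =
      T.profCurv s ^ 2 + T.rotCurv s ^ 2 := by
    rcases le_total (T.profCurv s) (T.rotCurv s) with h | h
    · rw [max_eq_right h, min_eq_left h]
      ring
    · rw [max_eq_left h, min_eq_right h]
  rw [h6, ← sq_abs (T.profCurv s)]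
  nlinarith [le_max_left M 1, le_max_right M 1, sq_nonneg (T.rotCurv s)]

end RotSurface

section

variable {F : ℝ → ℝ} {C : ℝ} {J : Set ℝ} {x z c : ℝ → ℝ}

theorem IsProfile.exists_surface (hα : W.α = 0) (hσ : σ = 1 ∨ σ = -1)
    (hP : IsProfile (W.bound σ) (W.rate σ) J x z c) :
    ∃ T : RotSurface, T.J = J ∧ T.x = x ∧ (T.z = fun s => σ * z s) ∧ T.InClass W ∧
      T.trace = (fun q => (q.1, σ * q.2)) '' ((fun s => (x s, z s)) '' J) ∧
      ∀ s ∈ J, T.dz s = σ * sine (c s) ∧ T.profCurv s = -σ * W.rate σ (sine (c s) / x s) := by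
  obtain ⟨T, hJ, hx, hz, h⟩ := hP.exists_rotSurface (isRate hα hσ) hσ
  refine ⟨T, hJ, hx, hz, RotSurface.inClass_of_rate hα hσ fun s hs => ?_, ?_,
    fun s hs => ⟨(h s hs).1, (h s hs).2.2⟩⟩
  · rw [hJ] at hs
    exact ⟨_, hP.mem s hs, (h s hs).2⟩
  · rw [RotSurface.trace, image_image, hJ, hx, hz]

theorem image_sign {P : Set (ℝ × ℝ) → Prop} (hσ : σ = 1 ∨ σ = -1) {A : Set (ℝ × ℝ)} (h : P A)
    (hr : P ((fun q => (q.1, -q.2)) '' A)) : P ((fun q => (q.1, σ * q.2)) '' A) := by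
  rcases hσ with rfl | rfl
  · simpa using h
  · simpa using hr

/-- A graph profile generates a pinched or a singular catenoid. -/
theorem IsProfile.exists_catenoid_of_graph (hα : W.α = 0) (hσ : σ = 1 ∨ σ = -1)
    (hP : IsProfile (W.bound σ) (W.rate σ) J x z c) {d : ℝ} (hd : W.bound σ = ⊤ → d = 0)
    (hd' : W.bound σ ≠ ⊤ → 0 < d) (hG : IsGraphTrace d ((fun s => (x s, z s)) '' J))
    (hb : W.bound σ ≠ ⊤ → ∀ M : ℝ, ∃ r₀ > d, ∀ s ∈ J, x s < r₀ →
      M ≤ W.rate σ (sine (c s) / x s)) :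
    ∃ T : RotSurface, T.J = J ∧ T.x = x ∧ (T.z = fun s => σ * z s) ∧
      (W.bound σ = ⊤ → T.IsPinchedCatenoid W) ∧ (W.bound σ ≠ ⊤ → T.IsSingularCatenoid W) := by
  obtain ⟨T, hJ, hx, hz, hT, htr, h⟩ := hP.exists_surface hα hσ
  have hG' : IsGraphTrace d T.trace := by
    rw [htr]
    exact image_sign hσ hG hG.reflect
  refine ⟨T, hJ, hx, hz, fun hB => ?_, fun hB => ?_⟩
  · exact RotSurface.isPinchedCatenoid_of_isGraphTrace hT (hd hB ▸ hG')
  · refine RotSurface.isSingularCatenoid_of_isGraphTrace hT (hd' hB) hG' fun M => ?_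
    obtain ⟨r₀, hr₀, H⟩ := hb hB M
    refine ⟨r₀, hr₀, fun s hs hsr => ?_⟩
    rw [hJ] at hs
    rw [hx] at hsr
    have hσ1 : |σ| = 1 := by rcases hσ with rfl | rfl <;> simp
    rw [(h s hs).2, abs_mul, abs_neg, hσ1, one_mul]
    exact (H s hs hsr).trans (le_abs_self _)

/-- The pinched or singular catenoids of first integral `C`: up to a shift of the arc length,
they contain all profiles `(x, z)` of first integral `C`. -/
theorem exists_graph_surface (hα : W.α = 0) (hσ : σ = 1 ∨ σ = -1)
    (hF : IsPrim (W.bound σ) (W.rate σ) F) (hC : 0 < C)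
    (hlt : ∀ t ∈ posBelow (W.bound σ), C * gFun F t < 1) :
    ∃ l X Z S : ℝ → ℝ, IsModel (W.bound σ) (W.rate σ) F C (graphDomain (W.bound σ) F C) l X Z S ∧
      ∀ z₀, (∃ T : RotSurface, (∀ c ∈ graphDomain (W.bound σ) F C,
          S c ∈ T.J ∧ T.x (S c) = X c ∧ T.z (S c) = σ * (z₀ + Z c)) ∧
        (W.bound σ = ⊤ → T.IsPinchedCatenoid W) ∧ (W.bound σ ≠ ⊤ → T.IsSingularCatenoid W)) ∧
      ∃ T : RotSurface, (∀ c ∈ graphDomain (W.bound σ) F C,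
          -S c ∈ T.J ∧ T.x (-S c) = X c ∧ T.z (-S c) = σ * -(z₀ + Z c)) ∧
        (W.bound σ = ⊤ → T.IsPinchedCatenoid W) ∧ (W.bound σ ≠ ⊤ → T.IsSingularCatenoid W) := by
  obtain ⟨l, X, Z, S, h, d, hd, hd', hXD, hG, hb⟩ := hF.exists_graph (isRate hα hσ) hC hlt
  refine ⟨l, X, Z, S, h, fun z₀ => ?_⟩
  obtain ⟨k, hk, hQ⟩ := h.exists_isProfile (isRate hα hσ) z₀
  have htr : (fun s => (X (k s), z₀ + Z (k s))) '' (S '' graphDomain (W.bound σ) F C) =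
      (fun c => (X c, z₀ + Z c)) '' graphDomain (W.bound σ) F C := by
    rw [image_image]
    exact image_congr fun c hc => by rw [hk c hc]
  have hbl : W.bound σ ≠ ⊤ → ∀ M : ℝ, ∃ r₀ > d, ∀ s ∈ S '' graphDomain (W.bound σ) F C,
      X (k s) < r₀ → M ≤ W.rate σ (sine (k s) / X (k s)) := by
    intro hB M
    obtain ⟨r₀, hr₀, H⟩ := hb hB M
    refine ⟨r₀, hr₀, ?_⟩
    rintro _ ⟨c, hc, rfl⟩ hlt
    rw [hk c hc] at hlt ⊢
    rw [h.sine_div_X hc]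
    exact H c hc hlt
  constructor
  · obtain ⟨T, hJ, hx, hz, hT⟩ := hQ.exists_catenoid_of_graph hα hσ hd hd' (htr ▸ hG z₀) hbl
    refine ⟨T, fun c hc => ⟨hJ ▸ mem_image_of_mem S hc, ?_, ?_⟩, hT⟩
    · simp only [hx, hk c hc]
    · simp only [hz, hk c hc]
  -- The second surface is traversed towards the axis, to match profiles with `x' < 0`.
  · have htr' : (fun s => (X (k (-s)), -(z₀ + Z (k (-s))))) ''
        (Neg.neg ⁻¹' (S '' graphDomain (W.bound σ) F C)) = (fun q => (q.1, -q.2)) ''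
        ((fun c => (X c, z₀ + Z c)) '' graphDomain (W.bound σ) F C) := by
      rw [← htr, Set.neg_preimage, ← Set.image_neg_eq_neg]
      simp only [image_image, neg_neg]
    obtain ⟨T, hJ, hx, hz, hT⟩ := hQ.reverse.exists_catenoid_of_graph hα hσ hd hd'
      (htr' ▸ (hG z₀).reflect) fun hB M => by
        obtain ⟨r₀, hr₀, H⟩ := hbl hB M
        refine ⟨r₀, hr₀, fun s hs hlt => ?_⟩
        rw [sine_neg]
        exact H _ hs hlt
    refine ⟨T, fun c hc => ⟨?_, ?_, ?_⟩, hT⟩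
    · rw [hJ, mem_preimage, neg_neg]
      exact mem_image_of_mem S hc
    · simp only [hx, neg_neg, hk c hc]
    · simp only [hz, neg_neg, hk c hc]

end

/-! ### Classification -/

namespace RotSurface

variable {S T : RotSurface}

theorem classification (hα : W.α = 0) (hS : S.InClass W) :
    (∃ T : RotSurface, T.IsPlane ∧ S.IsOpenPiece T) ∨
      (∃ (τ : ℝ) (T : RotSurface), 0 < τ ∧
        (T.IsCatenoidPlus W τ ∨ T.IsCatenoidMinus W τ) ∧ S.IsOpenPiece T) ∨
      (∃ T : RotSurface, T.IsPinchedCatenoid W ∧ S.IsOpenPiece T) ∨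
      (∃ T : RotSurface, T.IsSingularCatenoid W ∧ S.IsOpenPiece T) := by
  rcases dz_eq_zero_or_isProfile hα hS with h | ⟨σ, hσ, hP, -⟩
  · exact Or.inl (exists_plane h)
  have hσ2 : σ * σ = 1 := by rcases hσ with rfl | rfl <;> norm_num
  have hr := isRate hα hσ
  obtain ⟨F, hF⟩ := hr.exists_isPrim
  obtain ⟨C, hC, H⟩ := hP.exists_const hr hF
  -- The dichotomy is whether the sine can reach `1`, that is, whether the curve with this `C` has a
  -- neck.
  by_cases hcase : ∃ t ∈ posBelow (W.bound σ), C * gFun F t = 1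
  · obtain ⟨t, ht, hCt⟩ := hcase
    obtain ⟨l, X, Z, A, hM, hA, τ, hτ, htr⟩ := hF.exists_catenoid hr hC ht hCt
    obtain ⟨a, z₀, hpiece⟩ := hM.exists_shift hr hF hP H hP.c_mem
    obtain ⟨k, hk, hQ⟩ := hM.exists_isProfile hr z₀
    obtain ⟨T, hJ, hx, hz, hT, hTtr, hTs⟩ := hQ.exists_surface hα hσ
    rw [hA] at hJ
    have hcat : T.IsSpecialCatenoid W τ := by
      refine ⟨hT, hJ, ?_⟩
      change IsCatenoidTrace τ T.trace
      have : (fun s => (X (k s), z₀ + Z (k s))) '' (A '' Ioo (-1) 1) =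
          (fun c => (X c, z₀ + Z c)) '' Ioo (-1) 1 := by
        rw [image_image]
        exact image_congr fun c hc => by rw [hk c hc]
      rw [hTtr, this]
      exact image_sign hσ (htr z₀) (htr z₀).reflect
    have hdz : ∀ s, 0 < σ * T.dz s := fun s => by
      have hs : s ∈ A '' Ioo (-1) 1 := hA ▸ mem_univ s
      rw [(hTs s hs).1, ← mul_assoc, hσ2, one_mul]
      exact sine_pos (hQ.c_mem s hs)
    refine Or.inr (Or.inl ⟨τ, T, hτ, ?_, a, fun s hs => ?_⟩)
    · rcases hσ with rfl | rfl
      · exact Or.inl ⟨hcat, fun s _ => by simpa [dz] using hdz s⟩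
      · exact Or.inr ⟨hcat, fun s _ => by simpa [dz] using hdz s⟩
    · obtain ⟨h1, h2, h3⟩ := hpiece s hs
      refine ⟨hJ ▸ mem_univ _, ?_, ?_⟩
      · simp only [hx, ← h1, hk _ (hP.c_mem s hs), h2]
      · simp only [hz, ← h1, hk _ (hP.c_mem s hs)]
        rw [← h3, ← mul_assoc, hσ2, one_mul]
  · have hlt : ∀ t ∈ posBelow (W.bound σ), C * gFun F t < 1 := by
      intro t ht
      by_contra hge
      rw [not_lt, ← div_le_iff₀' hC] at hge
      obtain ⟨u, hu, hu'⟩ := hF.mem_image_gFun hr ht (by positivity) hge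
      exact hcase ⟨u, hu, by rw [hu', mul_one_div, div_self hC.ne']⟩
    have hmem : ∀ s ∈ S.J, sine (S.dx s) / C ∈ gFun F '' posBelow (W.bound σ) := fun s hs =>
      ⟨_, hP.mem s hs, by rw [eq_div_iff hC.ne', mul_comm]; exact (H s hs).2.symm⟩
    -- A vertical tangent would mean `sin = 1 = C 𝓖(λ)`.
    have hne : ∀ s ∈ S.J, S.dx s ≠ 0 := fun s hs h0 => by
      have h1 := (H s hs).2
      rw [h0] at h1
      have h2 := hlt _ (hP.mem s hs)
      rw [h0, ← h1] at h2
      simp [sine] at h2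
    obtain ⟨l, X, Z, A, hM, hsurf⟩ := exists_graph_surface hα hσ hF hC hlt
    have hfin : ∀ T : RotSurface, S.IsOpenPiece T →
        (W.bound σ = ⊤ → T.IsPinchedCatenoid W) ∧ (W.bound σ ≠ ⊤ → T.IsSingularCatenoid W) →
        (∃ T : RotSurface, T.IsPinchedCatenoid W ∧ S.IsOpenPiece T) ∨
        (∃ T : RotSurface, T.IsSingularCatenoid W ∧ S.IsOpenPiece T) := fun T h1 h2 => by
      by_cases hB : W.bound σ = ⊤
      exacts [Or.inl ⟨T, h2.1 hB, h1⟩, Or.inr ⟨T, h2.2 hB, h1⟩]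
    refine Or.inr (Or.inr ?_)
    obtain ⟨ε, hε, hsign⟩ := exists_sign_of_ne_zero S.interval (f := S.dx)
      (fun s hs => (S.hasDerivWithinAt_dx hs).continuousWithinAt) hne
    rcases hε with rfl | rfl
    · have hD : ∀ s ∈ S.J, S.dx s ∈ graphDomain (W.bound σ) F C := fun s hs =>
        ⟨⟨by simpa using hsign s hs, (hP.c_mem s hs).2⟩, hmem s hs⟩
      obtain ⟨a, z₀, hpiece⟩ := hM.exists_shift hr hF hP H hD
      obtain ⟨T, hT, hT'⟩ := (hsurf z₀).1
      refine hfin T ⟨a, fun s hs => ?_⟩ hT'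
      obtain ⟨h1, h2, h3⟩ := hpiece s hs
      obtain ⟨h4, h5, h6⟩ := hT _ (hD s hs)
      rw [h1] at h4 h5 h6
      exact ⟨h4, by rw [h5, h2], by rw [h6, ← h3, ← mul_assoc, hσ2, one_mul]⟩
    -- If `x' < 0`, the reversed and reflected profile has positive cosine and the same `C`.
    · have hD : ∀ s ∈ Neg.neg ⁻¹' S.J, -S.dx (-s) ∈ graphDomain (W.bound σ) F C := fun s hs =>
        ⟨⟨by simpa using hsign _ hs, by linarith [(hP.c_mem _ hs).1]⟩, by
          rw [sine_neg]; exact hmem _ hs⟩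
      obtain ⟨a, z₀, hpiece⟩ := hM.exists_shift hr hF hP.reverse
        (fun s hs => by rw [sine_neg]; exact H _ hs) hD
      obtain ⟨T, hT, hT'⟩ := (hsurf z₀).2
      refine hfin T ⟨-a, fun s hs => ?_⟩ hT'
      have hs' : -s ∈ Neg.neg ⁻¹' S.J := by simpa using hs
      obtain ⟨h1, h2, h3⟩ := hpiece _ hs'
      obtain ⟨h4, h5, h6⟩ := hT _ (hD _ hs')
      rw [neg_neg] at h1 h2 h3 h4 h5 h6
      rw [h1, neg_add, neg_neg] at h4 h5 h6
      exact ⟨h4, by rw [h5, h2], by rw [h6, ← h3, neg_neg, ← mul_assoc, hσ2, one_mul]⟩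

/-! ### Existence -/

theorem exists_of_gFun_le (hα : W.α = 0) (hσ : σ = 1 ∨ σ = -1) {F : ℝ → ℝ}
    (hF : IsPrim (W.bound σ) (W.rate σ) F)
    (hL : ∃ L, ∀ t ∈ posBelow (W.bound σ), gFun F t ≤ L) :
    ∃ T : RotSurface, (W.bound σ = ⊤ → T.IsPinchedCatenoid W) ∧
      (W.bound σ ≠ ⊤ → T.IsSingularCatenoid W) := by
  obtain ⟨L, hL⟩ := hL
  obtain ⟨l, X, Z, A, -, hsurf⟩ := exists_graph_surface hα hσ hF (C := (|L| + 1)⁻¹)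
    (by positivity) fun t ht => by
      rw [inv_mul_lt_iff₀ (by positivity), mul_one]
      linarith [hL t ht, le_abs_self L]
  obtain ⟨T, -, hT⟩ := (hsurf 0).1
  exact ⟨T, hT⟩

theorem IsPinchedCatenoid.exists_isProfile (hα : W.α = 0) (hT : T.IsPinchedCatenoid W) :
    ∃ σ : ℝ, (σ = 1 ∨ σ = -1) ∧ IsProfile (W.bound σ) (W.rate σ) T.J T.x (fun s => σ * T.z s) T.dx ∧
      ∀ ε > 0, ∃ s ∈ T.J, T.x s < ε := by
  obtain ⟨hc, u, htr, -, -, hu, hns⟩ := hT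
  have hval : ∀ r > 0, ∃ s ∈ T.J, T.x s = r ∧ T.z s = u r := fun r hr => by
    have : (r, u r) ∈ T.trace := htr ▸ mem_image_of_mem _ hr
    obtain ⟨s, hs, hsr⟩ := this
    exact ⟨s, hs, (Prod.ext_iff.1 hsr).1, (Prod.ext_iff.1 hsr).2⟩
  rcases dz_eq_zero_or_isProfile hα hc with h | ⟨σ, hσ, hP, -⟩
  · refine absurd ?_ hns
    have hconst : ∀ r > 0, u r = u 1 := fun r hr => by
      obtain ⟨s, hs, -, h1⟩ := hval r hr
      obtain ⟨s', hs', -, h2⟩ := hval 1 one_pos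
      rw [← h1, ← h2]
      exact eq_of_hasDerivWithinAt_zero T.interval (fun t ht => by
        have := T.hasDerivWithinAt_z ht
        rwa [h t ht] at this) hs hs'
    -- A horizontal profile makes `u` constant off `0`, and continuity at `0` then makes the radial
    -- function constant, hence smooth, against the singularity.
    have h0 : u 0 = u 1 := tendsto_nhds_unique (f := u) (l := 𝓝[>] 0) hu
      (tendsto_const_nhds.congr' (by
        filter_upwards [self_mem_nhdsWithin] with r hr using (hconst r hr).symm))
    have : (fun p : EuclideanSpace ℝ (Fin 2) => u ‖p‖) = fun _ => u 1 := by
      funext p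
      rcases (norm_nonneg p).eq_or_lt with h | h
      · rw [← h, h0]
      · exact hconst _ h
    rw [this]
    exact contDiffAt_const
  · refine ⟨σ, hσ, hP, fun ε hε => ?_⟩
    obtain ⟨s, hs, h1, -⟩ := hval (ε / 2) (half_pos hε)
    exact ⟨s, hs, by linarith⟩

/-- Small radii `C exp F(λ)` force `F` to be unbounded below, so `B` is infinite. For each `t` some
point has `F(λ) < F(t)`, that is `λ > t`, whence `C 𝓖(t) < C 𝓖(λ) = sin ≤ 1`. -/
theorem bound_eq_top_of_isProfile (hα : W.α = 0) (hσ : σ = 1 ∨ σ = -1) {F : ℝ → ℝ}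
    (hF : IsPrim (W.bound σ) (W.rate σ) F) {J : Set ℝ} {x z c : ℝ → ℝ}
    (hP : IsProfile (W.bound σ) (W.rate σ) J x z c) (hx : ∀ ε > 0, ∃ s ∈ J, x s < ε) :
    W.bound σ = ⊤ ∧ ∃ L, ∀ t ∈ posBelow (W.bound σ), gFun F t ≤ L := by
  have hr := isRate hα hσ
  obtain ⟨C, hC, H⟩ := hP.exists_const hr hF
  constructor
  · by_contra hB
    obtain ⟨m, hm⟩ := hF.exists_le hr hB
    obtain ⟨s, hs, hlt⟩ := hx (C * Real.exp m) (mul_pos hC (Real.exp_pos m))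
    rw [(H s hs).1] at hlt
    exact absurd hlt (not_lt.2
      (mul_le_mul_of_nonneg_left (Real.exp_le_exp.2 (hm _ (hP.mem s hs))) hC.le))
  · refine ⟨1 / C, fun t ht => ?_⟩
    obtain ⟨s, hs, hlt⟩ := hx (C * Real.exp (F t)) (mul_pos hC (Real.exp_pos _))
    rw [(H s hs).1] at hlt
    have h1 := Real.exp_lt_exp.1 ((mul_lt_mul_iff_right₀ hC).1 hlt)
    have h2 := ((hF.strictAntiOn hr).lt_iff_gt (hP.mem s hs) ht).1 h1
    refine ((hF.strictMonoOn_gFun hr) ht (hP.mem s hs) h2).le.trans ?_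
    rw [le_div_iff₀ hC, mul_comm, ← (H s hs).2]
    exact sine_le_one _

/-- Outside radius `d` one has `|λ| ≤ 1/d`. If `b = -∞`, then `1/d` lies in the domain of `p` for
either sign, so `|k| ≤ p(1/d)` and the curvatures are bounded. -/
theorem IsSingularCatenoid.b_ne_bot (hα : W.α = 0) (hT : T.IsSingularCatenoid W) : W.b ≠ ⊥ := by
  obtain ⟨hc, d, u, hd, htr, -, -, -, hlim⟩ := hT
  have hval : ∀ M : ℝ, ∃ s ∈ T.J, d < T.x s ∧ M < |T.profCurv s| + |T.rotCurv s| := by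
    intro M
    have hev := hlim.eventually_gt_atTop (M ^ 2)
    rw [eventually_inf_principal] at hev
    obtain ⟨U, hU, hUs⟩ := mem_comap.1 hev
    obtain ⟨r, hrU, hr⟩ := (((eventually_mem_set.2 hU).filter_mono inf_le_left).and
      (self_mem_nhdsWithin : Ioi d ∈ 𝓝[>] d)).exists (f := 𝓝[>] d)
    have : (r, u r) ∈ T.trace := htr ▸ mem_image_of_mem _ hr
    obtain ⟨s, hs, hsr⟩ := this
    have hx : T.x s = r := (Prod.ext_iff.1 hsr).1
    have hxd : d < T.x s := by rw [hx]; exact hr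
    refine ⟨s, hs, hxd, ?_⟩
    have h1 := hUs (show T.x s ∈ U by rwa [hx]) hs
    obtain ⟨e1, e2⟩ := kappa_eq (T.mem_interior s hs (hd.trans hxd)) (hd.trans hxd) 0
    rw [e1, e2] at h1
    have h2 : max (T.profCurv s) (T.rotCurv s) ^ 2 + min (T.profCurv s) (T.rotCurv s) ^ 2 =
        T.profCurv s ^ 2 + T.rotCurv s ^ 2 := by
      rcases le_total (T.profCurv s) (T.rotCurv s) with h | h
      · rw [max_eq_right h, min_eq_left h]
        ring
      · rw [max_eq_left h, min_eq_right h]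
    rw [h2] at h1
    refine lt_of_pow_lt_pow_left₀ 2 (by positivity) (h1.trans_le ?_)
    nlinarith [sq_abs (T.profCurv s), sq_abs (T.rotCurv s),
      mul_nonneg (abs_nonneg (T.profCurv s)) (abs_nonneg (T.rotCurv s))]
  have hrel := (inClass_iff hα).1 hc
  rcases dz_eq_zero_or_isProfile hα hc with h | ⟨σ, hσ, hP, hsine⟩
  · obtain ⟨s, hs, hx, h1⟩ := hval 0
    have h2 : T.rotCurv s = 0 := by rw [rotCurv, h s hs, zero_div]
    rw [(hrel s hs (hd.trans hx)).2, h2, f_zero hα] at h1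
    simp at h1
  · intro hb
    have hB : W.bound σ = ⊤ := by
      rcases hσ with rfl | rfl
      · exact bound_one
      · rw [bound_neg_one, hb, EReal.neg_bot]
    have hr := isRate hα hσ
    have hσ1 : |σ| = 1 := by rcases hσ with rfl | rfl <;> simp
    obtain ⟨s, hs, hx, h1⟩ := hval (W.rate σ (1 / d) + 1 / d)
    have h2 : σ * T.rotCurv s = sine (T.dx s) / T.x s := by
      rw [hsine s hs, rotCurv, mul_div_assoc]
    have h3 := hP.mem s hs
    have h4 : sine (T.dx s) / T.x s ≤ 1 / d :=
      div_le_div₀ zero_le_one (sine_le_one _) hd hx.le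
    have h5 := hr.mono h3 ⟨by positivity, by rw [hB]; exact EReal.coe_lt_top _⟩ h4
    have h6 : |T.rotCurv s| = sine (T.dx s) / T.x s := by
      rw [← abs_of_pos h3.1, ← h2, abs_mul, hσ1, one_mul]
    have h7 : |T.profCurv s| = W.rate σ (sine (T.dx s) / T.x s) := by
      rw [(hrel s hs (hd.trans hx)).2, f_eq hσ, h2, abs_mul, abs_neg, hσ1, one_mul,
        abs_of_pos (hr.pos _ h3)]
    rw [h6, h7] at h1
    linarith

theorem existence_iff (hα : W.α = 0) {G : ℝ → ℝ} (hG : IsGFunction W G) :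
    ((∃ T : RotSurface, T.IsPinchedCatenoid W) ↔
        (FiniteAtTop G ∨ (W.b = ⊥ ∧ FiniteAtB W G))) ∧
      ((∃ T : RotSurface, T.IsSingularCatenoid W) ↔ (W.b ≠ ⊥ ∧ FiniteAtB W G)) := by
  obtain ⟨F₁, F₂, hF₁, hF₂, hfin₁, hfin₂⟩ := hG.exists_isPrim hα
  rw [← rate_one, ← bound_one (W := W)] at hF₁
  rw [← bound_one (W := W)] at hfin₁
  rw [← rate_neg_one, ← bound_neg_one] at hF₂
  rw [← bound_neg_one] at hfin₂
  have hbound : W.bound (-1) = ⊤ ↔ W.b = ⊥ := by rw [bound_neg_one, neg_b_eq_top_iff]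
  rw [hfin₁, hfin₂]
  refine ⟨⟨?_, ?_⟩, ⟨?_, ?_⟩⟩
  · rintro ⟨T, hT⟩
    obtain ⟨σ, hσ, hP, hx⟩ := hT.exists_isProfile hα
    rcases hσ with rfl | rfl
    · exact Or.inl (bound_eq_top_of_isProfile hα (Or.inl rfl) hF₁ hP hx).2
    · obtain ⟨h1, h2⟩ := bound_eq_top_of_isProfile hα (Or.inr rfl) hF₂ hP hx
      exact Or.inr ⟨hbound.1 h1, h2⟩
  · rintro (h | ⟨hb, h⟩)
    · obtain ⟨T, hT, -⟩ := exists_of_gFun_le hα (Or.inl rfl) hF₁ h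
      exact ⟨T, hT bound_one⟩
    · obtain ⟨T, hT, -⟩ := exists_of_gFun_le hα (Or.inr rfl) hF₂ h
      exact ⟨T, hT (hbound.2 hb)⟩
  · rintro ⟨T, hT⟩
    have hb := hT.b_ne_bot hα
    -- For finite `b` the boundedness of `𝓖` needs no surface.
    exact ⟨hb, hF₂.exists_gFun_le (isRate hα (Or.inr rfl)) fun h => hb (hbound.1 h)⟩
  · rintro ⟨hb, h⟩
    obtain ⟨T, -, hT⟩ := exists_of_gFun_le hα (Or.inr rfl) hF₂ h
    exact ⟨T, hT fun h => hb (hbound.1 h)⟩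

end RotSurface

end

end

end Weingarten

theorem mainTheorem4 (W : Weingarten.EllipticClass) (hα : W.α = 0) :
    (∀ S : Weingarten.RotSurface, S.InClass W →
      (∃ T : Weingarten.RotSurface, T.IsPlane ∧ S.IsOpenPiece T) ∨
      (∃ (τ : ℝ) (T : Weingarten.RotSurface), 0 < τ ∧
        (T.IsCatenoidPlus W τ ∨ T.IsCatenoidMinus W τ) ∧ S.IsOpenPiece T) ∨
      (∃ T : Weingarten.RotSurface, T.IsPinchedCatenoid W ∧ S.IsOpenPiece T) ∨
      (∃ T : Weingarten.RotSurface, T.IsSingularCatenoid W ∧ S.IsOpenPiece T)) ∧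
    (∀ G : ℝ → ℝ, Weingarten.IsGFunction W G →
      ((∃ T : Weingarten.RotSurface, T.IsPinchedCatenoid W) ↔
        (Weingarten.FiniteAtTop G ∨ (W.b = ⊥ ∧ Weingarten.FiniteAtB W G))) ∧
      ((∃ T : Weingarten.RotSurface, T.IsSingularCatenoid W) ↔
        (W.b ≠ ⊥ ∧ Weingarten.FiniteAtB W G))) :=
  ⟨fun _ hS => Weingarten.RotSurface.classification hα hS,
    fun _ hG => Weingarten.RotSurface.existence_iff hα hG⟩
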